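/- **Setting.** Let $n\ge 1$, let $\Theta\subset\mathbb R^n$ be compact, and let $H$ be a separable complex Hilbert space. Sesquilinear forms are linear in the first and antilinear in the second argument, and $\mathfrak b[u]:=\mathfrak b(u,u)$. For $\theta\in\Theta$ let $a_\theta,b_\theta$ be non-negative sesquilinear forms on $H$ such that $(u,\tilde u)_\theta:=a_\theta(u,\tilde u)+b_\theta(u,\tilde u)$ are inner products on $H$ whose norms $\|\cdot\|_\theta$ are equivalent to the norm of $H$ and satisfy $\|u\|_{\theta_1}\le K\|u\|_{\theta_2}$ for all $u\in H$, $\theta_1,\theta_2\in\Theta$, for some $K>0$. Assume that for some $L_a>0$, $|a_{\theta_1}(u,\tilde u)-a_{\theta_2}(u,\tilde u)|\le L_a|\theta_1-\theta_2|\,\|u\|_{\theta_1}\|\tilde u\|_{\theta_1}$ for all $u,\tilde u\in H$, $\theta_1,\theta_2\in\Theta$. Let $V_\theta:=\{v\in H: a_\theta[v]=0\}$, and let $W_\theta$ be the orthogonal complement of $V_\theta$ with respect to $(\cdot,\cdot)_\theta$. Let $H^*$ be the space of continuous antilinear functionals on $H$, and $\|f\|_{*\theta}:=\sup_{u\ne0}|\langle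 f,u\rangle|/\|u\|_\theta$. For $0<\varepsilon<1$, $\theta\in\Theta$, $f\in H^*$ let $u_{\varepsilon,\theta}\in H$ be the solution of $$\varepsilon^{-2}a_\theta(u_{\varepsilon,\theta},\tilde u)+b_\theta(u_{\varepsilon,\theta},\tilde u)=\langle f,\tilde u\rangle\qquad\forall\,\tilde u\in H. \tag{1}$$ **Hypotheses.** * (H1) For every $\theta\in\Theta$ there is $\nu_\theta>0$ with $a_\theta[w]\ge\nu_\theta\|w\|_\theta^2$ for all $w\in W_\theta$. * (H2) $0$ is an accumulation point of $\Theta$, and there are a closed subspace $V_\star\subset H$ and $L_\star\ge0$ such that, with $V^\star_\theta:=V_\theta$ for $\theta\neq0$ and $V^\star_0:=V_\star$, one has $\inf_{v_2\in V^\star_{\theta_2}}\|v_1-v_2\|_{\theta_2}\le L_\star|\theta_1-\theta_2|\,\|v_1\|_{\theta_1}$ for all $v_1\in V^\star_{\theta_1}$, $\theta_1,\theta_2\in\Theta$. Moreover, $Z$ is a closed subspace of $V_0$ with $V_0=V_\star\dotplus Z$ (direct sum) and, for some $0\le K_Z<1$, $|(v,z)_0|\le K_Z\|v\|_0\|z\|_0$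 for all $v\in V_\star$, $z\in Z$. * (H3) For some $\gamma>0$, $a_\theta[w]\ge\gamma|\theta|^2\|w\|_\theta^2$ for all $w\in W_\theta$, $\theta\in\Theta$. * (H4) $0$ is an interior point of $\Theta$, and there are sesquilinear maps $a_0':V_0\times H\to\mathbb C^n$, $a_0'':V_0\times V_0\to\mathbb C^{n\times n}$ and constants $K_{a'},K_{a''}\ge0$ such that for all $\theta\in\Theta$, $|a_\theta(v,u)-a_0'(v,u)\cdot\theta|\le K_{a'}|\theta|^2\|v\|_0\|u\|_0$ for $v\in V_0$, $u\in H$, and $|a_\theta(v,\tilde v)-a_0''(v,\tilde v)\theta\cdot\theta|\le K_{a''}|\theta|^3\|v\|_0\|\tilde v\|_0$ for $v,\tilde v\in V_0$. * (H5) $\Theta$ is connected and, for some $L_b\ge0$, $|b_\theta(v,\tilde v)-b_0(v,\tilde v)|\le L_b|\theta|\,\|v\|_0\|\tilde v\|_\theta$ for all $v,\tilde v\in V_0$, $\theta\in\Theta$. **Corrector and homogenised form.** For $\theta\in\mathbb R^n$ and $v\in V_0$ let $N_\theta v\in W_0$ be the solution of $a_0(N_\theta v,\tilde w)=-a_0'(v,\tilde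 w)\cdot\theta$ for all $\tilde w\in W_0$, and put $a^h_\theta(v,\tilde v):=a_0''(v,\tilde v)\theta\cdot\theta-a_0(N_\theta v,N_\theta\tilde v)$ for $v,\tilde v\in V_0$. **Transfer operators.** A family of transfer operators with constant $K_b$ is a family of bijections $\mathcal E_\theta:V_\star\to V^\star_\theta$, $\theta\in\Theta$, such that $b_\theta(\mathcal E_\theta v,\mathcal E_\theta\tilde v)=b_0(v,\tilde v)$ for all $v,\tilde v\in V_\star$ and $|b_\theta(\mathcal E_\theta v,z)-b_0(v,z)|\le K_b|\theta|\,\|v\|_0\|z\|_0$ for all $v\in V_\star$, $z\in Z$. **Theorem.** Assume (H1)–(H5). Then the problem defining $N_\theta v$ has a unique solution for all $\theta\in\mathbb R^n$, $v\in V_0$; there is a family of transfer operators with some constant $K_b\ge0$; and for every $K_b$ there are constants $C_9,C_{10}$ such that for every family $(\mathcal E_\theta)_{\theta\in\Theta}$ of transfer operators with constant $K_b$ and all $0<\varepsilon<1$, $\theta\in\Theta$, $f\in H^*$ the following holds. Problem (1) has a unique solution $u_{\varepsilon,\theta}$, there is a unique $v+z\in V_\star\dotplus Z$ (with $v\in V_\star$,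 $z\in Z$) such that $$a^h_{\theta/\varepsilon}(z,\tilde z)+b_0(v+z,\tilde v+\tilde z)=\langle f,\mathcal E_\theta\tilde v+\tilde z\rangle\qquad\forall\,\tilde v\in V_\star,\ \tilde z\in Z,$$ and $$\varepsilon^{-2}a_\theta\big[u_{\varepsilon,\theta}-(\mathcal E_\theta v+(I+N_\theta)z)\big]+b_\theta\big[u_{\varepsilon,\theta}-(\mathcal E_\theta v+(I+N_\theta)z)\big]\le C_9\,\varepsilon^2\|f\|_{*\theta}^2,$$ $$b_\theta\big[u_{\varepsilon,\theta}-(\mathcal E_\theta v+z)\big]\le C_{10}\,\varepsilon^2\|f\|_{*\theta}^2.$$ -/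

import Mathlib

/-- A non-negative sesquilinear form on `H`: linear in the first argument, antilinear in the
second one, and with `form u u` real and non-negative for every `u`. -/
structure NonnegForm (H : Type*) [AddCommGroup H] [Module ℂ H] where
  form : H →ₗ[ℂ] H →ₗ⋆[ℂ] ℂ
  im_self : ∀ u, (form u u).im = 0
  re_self_nonneg : ∀ u, 0 ≤ (form u u).re

namespace NonnegForm

section Basic

variable {H : Type*} [AddCommGroup H] [Module ℂ H]

instance : CoeFun (NonnegForm H) (fun _ => H → H → ℂ) := ⟨fun A u v => A.form u v⟩

/-- The sum of two non-negative forms. -/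
def add (A B : NonnegForm H) : NonnegForm H where
  form := A.form + B.form
  im_self u := by simp [A.im_self u, B.im_self u]
  re_self_nonneg u := by
    simpa using add_nonneg (A.re_self_nonneg u) (B.re_self_nonneg u)

/-- The quadratic form `A[u] = A(u, u)`, as a real number. -/
def quad (A : NonnegForm H) (u : H) : ℝ := (A u u).re

/-- `A[u]^{1/2}`. -/
noncomputable def nrm (A : NonnegForm H) (u : H) : ℝ := Real.sqrt (A.quad u)

/-- If `A[v] = 0`, then `A(v, u) + A(u, v) = 0` for every `u`. -/
theorem add_swap_eq_zero (A : NonnegForm H) {v : H} (hv : A v v = 0) (u : H) :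
    (A v u).re + (A u v).re = 0 := by
  have key : ∀ t : ℝ, 0 ≤ (A u u).re + t * ((A v u).re + (A u v).re) := by
    intro t
    have h := A.re_self_nonneg (u + (t : ℂ) • v)
    simp only [map_add, map_smul, LinearMap.add_apply, LinearMap.smul_apply,
      LinearMap.map_smulₛₗ, smul_eq_mul, Complex.conj_ofReal, Complex.add_re,
      Complex.re_ofReal_mul] at h
    have hv' : (A.form v v).re = 0 := by
      have := congrArg Complex.re hv
      simpa using this
    rw [hv'] at h
    linarith
  by_contra hne
  have h1 := key (-((A u u).re + 1) / ((A v u).re + (A u v).re))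
  rw [div_mul_cancel₀ _ hne] at h1
  linarith

/-- The kernel `{v | A[v] = 0}` of a non-negative form. -/
def ker (A : NonnegForm H) : Submodule ℂ H where
  carrier := {v | A v v = 0}
  zero_mem' := by simp
  add_mem' := by
    intro v w hv hw
    have h1 := A.add_swap_eq_zero hv w
    apply Complex.ext
    · have hv' : (A.form v v).re = 0 := by simpa using congrArg Complex.re hv
      have hw' : (A.form w w).re = 0 := by simpa using congrArg Complex.re hw
      simp only [map_add, LinearMap.add_apply, Complex.add_re, Complex.zero_re]
      linarith
    · exact A.im_self _
  smul_mem' := by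
    intro c v hv
    have hv' : A.form v v = 0 := hv
    simp [hv']

/-- The subspace of all `w` with `A(w, v) = 0` for every `v ∈ V`. -/
def orth (A : NonnegForm H) (V : Submodule ℂ H) : Submodule ℂ H where
  carrier := {w | ∀ v ∈ V, A w v = 0}
  zero_mem' := by intro v _; simp
  add_mem' := by
    intro x y hx hy v hv
    have h1 : A.form x v = 0 := hx v hv
    have h2 : A.form y v = 0 := hy v hv
    simp [h1, h2]
  smul_mem' := by
    intro c x hx v hv
    have h1 : A.form x v = 0 := hx v hv
    simp [h1]

/-- The dual norm `‖f‖_* = sup_{u ≠ 0} |⟨f, u⟩| / A[u]^{1/2}` of an antilinear functional. -/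
noncomputable def dualNorm (A : NonnegForm H) (f : H → ℂ) : ℝ :=
  ⨆ u : {u : H // u ≠ 0}, ‖f u‖ / A.nrm u

end Basic

end NonnegForm

namespace Degenerating

section Setting

variable {n : ℕ} {H : Type*} [NormedAddCommGroup H] [InnerProductSpace ℂ H]

/-- The inner product `(u, v)_θ = a_θ(u, v) + b_θ(u, v)`. -/
def ip (a b : EuclideanSpace ℝ (Fin n) → NonnegForm H) (θ : EuclideanSpace ℝ (Fin n)) :
    NonnegForm H := (a θ).add (b θ)

/-- `W_θ`, the orthogonal complement of `V_θ = ker a_θ` with respect to `(·,·)_θ`. -/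
def WSpace (a b : EuclideanSpace ℝ (Fin n) → NonnegForm H) (θ : EuclideanSpace ℝ (Fin n)) :
    Submodule ℂ H := (ip a b θ).orth (a θ).ker

/-- The standing assumptions: `Θ` is compact, the `(·,·)_θ`, `θ ∈ Θ`, are inner products on `H`
which induce its topology and are uniformly equivalent to each other, and `a_θ` is Lipschitz
in `θ`. -/
structure Standing (Θ : Set (EuclideanSpace ℝ (Fin n)))
    (a b : EuclideanSpace ℝ (Fin n) → NonnegForm H) : Prop where
  isCompact : IsCompact Θ
  equiv_norm : ∀ θ ∈ Θ, ∃ c C : ℝ, 0 < c ∧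
    ∀ u : H, c * ‖u‖ ≤ (ip a b θ).nrm u ∧ (ip a b θ).nrm u ≤ C * ‖u‖
  uniform_equiv : ∃ K : ℝ, 0 < K ∧ ∀ θ₁ ∈ Θ, ∀ θ₂ ∈ Θ, ∀ u : H,
    (ip a b θ₁).nrm u ≤ K * (ip a b θ₂).nrm u
  lipschitz : ∃ La : ℝ, 0 < La ∧ ∀ θ₁ ∈ Θ, ∀ θ₂ ∈ Θ, ∀ u u' : H,
    ‖a θ₁ u u' - a θ₂ u u'‖ ≤ La * ‖θ₁ - θ₂‖ * (ip a b θ₁).nrm u * (ip a b θ₁).nrm u'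

/-- (H1), the pointwise gap condition. -/
def GapCondition (Θ : Set (EuclideanSpace ℝ (Fin n)))
    (a b : EuclideanSpace ℝ (Fin n) → NonnegForm H) : Prop :=
  ∀ θ ∈ Θ, ∃ ν : ℝ, 0 < ν ∧ ∀ w ∈ WSpace a b θ, ν * (ip a b θ).nrm w ^ 2 ≤ (a θ).quad w

open Classical in
/-- `V_θ^⋆`, equal to `V_θ` for `θ ≠ 0` and to `V_⋆` for `θ = 0`. -/
noncomputable def VStar (a : EuclideanSpace ℝ (Fin n) → NonnegForm H) (Vs : Submodule ℂ H)
    (θ : EuclideanSpace ℝ (Fin n)) : Submodule ℂ H :=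
  if θ = 0 then Vs else (a θ).ker

/-- (H2): `V_θ` has a removable singularity at `0`, which is filled by the closed subspace
`V_⋆`. -/
structure RemovableSingularity (Θ : Set (EuclideanSpace ℝ (Fin n)))
    (a b : EuclideanSpace ℝ (Fin n) → NonnegForm H) (Vs : Submodule ℂ H) : Prop where
  accPt : AccPt (0 : EuclideanSpace ℝ (Fin n)) (Filter.principal Θ)
  isClosed : IsClosed (Vs : Set H)
  lipschitz : ∃ Ls : ℝ, 0 ≤ Ls ∧ ∀ θ₁ ∈ Θ, ∀ θ₂ ∈ Θ, ∀ v₁ ∈ VStar a Vs θ₁,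
    (⨅ v₂ : VStar a Vs θ₂, (ip a b θ₂).nrm (v₁ - v₂)) ≤
      Ls * ‖θ₁ - θ₂‖ * (ip a b θ₁).nrm v₁

/-- `Z` is a defect subspace: a closed subspace of `V_0` with `V_0 = V_⋆ ∔ Z`, a direct sum that
satisfies the transversality condition with a constant `K_Z < 1`. -/
structure IsDefectSubspace (a b : EuclideanSpace ℝ (Fin n) → NonnegForm H)
    (Vs : Submodule ℂ H) (Z : Submodule ℂ (a 0).ker) : Prop where
  isClosed : IsClosed (Z : Set (a 0).ker)
  sup_eq : Vs ⊔ Z.map (a 0).ker.subtype = (a 0).ker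
  disjoint : Disjoint Vs (Z.map (a 0).ker.subtype)
  transversal : ∃ KZ : ℝ, 0 ≤ KZ ∧ KZ < 1 ∧ ∀ v ∈ Vs, ∀ z ∈ Z,
    ‖ip a b 0 v z‖ ≤ KZ * (ip a b 0).nrm v * (ip a b 0).nrm z

/-- (H3): the gap degenerates at most quadratically at `0`. -/
def QuadraticGap (Θ : Set (EuclideanSpace ℝ (Fin n)))
    (a b : EuclideanSpace ℝ (Fin n) → NonnegForm H) : Prop :=
  ∃ γ : ℝ, 0 < γ ∧ ∀ θ ∈ Θ, ∀ w ∈ WSpace a b θ,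
    γ * ‖θ‖ ^ 2 * (ip a b θ).nrm w ^ 2 ≤ (a θ).quad w

/-- `x · θ` for `x ∈ ℂⁿ` and `θ ∈ ℝⁿ`. -/
noncomputable def dot (x : Fin n → ℂ) (θ : EuclideanSpace ℝ (Fin n)) : ℂ :=
  ∑ i, x i * (θ i : ℂ)

/-- `M θ · θ` for `M ∈ ℂⁿˣⁿ` and `θ ∈ ℝⁿ`. -/
noncomputable def dot₂ (M : Matrix (Fin n) (Fin n) ℂ) (θ : EuclideanSpace ℝ (Fin n)) : ℂ :=
  ∑ i, (∑ j, M i j * (θ j : ℂ)) * (θ i : ℂ)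

/-- (H4): `0` is an interior point of `Θ`, and the sesquilinear maps `a₀'` and `a₀''` give the
first two terms of the expansion of `a_θ` at `θ = 0` on `V_0`. -/
structure Differentiability (Θ : Set (EuclideanSpace ℝ (Fin n)))
    (a b : EuclideanSpace ℝ (Fin n) → NonnegForm H)
    (a₁ : (a 0).ker →ₗ[ℂ] H →ₗ⋆[ℂ] (Fin n → ℂ))
    (a₂ : (a 0).ker →ₗ[ℂ] (a 0).ker →ₗ⋆[ℂ] Matrix (Fin n) (Fin n) ℂ) : Prop where
  zero_mem_interior : (0 : EuclideanSpace ℝ (Fin n)) ∈ interior Θ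
  first : ∃ K₁ : ℝ, 0 ≤ K₁ ∧ ∀ θ ∈ Θ, ∀ (v : (a 0).ker) (u : H),
    ‖a θ v u - dot (a₁ v u) θ‖ ≤ K₁ * ‖θ‖ ^ 2 * (ip a b 0).nrm v * (ip a b 0).nrm u
  second : ∃ K₂ : ℝ, 0 ≤ K₂ ∧ ∀ θ ∈ Θ, ∀ v v' : (a 0).ker,
    ‖a θ v v' - dot₂ (a₂ v v') θ‖ ≤ K₂ * ‖θ‖ ^ 3 * (ip a b 0).nrm v * (ip a b 0).nrm v'

/-- (H5): `Θ` is connected, and `b_θ` is Lipschitz continuous at `θ = 0` on `V_0`. -/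
structure LipschitzAtZero (Θ : Set (EuclideanSpace ℝ (Fin n)))
    (a b : EuclideanSpace ℝ (Fin n) → NonnegForm H) : Prop where
  isConnected : IsConnected Θ
  lipschitz : ∃ Lb : ℝ, 0 ≤ Lb ∧ ∀ θ ∈ Θ, ∀ v ∈ (a 0).ker, ∀ v' ∈ (a 0).ker,
    ‖b θ v v' - b 0 v v'‖ ≤ Lb * ‖θ‖ * (ip a b 0).nrm v * (ip a b θ).nrm v'

/-- `u` solves `ε⁻² a_θ(u, ·) + b_θ(u, ·) = ⟨f, ·⟩` on `H`. -/
def IsSolution (a b : EuclideanSpace ℝ (Fin n) → NonnegForm H) (ε : ℝ)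
    (θ : EuclideanSpace ℝ (Fin n)) (f : H →L⋆[ℂ] ℂ) (u : H) : Prop :=
  ∀ u' : H, ((ε ^ 2)⁻¹ : ℝ) * a θ u u' + b θ u u' = f u'

/-- `w ∈ W_0` solves the linearised cell problem
`a_0(w, w') = - a₀'(v, w') · θ` for all `w' ∈ W_0`. -/
def IsCellSolution (a b : EuclideanSpace ℝ (Fin n) → NonnegForm H)
    (a₁ : (a 0).ker →ₗ[ℂ] H →ₗ⋆[ℂ] (Fin n → ℂ)) (θ : EuclideanSpace ℝ (Fin n))
    (v : (a 0).ker) (w : H) : Prop :=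
  w ∈ WSpace a b 0 ∧ ∀ w' ∈ WSpace a b 0, a 0 w w' = - dot (a₁ v w') θ

/-- The corrector `N_θ v`: the solution of the linearised cell problem (`0` if there is none). -/
noncomputable def corrector (a b : EuclideanSpace ℝ (Fin n) → NonnegForm H)
    (a₁ : (a 0).ker →ₗ[ℂ] H →ₗ⋆[ℂ] (Fin n → ℂ)) (θ : EuclideanSpace ℝ (Fin n))
    (v : (a 0).ker) : H :=
  open Classical in
  if h : ∃ w, IsCellSolution a b a₁ θ v w then h.choose else 0

/-- The homogenised form `a^h_θ(v, v') = a₀''(v, v') θ · θ - a_0(N_θ v, N_θ v')` on `V_0`. -/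
noncomputable def homForm (a b : EuclideanSpace ℝ (Fin n) → NonnegForm H)
    (a₁ : (a 0).ker →ₗ[ℂ] H →ₗ⋆[ℂ] (Fin n → ℂ))
    (a₂ : (a 0).ker →ₗ[ℂ] (a 0).ker →ₗ⋆[ℂ] Matrix (Fin n) (Fin n) ℂ)
    (θ : EuclideanSpace ℝ (Fin n)) (v v' : (a 0).ker) : ℂ :=
  dot₂ (a₂ v v') θ - a 0 (corrector a b a₁ θ v) (corrector a b a₁ θ v')

/-- `E_θ`, `θ ∈ Θ`, is a family of transfer operators with constant `K_b`: bijections from `V_⋆`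
to `V_θ^⋆` which are isometric from `b_0` to `b_θ` and almost preserve the pairing with `Z`. -/
structure IsTransfer (Θ : Set (EuclideanSpace ℝ (Fin n)))
    (a b : EuclideanSpace ℝ (Fin n) → NonnegForm H) (Vs : Submodule ℂ H)
    (Z : Submodule ℂ (a 0).ker) (Kb : ℝ) (E : EuclideanSpace ℝ (Fin n) → H → H) : Prop where
  bijOn : ∀ θ ∈ Θ, Set.BijOn (E θ) (Vs : Set H) (VStar a Vs θ : Set H)
  isometric : ∀ θ ∈ Θ, ∀ v ∈ Vs, ∀ v' ∈ Vs, b θ (E θ v) (E θ v') = b 0 v v'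
  near : ∀ θ ∈ Θ, ∀ v ∈ Vs, ∀ z ∈ Z,
    ‖b θ (E θ v) z - b 0 v z‖ ≤ Kb * ‖θ‖ * (ip a b 0).nrm v * (ip a b 0).nrm z

/-- `v + z`, with `v ∈ V_⋆` and `z ∈ Z`, solves the approximating problem
`a^h_{θ/ε}(z, z') + b_0(v + z, v' + z') = ⟨f, E_θ v' + z'⟩` for all `v' ∈ V_⋆`, `z' ∈ Z`. -/
structure IsApproxSolution (a b : EuclideanSpace ℝ (Fin n) → NonnegForm H)
    (a₁ : (a 0).ker →ₗ[ℂ] H →ₗ⋆[ℂ] (Fin n → ℂ))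
    (a₂ : (a 0).ker →ₗ[ℂ] (a 0).ker →ₗ⋆[ℂ] Matrix (Fin n) (Fin n) ℂ)
    (Vs : Submodule ℂ H) (Z : Submodule ℂ (a 0).ker)
    (E : EuclideanSpace ℝ (Fin n) → H → H) (ε : ℝ) (θ : EuclideanSpace ℝ (Fin n))
    (f : H →L⋆[ℂ] ℂ) (v : H) (z : (a 0).ker) : Prop where
  left_mem : v ∈ Vs
  right_mem : z ∈ Z
  eqn : ∀ v' ∈ Vs, ∀ z' ∈ Z,
    homForm a b a₁ a₂ (ε⁻¹ • θ) z z' + b 0 (v + z) (v' + z') = f (E θ v' + z')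

end Setting

end Degenerating

/-! The error `r = u - (E_θ v + (I + N_θ) z)` has energy `q = ε⁻² a_θ[r] + b_θ[r]` equal to the
residual of the approximation tested with `r`. So it suffices to bound the residual by a multiple of
`ε ‖f‖ Q` on test elements of energy at most `Q²`; taking `Q` of order `√q` and dividing by `√q`
gives the estimate (`norm_residual_le`, `error_estimates`).

Such a test element is `E_θ v' + z' + w` with `v' ∈ V_⋆`, `z' ∈ Z` and both `‖w‖` and `|θ| ‖z'‖` of
order `ε Q` (`exists_decomposition`): away from `θ = 0` by the gap alone, near it by splitting into
`V_⋆`, `Z`, `W_0` and moving `V_⋆` to `V_θ^⋆`. The approximating problem cancels the main part on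
`E_θ v' + z'`. The rest is small because the corrector removes the first-order part of `a_θ(z, ·)`
on `W_0`, and `a_θ((I + N_θ) z, z')` is `a^h_θ(z, z')` up to third order (`norm_a_corrector_le`,
`norm_a_corrector_sub_homForm_le`). The factor `ε⁻²` is paid for by `|θ|² ‖z‖ ≲ ε² ‖f‖`, a
consequence of the coercivity of `a^h_θ` on `Z` (`homForm_coercive`). That coercivity holds because
`a^h_θ` is quadratic in `θ` and approximates `a_θ[(I + N_θ) z]` for small `θ`, while transversality
keeps `z` away from `V_θ^⋆`, so that (H3) applies.

For transfer operators, the projection between two nearby closed subspaces is bijective, and an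
operator square root corrects it to an isometry (`exists_isometric_bijOn`). Near `θ = 0` the result
is close to the identity. Elsewhere compositions of such maps suffice, since the required bound
costs nothing once `|θ|` is bounded below; connectedness of `Θ` supplies them. -/

namespace NonnegForm

/-! ### Non-negative sesquilinear forms -/

section Algebra

variable {H : Type*} [AddCommGroup H] [Module ℂ H]

/-- Polarisation: reality of the form at `u + v` compares the imaginary parts, at `u + i v` the real
parts. -/
theorem conj_symm (A : NonnegForm H) (u v : H) : starRingEnd ℂ (A.form u v) = A.form v u := by
  have h1 := A.im_self (u + v)
  have h2 := A.im_self (u + Complex.I • v)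
  have hu := A.im_self u
  have hv := A.im_self v
  simp [hu, hv] at h1 h2
  apply Complex.ext
  · simp; linarith
  · simp; linarith

/-- The semidefinite inner product `⟪x, y⟫ = A(y, x)`. -/
abbrev core (A : NonnegForm H) : PreInnerProductSpace.Core ℂ H where
  inner x y := A.form y x
  conj_inner_symm x y := A.conj_symm x y
  re_inner_nonneg x := A.re_self_nonneg x
  add_left x y z := by simp
  smul_left x y r := by simp

theorem nrm_nonneg (A : NonnegForm H) (u : H) : 0 ≤ A.nrm u := Real.sqrt_nonneg _

theorem quad_nonneg (A : NonnegForm H) (u : H) : 0 ≤ A.quad u := A.re_self_nonneg u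

theorem nrm_sq (A : NonnegForm H) (u : H) : A.nrm u ^ 2 = A.quad u :=
  Real.sq_sqrt (A.quad_nonneg u)

theorem self_eq_quad (A : NonnegForm H) (u : H) : A.form u u = (A.quad u : ℂ) :=
  Complex.ext rfl (A.im_self u)

theorem norm_apply_le (A : NonnegForm H) (u v : H) : ‖A.form u v‖ ≤ A.nrm u * A.nrm v := by
  rw [mul_comm]
  let _ := A.core
  exact InnerProductSpace.Core.norm_inner_le_norm (𝕜 := ℂ) v u

theorem quad_add (A : NonnegForm H) (u v : H) :
    A.quad (u + v) = A.quad u + 2 * (A.form u v).re + A.quad v := by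
  have h := congrArg Complex.re (A.conj_symm u v)
  simp only [Complex.conj_re] at h
  simp only [quad, map_add, LinearMap.add_apply, Complex.add_re]
  linarith

theorem quad_add_le (A : NonnegForm H) (u v : H) :
    A.quad (u + v) ≤ 2 * A.quad u + 2 * A.quad v := by
  have h1 := A.quad_add u v
  have h2 := A.quad_add u (-v)
  have h3 := A.quad_nonneg (u + -v)
  have h4 : A.quad (-v) = A.quad v := by simp [quad]
  have h5 : (A.form u (-v)).re = -(A.form u v).re := by simp
  rw [h4, h5] at h2
  linarith

theorem nrm_add_le (A : NonnegForm H) (u v : H) : A.nrm (u + v) ≤ A.nrm u + A.nrm v := by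
  apply Real.sqrt_le_iff.mpr
  refine ⟨add_nonneg (A.nrm_nonneg _) (A.nrm_nonneg _), ?_⟩
  have h := (Complex.re_le_norm _).trans (A.norm_apply_le u v)
  rw [A.quad_add]
  nlinarith [A.nrm_sq u, A.nrm_sq v]

theorem quad_neg (A : NonnegForm H) (u : H) : A.quad (-u) = A.quad u := by simp [quad]

theorem nrm_neg (A : NonnegForm H) (u : H) : A.nrm (-u) = A.nrm u := by
  rw [nrm, nrm, quad_neg]

theorem quad_eq_zero_of_mem_ker (A : NonnegForm H) {v : H} (hv : v ∈ A.ker) : A.quad v = 0 := by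
  have : A.form v v = 0 := hv
  simp [quad, this]

/-- By Cauchy-Schwarz a null vector of the quadratic form is a null vector of the sesquilinear form.
-/
theorem apply_ker_left (A : NonnegForm H) {v : H} (hv : v ∈ A.ker) (u : H) : A.form v u = 0 := by
  have h := A.norm_apply_le v u
  rw [nrm, A.quad_eq_zero_of_mem_ker hv, Real.sqrt_zero, zero_mul] at h
  exact norm_le_zero_iff.mp h

theorem apply_ker_right (A : NonnegForm H) {v : H} (hv : v ∈ A.ker) (u : H) : A.form u v = 0 := by
  rw [← A.conj_symm, A.apply_ker_left hv, map_zero]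

theorem add_apply (A B : NonnegForm H) (u v : H) : (A.add B).form u v = A.form u v + B.form u v := rfl

theorem add_quad (A B : NonnegForm H) (u : H) : (A.add B).quad u = A.quad u + B.quad u := by
  simp [quad, add]

/-- The pull-back of a form along a linear map. -/
def comap {X : Type*} [AddCommGroup X] [Module ℂ X] (A : NonnegForm H) (T : X →ₗ[ℂ] H) :
    NonnegForm X where
  form := LinearMap.mk₂'ₛₗ (RingHom.id ℂ) (starRingEnd ℂ) (fun u v => A.form (T u) (T v))
    (by simp) (by simp) (by simp) (by simp)
  im_self u := A.im_self (T u)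
  re_self_nonneg u := A.re_self_nonneg (T u)

theorem comap_apply {X : Type*} [AddCommGroup X] [Module ℂ X] (A : NonnegForm H)
    (T : X →ₗ[ℂ] H) (u v : X) : (A.comap T).form u v = A.form (T u) (T v) := rfl

theorem comap_quad {X : Type*} [AddCommGroup X] [Module ℂ X] (A : NonnegForm H)
    (T : X →ₗ[ℂ] H) (u : X) : (A.comap T).quad u = A.quad (T u) := rfl

/-- A non-negative multiple of a form. -/
def smul (A : NonnegForm H) (c : ℝ) (hc : 0 ≤ c) : NonnegForm H where
  form := (c : ℂ) • A.form
  im_self u := by simp [A.im_self u]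
  re_self_nonneg u := by simpa using mul_nonneg hc (A.re_self_nonneg u)

theorem smul_apply (A : NonnegForm H) (c : ℝ) (hc : 0 ≤ c) (u v : H) :
    (A.smul c hc).form u v = c * A.form u v := rfl

theorem smul_quad (A : NonnegForm H) (c : ℝ) (hc : 0 ≤ c) (u : H) :
    (A.smul c hc).quad u = c * A.quad u := by
  simp [quad, smul]

end Algebra

end NonnegForm

/-! ### Lax-Milgram and square roots of forms -/

section LaxMilgram

variable {X : Type*} [NormedAddCommGroup X] [InnerProductSpace ℂ X] [CompleteSpace X]

open scoped InnerProductSpace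

/-- A bounded sesquilinear form is represented by a bounded operator. -/
theorem exists_operator_of_bounded (B : X →ₗ[ℂ] X →ₗ⋆[ℂ] ℂ) {C : ℝ}
    (hC : ∀ u v, ‖B u v‖ ≤ C * ‖u‖ * ‖v‖) :
    ∃ G : X →L[ℂ] X, ∀ u v, B u v = ⟪v, G u⟫_ℂ := by
  let B' : X →L⋆[ℂ] X →L[ℂ] ℂ := LinearMap.mkContinuous₂ B.flip C
    (fun v u => by
      calc ‖B u v‖ ≤ C * ‖u‖ * ‖v‖ := hC u v
        _ = C * ‖v‖ * ‖u‖ := by ring)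
  -- `continuousLinearMapOfBilin` puts the operator in the other slot of the inner product, hence
  -- the adjoint.
  refine ⟨(InnerProductSpace.continuousLinearMapOfBilin (𝕜 := ℂ) B').adjoint, fun u v => ?_⟩
  rw [ContinuousLinearMap.adjoint_inner_right,
    InnerProductSpace.continuousLinearMapOfBilin_apply]
  rfl

/-- The Lax-Milgram theorem for complex sesquilinear forms. -/
theorem exists_unique_of_coercive (B : X →ₗ[ℂ] X →ₗ⋆[ℂ] ℂ) {c C : ℝ} (hc : 0 < c)
    (hC : ∀ u v, ‖B u v‖ ≤ C * ‖u‖ * ‖v‖) (hB : ∀ u, c * ‖u‖ ^ 2 ≤ ‖B u u‖)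
    (f : X →ₗ⋆[ℂ] ℂ) {F : ℝ} (hf : ∀ v, ‖f v‖ ≤ F * ‖v‖) :
    ∃! u, ∀ v, B u v = f v := by
  obtain ⟨G, hG⟩ := exists_operator_of_bounded B hC
  have hunit : IsUnit G := by
    refine ContinuousLinearMap.isUnit_of_forall_le_norm_inner_map G (c := ⟨c, hc.le⟩) hc ?_
    intro x
    rw [norm_inner_symm, ← hG, mul_comm]
    exact hB x
  have hbij : Function.Bijective G := ContinuousLinearMap.isUnit_iff_bijective.mp hunit
  let g : X →L[ℂ] ℂ := LinearMap.mkContinuous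
    { toFun := fun v => starRingEnd ℂ (f v)
      map_add' := by intro x y; simp
      map_smul' := by intro r x; simp } F (by intro x; simpa using hf x)
  have hg : ∀ v, f v = ⟪v, (InnerProductSpace.toDual ℂ X).symm g⟫_ℂ := by
    intro v
    rw [← inner_conj_symm, InnerProductSpace.toDual_symm_apply]
    simp [g]
  obtain ⟨u, hu⟩ := hbij.2 ((InnerProductSpace.toDual ℂ X).symm g)
  refine ⟨u, fun v => by rw [hG, hu, hg], fun u' hu' => hbij.1 ?_⟩
  rw [hu]
  refine ext_inner_left ℂ fun v => ?_
  rw [← hG, ← hg, hu']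

/-- A bounded coercive non-negative form is the inner product in suitable coordinates `R`, which
are close to the identity if the form is close to the inner product. -/
theorem NonnegForm.exists_sqrt (D : NonnegForm X) {c C : ℝ} (hc : 0 < c)
    (hC : ∀ u v, ‖D.form u v‖ ≤ C * ‖u‖ * ‖v‖) (hD : ∀ u, c * ‖u‖ ^ 2 ≤ D.quad u) :
    ∃ R : X →L[ℂ] X, Function.Bijective R ∧ (∀ u v, D.form u v = ⟪R v, R u⟫_ℂ) ∧
      ∀ δ : ℝ, (∀ u v, ‖D.form u v - ⟪v, u⟫_ℂ‖ ≤ δ * ‖u‖ * ‖v‖) → ∀ u, ‖R u - u‖ ≤ δ * ‖u‖ := by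
  obtain ⟨G, hG⟩ := exists_operator_of_bounded D.form hC
  have hpos : G.IsPositive := by
    rw [ContinuousLinearMap.isPositive_iff_complex]
    intro x
    have h : ⟪G x, x⟫_ℂ = (D.quad x : ℂ) := by
      rw [← inner_conj_symm, ← hG, D.self_eq_quad, Complex.conj_ofReal]
    rw [h]
    simpa using D.quad_nonneg x
  have hG0 : 0 ≤ G := (ContinuousLinearMap.nonneg_iff_isPositive G).mpr hpos
  have hunit : IsUnit G := by
    refine ContinuousLinearMap.isUnit_of_forall_le_norm_inner_map G (c := ⟨c, hc.le⟩) hc ?_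
    intro x
    have h := (hD x).trans (le_abs_self _)
    rw [norm_inner_symm, ← hG, mul_comm, D.self_eq_quad, Complex.norm_real]
    exact h
  have hR0 : 0 ≤ CFC.sqrt G := CFC.sqrt_nonneg G
  have hRR : CFC.sqrt G * CFC.sqrt G = G := CFC.sqrt_mul_sqrt_self G hG0
  have hRpos : (CFC.sqrt G).IsPositive := (ContinuousLinearMap.nonneg_iff_isPositive _).mp hR0
  have hRunit : IsUnit (CFC.sqrt G) := (CFC.isUnit_sqrt_iff G).mpr hunit
  generalize CFC.sqrt G = R at *
  have hRG : ∀ x, R (R x) = G x := fun x => by rw [← hRR]; rfl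
  have hsymm : ∀ x y, ⟪R x, y⟫_ℂ = ⟪x, R y⟫_ℂ := fun x y => hRpos.isSymmetric x y
  refine ⟨R, ContinuousLinearMap.isUnit_iff_bijective.mp hRunit, ?_, ?_⟩
  · intro u v
    rw [hG, ← hRG, hsymm]
  · intro δ hδ u
    have h1 : ‖G u - u‖ ≤ δ * ‖u‖ := by
      by_cases h0 : ‖G u - u‖ = 0
      · rw [h0]
        by_cases hu : u = 0
        · simp [hu]
        · have := (norm_nonneg _).trans (hδ u u)
          have hu' : 0 < ‖u‖ := norm_pos_iff.mpr hu
          rw [mul_assoc] at this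
          have := nonneg_of_mul_nonneg_left this (by positivity)
          positivity
      · have h := hδ u (G u - u)
        rw [hG, ← inner_sub_right, inner_self_eq_norm_sq_to_K] at h
        have h' : ‖G u - u‖ * ‖G u - u‖ ≤ δ * ‖u‖ * ‖G u - u‖ := by
          simpa [sq] using h
        exact le_of_mul_le_mul_right h' (lt_of_le_of_ne (norm_nonneg _) (Ne.symm h0))
    refine le_trans ?_ h1
    -- Since `G - 1 = (R + 1)(R - 1)` and `R ≥ 0` gives `‖(R + 1) x‖ ≥ ‖x‖`, the root is no further
    -- from the identity than `G` is.
    set x := R u - u with hx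
    have h2 : G u - u = R x + x := by rw [hx, map_sub, hRG]; abel
    rw [h2]
    by_cases h0 : ‖x‖ = 0
    · rw [h0]; positivity
    have h3 : ‖x‖ * ‖x‖ ≤ ‖R x + x‖ * ‖x‖ := by
      have h4 : 0 ≤ (⟪R x, x⟫_ℂ).re := hRpos.re_inner_nonneg_left x
      have h5 := (Complex.re_le_norm _).trans (norm_inner_le_norm (𝕜 := ℂ) (R x + x) x)
      rw [inner_add_left, inner_self_eq_norm_sq_to_K, Complex.add_re] at h5
      have h6 : (((‖x‖ : ℝ) : ℂ) ^ 2).re = ‖x‖ * ‖x‖ := by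
        rw [← Complex.ofReal_pow, Complex.ofReal_re, sq]
      have h7 := h6
      simp at h5 h7
      nlinarith
    exact le_of_mul_le_mul_right h3 (lt_of_le_of_ne (norm_nonneg _) (Ne.symm h0))

end LaxMilgram

open scoped InnerProductSpace

/-! ### Isometries between forms and between nearby subspaces -/

namespace NonnegForm

/-- `A.nrm` is equivalent to the norm of `H`, with constant `M`. -/
structure Equivalent {H : Type*} [NormedAddCommGroup H] [InnerProductSpace ℂ H]
    (A : NonnegForm H) (M : ℝ) : Prop where
  one_le : 1 ≤ M
  norm_le : ∀ u, ‖u‖ ≤ M * A.nrm u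
  nrm_le : ∀ u, A.nrm u ≤ M * ‖u‖

namespace Equivalent

variable {H : Type*} [NormedAddCommGroup H] [InnerProductSpace ℂ H] {A : NonnegForm H} {M : ℝ}

theorem pos (h : A.Equivalent M) : 0 < M := zero_lt_one.trans_le h.one_le

theorem norm_form_le (h : A.Equivalent M) (u v : H) : ‖A.form u v‖ ≤ M ^ 2 * ‖u‖ * ‖v‖ := by
  have := h.pos
  calc ‖A.form u v‖ ≤ A.nrm u * A.nrm v := A.norm_apply_le u v
    _ ≤ (M * ‖u‖) * (M * ‖v‖) :=
        mul_le_mul (h.nrm_le u) (h.nrm_le v) (A.nrm_nonneg v) (by positivity)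
    _ = M ^ 2 * ‖u‖ * ‖v‖ := by ring

theorem coercive (h : A.Equivalent M) (u : H) : (M ^ 2)⁻¹ * ‖u‖ ^ 2 ≤ A.quad u := by
  have := h.pos
  rw [inv_mul_le_iff₀ (by positivity), ← A.nrm_sq, ← mul_pow]
  exact pow_le_pow_left₀ (norm_nonneg u) (h.norm_le u) 2

theorem eq_zero (h : A.Equivalent M) {u : H} (hu : A.quad u = 0) : u = 0 := by
  have := h.norm_le u
  rw [nrm, hu, Real.sqrt_zero, mul_zero] at this
  exact norm_le_zero_iff.mp this

end Equivalent

variable {H : Type*} [NormedAddCommGroup H] [InnerProductSpace ℂ H] [CompleteSpace H]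

/-- Lax-Milgram on a closed subspace. -/
theorem exists_unique_solution (A : NonnegForm H) {V : Submodule ℂ H} (hV : IsClosed (V : Set H))
    {c C : ℝ} (hc : 0 < c) (hC : ∀ u v, ‖A.form u v‖ ≤ C * ‖u‖ * ‖v‖)
    (hA : ∀ u ∈ V, c * ‖u‖ ^ 2 ≤ A.quad u)
    (f : H →ₗ⋆[ℂ] ℂ) {F : ℝ} (hf : ∀ v, ‖f v‖ ≤ F * ‖v‖) :
    ∃! u, u ∈ V ∧ ∀ v ∈ V, A.form u v = f v := by
  have : CompleteSpace V := hV.completeSpace_coe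
  obtain ⟨u, hu, huniq⟩ := exists_unique_of_coercive (A.comap V.subtype).form hc
    (fun u v => hC u v)
    (fun u => by
      rw [self_eq_quad, Complex.norm_real]
      exact (hA u u.2).trans (le_abs_self _)) (f.comp V.subtype) (fun v => hf v)
  refine ⟨u, ⟨u.2, fun v hv => hu ⟨v, hv⟩⟩, fun u' hu' => ?_⟩
  exact congrArg Subtype.val (huniq ⟨u', hu'.1⟩ fun v => hu'.2 v v.2)

/-- The orthogonal projection onto a closed subspace with respect to `A`. -/
theorem exists_proj {A : NonnegForm H} {M : ℝ} (h : A.Equivalent M) {V : Submodule ℂ H}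
    (hV : IsClosed (V : Set H)) :
    ∃ P : H →ₗ[ℂ] V, ∀ u, ∀ v ∈ V, A.form (u - P u) v = 0 := by
  have hM := h.pos
  have key : ∀ u, ∃! p, p ∈ V ∧ ∀ v ∈ V, A.form p v = A.form u v := fun u =>
    A.exists_unique_solution hV (c := (M ^ 2)⁻¹) (by positivity) h.norm_form_le
      (fun v _ => h.coercive v) (A.form u) (h.norm_form_le u)
  choose p hp huniq using key
  refine ⟨{ toFun := fun u => ⟨p u, (hp u).1⟩, map_add' := ?_, map_smul' := ?_ }, ?_⟩
  · intro x y
    refine Subtype.ext (huniq (x + y) _ ⟨V.add_mem (hp x).1 (hp y).1, fun v hv => ?_⟩).symm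
    simp [(hp x).2 v hv, (hp y).2 v hv]
  · intro c x
    refine Subtype.ext (huniq (c • x) _ ⟨V.smul_mem c (hp x).1, fun v hv => ?_⟩).symm
    simp [(hp x).2 v hv]
  · intro u v hv
    simp [(hp u).2 v hv]

section Proj

variable {E : Type*} [AddCommGroup E] [Module ℂ E]

theorem proj_quad_add {A : NonnegForm E} {V : Submodule ℂ E} {P : E →ₗ[ℂ] V}
    (hP : ∀ u, ∀ v ∈ V, A.form (u - P u) v = 0) (u : E) {v : E} (hv : v ∈ V) :
    A.quad (u - v) = A.quad (u - P u) + A.quad (P u - v) := by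
  have h := A.quad_add (u - P u) (P u - v)
  rw [hP u _ (V.sub_mem (P u).2 hv), Complex.zero_re, mul_zero, add_zero, sub_add_sub_cancel] at h
  exact h

theorem nrm_sub_proj_le {A : NonnegForm E} {V : Submodule ℂ E} {P : E →ₗ[ℂ] V}
    (hP : ∀ u, ∀ v ∈ V, A.form (u - P u) v = 0) (u : E) {v : E} (hv : v ∈ V) :
    A.nrm (u - P u) ≤ A.nrm (u - v) := by
  apply Real.sqrt_le_sqrt
  rw [proj_quad_add hP u hv]
  linarith [A.quad_nonneg (P u - v)]

theorem nrm_proj_le {A : NonnegForm E} {V : Submodule ℂ E} {P : E →ₗ[ℂ] V}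
    (hP : ∀ u, ∀ v ∈ V, A.form (u - P u) v = 0) (u : E) : A.nrm (P u) ≤ A.nrm u := by
  apply Real.sqrt_le_sqrt
  have h := proj_quad_add hP u V.zero_mem
  rw [sub_zero, sub_zero] at h
  linarith [A.quad_nonneg (u - P u)]

end Proj

/-- Two forms which are equivalent to the norm are isometric, by a map that is close to the
identity if the forms are close to each other. -/
theorem exists_isometry {A D : NonnegForm H} {M M' : ℝ} (hA : A.Equivalent M)
    (hD : D.Equivalent M') :
    ∃ S : H → H, Function.Bijective S ∧ (∀ u v, D.form (S u) (S v) = A.form u v) ∧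
      ∀ δ : ℝ, δ ≤ 1 / 2 → (∀ u v, ‖D.form u v - A.form u v‖ ≤ δ * A.nrm u * A.nrm v) →
        ∀ u, A.nrm (S u - u) ≤ 2 * δ * A.nrm u := by
  have hM := hA.pos
  have hM' := hD.pos
  obtain ⟨J, hJ, hJA, -⟩ := A.exists_sqrt (c := (M ^ 2)⁻¹) (by positivity) hA.norm_form_le
    hA.coercive
  have hnrm : ∀ u, A.nrm u = ‖J u‖ := by
    intro u
    rw [nrm, quad]
    beta_reduce
    rw [hJA, inner_self_eq_norm_sq_to_K]
    have : (((‖J u‖ : ℝ) : ℂ) ^ 2).re = ‖J u‖ ^ 2 := by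
      rw [← Complex.ofReal_pow, Complex.ofReal_re]
    simp only [Complex.coe_algebraMap]
    rw [this, Real.sqrt_sq (norm_nonneg _)]
  let e : H ≃ₗ[ℂ] H := LinearEquiv.ofBijective J.toLinearMap hJ
  have he : ∀ u, e u = J u := fun u => rfl
  have hes : ∀ x, A.nrm (e.symm x) = ‖x‖ := by
    intro x
    rw [hnrm, ← he, e.apply_symm_apply]
  have hDe : (D.comap e.symm.toLinearMap).Equivalent (M * M') := by
    refine ⟨one_le_mul_of_one_le_of_one_le hA.one_le hD.one_le, fun x => ?_, fun x => ?_⟩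
    · calc ‖x‖ = A.nrm (e.symm x) := (hes x).symm
        _ ≤ M * ‖e.symm x‖ := hA.nrm_le _
        _ ≤ M * (M' * D.nrm (e.symm x)) := by gcongr; exact hD.norm_le _
        _ = M * M' * D.nrm (e.symm x) := by ring
    · calc D.nrm (e.symm x) ≤ M' * ‖e.symm x‖ := hD.nrm_le _
        _ ≤ M' * (M * A.nrm (e.symm x)) := by gcongr; exact hA.norm_le _
        _ = M * M' * ‖x‖ := by rw [hes]; ring
  obtain ⟨R, hR, hRD, hRδ⟩ := (D.comap e.symm.toLinearMap).exists_sqrt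
    (c := ((M * M') ^ 2)⁻¹) (by positivity) hDe.norm_form_le hDe.coercive
  let r : H ≃ₗ[ℂ] H := LinearEquiv.ofBijective R.toLinearMap hR
  have hr : ∀ u, R (r.symm u) = u := fun u => r.apply_symm_apply u
  -- In the coordinates `J` the form `A` is the inner product and `D` has root `R`; thus `J⁻¹ R⁻¹ J`
  -- carries `A` to `D`.
  refine ⟨fun u => e.symm (r.symm (e u)),
    e.symm.bijective.comp (r.symm.bijective.comp e.bijective), ?_, ?_⟩
  · intro u v
    have := hRD (r.symm (e u)) (r.symm (e v))
    rw [hr, hr, he, he, ← hJA] at this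
    exact this
  · intro δ hδ hclose u
    have h1 : ∀ x, ‖R x - x‖ ≤ δ * ‖x‖ := by
      refine hRδ δ fun x y => ?_
      have h := hclose (e.symm x) (e.symm y)
      rw [hes, hes, hJA (e.symm x), ← he, ← he, e.apply_symm_apply, e.apply_symm_apply] at h
      exact h
    have h2 := h1 (r.symm (e u))
    rw [hr] at h2
    have h3 : A.nrm (e.symm (r.symm (e u)) - u) = ‖e u - r.symm (e u)‖ := by
      rw [hnrm, map_sub, ← he, ← he, e.apply_symm_apply, norm_sub_rev]
    have h4 : ‖r.symm (e u)‖ ≤ ‖e u‖ + ‖e u - r.symm (e u)‖ := by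
      have := norm_sub_le (e u) (e u - r.symm (e u))
      rwa [sub_sub_cancel] at this
    have h5 : A.nrm u = ‖e u‖ := hnrm u
    have h0 : 0 ≤ ‖r.symm (e u)‖ := norm_nonneg _
    rw [h3, h5]
    -- With `δ ≤ 1 / 2` the term `δ ‖R⁻¹ J u‖` is absorbed; this is the source of the factor 2 in
    -- the conclusion.
    have h6 : ‖r.symm (e u)‖ ≤ 2 * ‖e u‖ := by nlinarith
    by_cases hδ0 : 0 ≤ δ
    · nlinarith
    · have : ‖r.symm (e u)‖ = 0 := by
        nlinarith [norm_nonneg (e u - r.symm (e u))]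
      have : ‖e u‖ = 0 := by
        rw [norm_eq_zero] at this ⊢
        exact (LinearEquiv.map_eq_zero_iff _).mp this
      rw [this] at h4 h6 ⊢
      nlinarith [norm_nonneg (e u - r.symm (e u))]

/-- If two closed subspaces are close to each other, then there is an isometric bijection between
them, which is close to the identity if the forms are close to each other. -/
theorem exists_isometric_bijOn {A₁ A₂ : NonnegForm H} {M : ℝ} (h₁ : A₁.Equivalent M)
    (h₂ : A₂.Equivalent M) {V₁ V₂ : Submodule ℂ H} (hV₁ : IsClosed (V₁ : Set H))
    (hV₂ : IsClosed (V₂ : Set H)) {η : ℝ} (hη0 : 0 ≤ η)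
    (hη : M ^ 2 * η < 1)
    (near : ∀ v₁ ∈ V₁, ∃ v₂ ∈ V₂, ‖v₁ - v₂‖ ≤ η * ‖v₁‖)
    (near' : ∀ v₂ ∈ V₂, ∃ v₁ ∈ V₁, ‖v₂ - v₁‖ ≤ η * ‖v₂‖) :
    ∃ e : H → H, Set.BijOn e V₁ V₂ ∧
      (∀ u ∈ V₁, ∀ v ∈ V₁, A₂.form (e u) (e v) = A₁.form u v) ∧
      ∀ δ : ℝ, (δ + M ^ 2 * η) * M ^ 2 ≤ 1 / 2 →
        (∀ u ∈ V₁, ∀ v ∈ V₁, ‖A₂.form u v - A₁.form u v‖ ≤ δ * ‖u‖ * ‖v‖) →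
        ∀ u ∈ V₁, ‖e u - u‖ ≤ (2 * ((δ + M ^ 2 * η) * M ^ 2) * M ^ 4 + M ^ 2 * η) * ‖u‖ := by
  have hM := h₁.pos
  have : CompleteSpace V₁ := hV₁.completeSpace_coe
  obtain ⟨P, hP⟩ := exists_proj h₂ hV₂
  have hsub : ∀ v ∈ V₁, A₂.nrm (v - P v) ≤ M * (η * ‖v‖) := by
    intro v hv
    obtain ⟨v₂, hv₂, hle⟩ := near v hv
    calc A₂.nrm (v - P v) ≤ A₂.nrm (v - v₂) := nrm_sub_proj_le hP v hv₂
      _ ≤ M * ‖v - v₂‖ := h₂.nrm_le _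
      _ ≤ M * (η * ‖v‖) := by gcongr
  have hlow : ∀ v ∈ V₁, (1 - M ^ 2 * η) * ‖v‖ ≤ M * A₂.nrm (P v) := by
    intro v hv
    have ha := A₂.nrm_add_le (P v) (v - P v)
    rw [add_sub_cancel] at ha
    have hb := mul_le_mul_of_nonneg_left (ha.trans (add_le_add_right (hsub v hv) _)) hM.le
    linarith [h₂.norm_le v]
  have hpos : 0 < 1 - M ^ 2 * η := by linarith
  -- `T` is the `A₂`-projection onto `V₂`, restricted to `V₁`. The map sought is `T ∘ S`, with `S`
  -- an isometry of `V₁` from `A₁` to the pull-back of `A₂` along `T`.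
  let T : V₁ →ₗ[ℂ] H := V₂.subtype ∘ₗ P ∘ₗ V₁.subtype
  have hT : ∀ v : V₁, T v = P (v : H) := fun v => rfl
  have hD : (A₂.comap T).Equivalent (M / (1 - M ^ 2 * η)) := by
    have hMM : M ≤ M / (1 - M ^ 2 * η) := by
      rw [le_div_iff₀ hpos]
      nlinarith [mul_nonneg (sq_nonneg M) hη0]
    refine ⟨h₁.one_le.trans hMM, fun v => ?_, fun v => ?_⟩
    · rw [div_mul_eq_mul_div, le_div_iff₀ hpos, mul_comm]
      exact hlow v v.2
    · calc A₂.nrm (P (v : H)) ≤ A₂.nrm v := nrm_proj_le hP _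
        _ ≤ M * ‖(v : H)‖ := h₂.nrm_le _
        _ ≤ M / (1 - M ^ 2 * η) * ‖(v : H)‖ := by gcongr
  have hA : (A₁.comap V₁.subtype).Equivalent M :=
    ⟨h₁.one_le, fun v => h₁.norm_le v, fun v => h₁.nrm_le v⟩
  have hTinj : Function.Injective T := by
    refine (injective_iff_map_eq_zero T).mpr fun v hv => hD.eq_zero ?_
    rw [comap_quad, hv]
    simp [quad]
  -- Let `T u` be the best `A₂`-approximation of `v₂` in the range of `T`. The defect `d` lies in
  -- `V₂` and is orthogonal to the range, hence to `V₁`. But `V₁` has an element close to `d`, and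
  -- `M ^ 2 * η < 1` then forces `d = 0`.
  have hTsurj : ∀ v₂ ∈ V₂, ∃ u, T u = v₂ := by
    intro v₂ hv₂
    obtain ⟨u, hu, -⟩ := exists_unique_of_coercive (A₂.comap T).form
      (c := ((M / (1 - M ^ 2 * η)) ^ 2)⁻¹) (by have := hD.pos; positivity) hD.norm_form_le
      (fun u => by
        rw [self_eq_quad, Complex.norm_real]
        exact (hD.coercive u).trans (le_abs_self _))
      ((A₂.form v₂).comp T) (F := A₂.nrm v₂ * (M / (1 - M ^ 2 * η)))
      (fun v => by
        calc ‖A₂.form v₂ (T v)‖ ≤ A₂.nrm v₂ * A₂.nrm (T v) := A₂.norm_apply_le _ _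
          _ ≤ A₂.nrm v₂ * (M / (1 - M ^ 2 * η) * ‖v‖) :=
              mul_le_mul_of_nonneg_left (hD.nrm_le v) (A₂.nrm_nonneg _)
          _ = A₂.nrm v₂ * (M / (1 - M ^ 2 * η)) * ‖v‖ := by ring)
    refine ⟨u, ?_⟩
    have hd : v₂ - T u ∈ V₂ := V₂.sub_mem hv₂ (P (u : H)).2
    set d := v₂ - T u with hd_def
    obtain ⟨v₁, hv₁, hle⟩ := near' d hd
    have horth : A₂.form d v₁ = 0 := by
      have ha : A₂.form d (v₁ - P v₁) = 0 := by rw [← conj_symm, hP v₁ d hd, map_zero]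
      have hb : A₂.form d (P v₁) = 0 := by
        have := hu ⟨v₁, hv₁⟩
        rw [comap_apply] at this
        rw [hd_def, map_sub, LinearMap.sub_apply, sub_eq_zero]
        exact this.symm
      rw [map_sub, hb, sub_zero] at ha
      exact ha
    have hq : A₂.nrm d ^ 2 ≤ A₂.nrm d * (M * (η * ‖d‖)) := by
      have ha : (A₂.quad d : ℂ) = A₂.form d (d - v₁) := by
        rw [map_sub, horth, sub_zero, self_eq_quad]
      rw [nrm_sq, ← abs_of_nonneg (A₂.quad_nonneg d), ← Real.norm_eq_abs, ← Complex.norm_real, ha]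
      refine (A₂.norm_apply_le _ _).trans (mul_le_mul_of_nonneg_left ?_ (A₂.nrm_nonneg _))
      exact (h₂.nrm_le _).trans (mul_le_mul_of_nonneg_left hle hM.le)
    have hn : A₂.nrm d = 0 := by
      by_contra hne
      have hp : 0 < A₂.nrm d := lt_of_le_of_ne (A₂.nrm_nonneg d) (Ne.symm hne)
      have ha : A₂.nrm d ≤ M * (η * ‖d‖) := by
        rw [sq] at hq
        exact le_of_mul_le_mul_left hq hp
      have hb := mul_le_mul_of_nonneg_left (mul_le_mul_of_nonneg_left (h₂.norm_le d) hη0) hM.le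
      nlinarith
    have : d = 0 := h₂.eq_zero (by rw [← nrm_sq, hn]; ring)
    exact (sub_eq_zero.mp this).symm
  obtain ⟨S, hS, hSA, hSδ⟩ := exists_isometry hA hD
  classical
  let e : H → H := fun u => if h : u ∈ V₁ then T (S ⟨u, h⟩) else 0
  have he : ∀ u : V₁, e u = T (S u) := fun u => dif_pos u.2
  refine ⟨e, ⟨?_, ?_, ?_⟩, ?_, ?_⟩
  · intro u hu
    rw [he ⟨u, hu⟩]
    exact (P _).2
  · intro u hu v hv huv
    rw [he ⟨u, hu⟩, he ⟨v, hv⟩] at huv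
    exact congrArg Subtype.val (hS.1 (hTinj huv))
  · intro v hv
    obtain ⟨u, hu⟩ := hTsurj v hv
    obtain ⟨x, rfl⟩ := hS.2 u
    exact ⟨x, x.2, (he x).trans hu⟩
  · intro u hu v hv
    rw [he ⟨u, hu⟩, he ⟨v, hv⟩]
    exact hSA ⟨u, hu⟩ ⟨v, hv⟩
  · intro δ hδ hclose u hu
    -- The hypothesis on `δ` forces `0 ≤ δ` only in the presence of a nonzero vector of `V₁`.
    by_cases hu0 : ‖u‖ = 0
    · have h0 : u = 0 := norm_eq_zero.mp hu0
      have hS0 : S 0 = 0 := hD.eq_zero (by rw [quad]; beta_reduce; rw [hSA]; simp)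
      rw [hu0, mul_zero, he ⟨u, hu⟩]
      have : (⟨u, hu⟩ : V₁) = 0 := Subtype.ext h0
      rw [this, hS0, map_zero, h0, sub_zero, norm_zero]
    have hu0' : 0 < ‖u‖ := lt_of_le_of_ne (norm_nonneg _) (Ne.symm hu0)
    have hδ0 : 0 ≤ δ := by
      have := (norm_nonneg _).trans (hclose u hu u hu)
      rw [mul_assoc] at this
      exact nonneg_of_mul_nonneg_left this (by positivity)
    -- `A₂(T x, T y) = A₂(x, T y)`, so the pull-back differs from `A₁` by the projection defect `M ^
    -- 2 * η` plus `δ`; the last `M ^ 2` converts the norm of `H` to that of `A₁`.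
    set κ := (δ + M ^ 2 * η) * M ^ 2 with hκ
    have hκ0 : 0 ≤ κ := by positivity
    have hDA : ∀ x y : V₁, ‖(A₂.comap T).form x y - (A₁.comap V₁.subtype).form x y‖ ≤
        κ * (A₁.comap V₁.subtype).nrm x * (A₁.comap V₁.subtype).nrm y := by
      intro x y
      have hx := hA.norm_le x
      have hy := hA.norm_le y
      have ha : A₂.form (T x) (T y) - A₁.form x y =
          A₂.form x (T y - y) + (A₂.form x y - A₁.form x y) := by
        have hb := hP x (T y) (P (y : H)).2
        rw [map_sub, LinearMap.sub_apply, sub_eq_zero] at hb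
        rw [hT x, ← hb, map_sub]
        ring
      have hb : ‖A₂.form x (T y - y)‖ ≤ (M * ‖x‖) * (M * (η * ‖y‖)) := by
        refine (A₂.norm_apply_le _ _).trans
          (mul_le_mul (h₂.nrm_le _) ?_ (A₂.nrm_nonneg _) (by positivity))
        rw [← nrm_neg, neg_sub]
        exact hsub y y.2
      calc ‖A₂.form (T x) (T y) - A₁.form x y‖
          ≤ (M * ‖x‖) * (M * (η * ‖y‖)) + δ * ‖x‖ * ‖y‖ := by
            rw [ha]
            exact (norm_add_le _ _).trans (add_le_add hb (hclose x x.2 y y.2))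
        _ = (δ + M ^ 2 * η) * (‖x‖ * ‖y‖) := by ring
        _ ≤ (δ + M ^ 2 * η) * ((M * (A₁.comap V₁.subtype).nrm x) *
              (M * (A₁.comap V₁.subtype).nrm y)) := by
            gcongr
            exact mul_nonneg hM.le (nrm_nonneg _ _)
        _ = κ * (A₁.comap V₁.subtype).nrm x * (A₁.comap V₁.subtype).nrm y := by
            rw [hκ]; ring
    have hS1 := hSδ κ hδ hDA ⟨u, hu⟩
    set x : V₁ := ⟨u, hu⟩ with hx
    have hxu : ‖x‖ = ‖u‖ := rfl
    have hS2 : ‖S x - x‖ ≤ 2 * κ * M ^ 2 * ‖u‖ := by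
      calc ‖S x - x‖ ≤ M * (2 * κ * (M * ‖x‖)) := by
            refine (hA.norm_le _).trans (mul_le_mul_of_nonneg_left (hS1.trans ?_) hM.le)
            exact mul_le_mul_of_nonneg_left (hA.nrm_le x) (by positivity)
        _ = 2 * κ * M ^ 2 * ‖u‖ := by rw [hxu]; ring
    have h3 : ‖T (S x - x)‖ ≤ M ^ 2 * (2 * κ * M ^ 2 * ‖u‖) := by
      calc ‖T (S x - x)‖ ≤ M * A₂.nrm (T (S x - x)) := h₂.norm_le _
        _ ≤ M * (M * ‖S x - x‖) := by
            gcongr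
            exact (nrm_proj_le hP _).trans (h₂.nrm_le _)
        _ = M ^ 2 * ‖S x - x‖ := by ring
        _ ≤ M ^ 2 * (2 * κ * M ^ 2 * ‖u‖) := by gcongr
    have h4 : ‖u - P u‖ ≤ M * (M * (η * ‖u‖)) :=
      (h₂.norm_le _).trans (mul_le_mul_of_nonneg_left (hsub u hu) hM.le)
    have h5 : e u - u = T (S x - x) - (u - P u) := by
      rw [he x, map_sub, hT x]; abel
    rw [h5]
    calc ‖T (S x - x) - (u - P u)‖ ≤ ‖T (S x - x)‖ + ‖u - P u‖ := norm_sub_le _ _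
      _ ≤ M ^ 2 * (2 * κ * M ^ 2 * ‖u‖) + M * (M * (η * ‖u‖)) := add_le_add h3 h4
      _ = (2 * κ * M ^ 4 + M ^ 2 * η) * ‖u‖ := by ring

end NonnegForm

/-! ### Closedness of kernels and complements; the dual norm -/

namespace NonnegForm

section Closed

variable {H : Type*} [NormedAddCommGroup H] [InnerProductSpace ℂ H]

theorem Equivalent.mono {A : NonnegForm H} {M M' : ℝ} (h : A.Equivalent M) (hM : M ≤ M') :
    A.Equivalent M' :=
  ⟨h.one_le.trans hM,
    fun u => (h.norm_le u).trans (mul_le_mul_of_nonneg_right hM (A.nrm_nonneg u)),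
    fun u => (h.nrm_le u).trans (mul_le_mul_of_nonneg_right hM (norm_nonneg u))⟩

theorem isClosed_orth (A : NonnegForm H) {C : ℝ} (hC : ∀ u v, ‖A.form u v‖ ≤ C * ‖u‖ * ‖v‖)
    (V : Submodule ℂ H) : IsClosed (A.orth V : Set H) := by
  have h : (A.orth V : Set H) = ⋂ v ∈ V, {w | A.form w v = 0} := by
    ext w
    simp only [Set.mem_iInter]
    rfl
  rw [h]
  refine isClosed_biInter fun v _ => isClosed_eq ?_ continuous_const
  exact (LinearMap.mkContinuous (A.form.flip v) (C * ‖v‖) (fun u => by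
    calc ‖A.form u v‖ ≤ C * ‖u‖ * ‖v‖ := hC u v
      _ = C * ‖v‖ * ‖u‖ := by ring)).continuous

theorem ker_eq_orth_top (A : NonnegForm H) : A.ker = A.orth ⊤ := by
  ext v
  exact ⟨fun hv u _ => A.apply_ker_left hv u, fun hv => hv v trivial⟩

theorem isClosed_ker (A : NonnegForm H) {C : ℝ} (hC : ∀ u v, ‖A.form u v‖ ≤ C * ‖u‖ * ‖v‖) :
    IsClosed (A.ker : Set H) := by
  rw [ker_eq_orth_top]
  exact A.isClosed_orth hC ⊤

end Closed

section DualNorm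

variable {H : Type*} [NormedAddCommGroup H] [InnerProductSpace ℂ H]

theorem dualNorm_nonneg (A : NonnegForm H) (f : H → ℂ) : 0 ≤ A.dualNorm f :=
  Real.iSup_nonneg fun _ => div_nonneg (norm_nonneg _) (A.nrm_nonneg _)

theorem norm_apply_le_dualNorm {A : NonnegForm H} {M : ℝ} (h : A.Equivalent M) (f : H →L⋆[ℂ] ℂ)
    (u : H) : ‖f u‖ ≤ A.dualNorm f * A.nrm u := by
  by_cases hu : u = 0
  · simp [hu, nrm, quad]
  have hpos : ∀ v : H, v ≠ 0 → 0 < A.nrm v := fun v hv =>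
    pos_of_mul_pos_right ((norm_pos_iff.mpr hv).trans_le (h.norm_le v)) h.pos.le
  -- A real supremum over an unbounded family would be `0`, so boundedness is needed before
  -- `le_ciSup`.
  have hbdd : BddAbove (Set.range fun v : {v : H // v ≠ 0} => ‖f v‖ / A.nrm v) := by
    refine ⟨‖f‖ * M, ?_⟩
    rintro _ ⟨v, rfl⟩
    rw [div_le_iff₀ (hpos v v.2), mul_assoc]
    exact (f.le_opNorm _).trans (mul_le_mul_of_nonneg_left (h.norm_le _) (norm_nonneg _))
  rw [← div_le_iff₀ (hpos u hu)]
  exact le_ciSup hbdd ⟨u, hu⟩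

end DualNorm

end NonnegForm

/-! ### Reduction of all hypotheses to one constant -/

namespace Degenerating

open Filter

variable {n : ℕ} {H : Type*} [NormedAddCommGroup H] [InnerProductSpace ℂ H]

/-- The hypotheses, with all norms replaced by the norm of `H` and all constants by one number
`M`. -/
structure Bounds (Θ : Set (EuclideanSpace ℝ (Fin n)))
    (a b : EuclideanSpace ℝ (Fin n) → NonnegForm H) (Vs : Submodule ℂ H)
    (Z : Submodule ℂ (a 0).ker)
    (a₁ : (a 0).ker →ₗ[ℂ] H →ₗ⋆[ℂ] (Fin n → ℂ))
    (a₂ : (a 0).ker →ₗ[ℂ] (a 0).ker →ₗ⋆[ℂ] Matrix (Fin n) (Fin n) ℂ) (M : ℝ) : Prop where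
  one_le : 1 ≤ M
  equiv : ∀ θ ∈ Θ, (ip a b θ).Equivalent M
  norm_le : ∀ θ ∈ Θ, ‖θ‖ ≤ M
  mem_of_norm_le : ∀ θ, ‖θ‖ ≤ M⁻¹ → θ ∈ Θ
  lipschitz : ∀ θ₁ ∈ Θ, ∀ θ₂ ∈ Θ, ∀ u u',
    ‖(a θ₁).form u u' - (a θ₂).form u u'‖ ≤ M * ‖θ₁ - θ₂‖ * ‖u‖ * ‖u'‖
  near : ∀ θ₁ ∈ Θ, ∀ θ₂ ∈ Θ, ∀ v₁ ∈ VStar a Vs θ₁, ∃ v₂ ∈ VStar a Vs θ₂,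
    ‖v₁ - v₂‖ ≤ M * ‖θ₁ - θ₂‖ * ‖v₁‖
  first : ∀ θ ∈ Θ, ∀ (v : (a 0).ker) (u : H),
    ‖(a θ).form v u - dot (a₁ v u) θ‖ ≤ M * ‖θ‖ ^ 2 * ‖v‖ * ‖u‖
  second : ∀ θ ∈ Θ, ∀ v v' : (a 0).ker,
    ‖(a θ).form v v' - dot₂ (a₂ v v') θ‖ ≤ M * ‖θ‖ ^ 3 * ‖v‖ * ‖v'‖
  gap : ∀ θ ∈ Θ, ∀ w ∈ WSpace a b θ, ‖θ‖ ^ 2 * ‖w‖ ^ 2 ≤ M * (a θ).quad w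
  gap_zero : ∀ w ∈ WSpace a b 0, ‖w‖ ^ 2 ≤ M * (a 0).quad w
  lipschitz_b : ∀ θ ∈ Θ, ∀ v v' : (a 0).ker,
    ‖(b θ).form v v' - (b 0).form v v'‖ ≤ M * ‖θ‖ * ‖v‖ * ‖v'‖
  transversal : ∀ v ∈ Vs, ∀ z ∈ Z, ‖v‖ ≤ M * ‖v + z‖ ∧ ‖z‖ ≤ M * ‖v + z‖
  le_ker : Vs ≤ (a 0).ker
  exists_add : ∀ p ∈ (a 0).ker, ∃ v ∈ Vs, ∃ z ∈ Z, p = v + z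
  isClosed : IsClosed (Vs : Set H)

section

variable {Θ : Set (EuclideanSpace ℝ (Fin n))} {a b : EuclideanSpace ℝ (Fin n) → NonnegForm H}

/-- The constants of `equiv_norm` depend on `θ`; those at `0` are spread over `Θ` by
`uniform_equiv`. -/
theorem Standing.exists_equivalent (hS : Standing Θ a b)
    (h0 : (0 : EuclideanSpace ℝ (Fin n)) ∈ Θ) :
    ∃ M, ∀ θ ∈ Θ, (ip a b θ).Equivalent M := by
  obtain ⟨c, C, hc, hcC⟩ := hS.equiv_norm 0 h0
  obtain ⟨K, hK, hKle⟩ := hS.uniform_equiv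
  refine ⟨max 1 (max (K / c) (K * C)), fun θ hθ => ⟨le_max_left _ _, fun u => ?_, fun u => ?_⟩⟩
  · refine le_trans ?_ (mul_le_mul_of_nonneg_right
      ((le_max_left _ _).trans (le_max_right _ _)) (NonnegForm.nrm_nonneg _ _))
    rw [div_mul_eq_mul_div, le_div_iff₀ hc, mul_comm]
    exact (hcC u).1.trans (hKle 0 h0 θ hθ u)
  · refine le_trans ?_ (mul_le_mul_of_nonneg_right
      ((le_max_right _ _).trans (le_max_right _ _)) (norm_nonneg _))
    rw [mul_assoc]
    exact (hKle θ hθ 0 h0 u).trans (mul_le_mul_of_nonneg_left (hcC u).2 hK.le)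

/-- Replacing the norms in an estimate by equivalent ones. -/
theorem le_of_nrm_bound {A B : NonnegForm H} {M M' K t x : ℝ} (hA : A.Equivalent M)
    (hB : B.Equivalent M) (hK : 0 ≤ K) (ht : 0 ≤ t) {u v : H}
    (h : x ≤ K * t * A.nrm u * B.nrm v) (hM : K * M ^ 2 ≤ M') : x ≤ M' * t * ‖u‖ * ‖v‖ := by
  have := hA.pos
  calc x ≤ K * t * A.nrm u * B.nrm v := h
    _ ≤ K * t * (M * ‖u‖) * (M * ‖v‖) := by
        have h1 := hA.nrm_le u
        have h2 := hB.nrm_le v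
        have h3 := B.nrm_nonneg v
        gcongr
    _ = K * M ^ 2 * (t * ‖u‖ * ‖v‖) := by ring
    _ ≤ M' * (t * ‖u‖ * ‖v‖) := by gcongr
    _ = M' * t * ‖u‖ * ‖v‖ := by ring

/-- An element below the bound exists only if the infimum is strictly smaller. Hence `Ls + 1`, and
separate exact choices when the right-hand side vanishes. -/
theorem exists_near {Vs : Submodule ℂ H} {M Ls : ℝ} (hM : ∀ θ ∈ Θ, (ip a b θ).Equivalent M)
    (hLs : 0 ≤ Ls)
    (h : ∀ θ₁ ∈ Θ, ∀ θ₂ ∈ Θ, ∀ v₁ ∈ VStar a Vs θ₁,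
      (⨅ v₂ : VStar a Vs θ₂, (ip a b θ₂).nrm (v₁ - v₂)) ≤
        Ls * ‖θ₁ - θ₂‖ * (ip a b θ₁).nrm v₁)
    {θ₁ θ₂ : EuclideanSpace ℝ (Fin n)} (h₁ : θ₁ ∈ Θ) (h₂ : θ₂ ∈ Θ) {v₁ : H}
    (hv₁ : v₁ ∈ VStar a Vs θ₁) :
    ∃ v₂ ∈ VStar a Vs θ₂, ‖v₁ - v₂‖ ≤ (Ls + 1) * M ^ 2 * ‖θ₁ - θ₂‖ * ‖v₁‖ := by
  have hMp := (hM θ₁ h₁).pos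
  by_cases hθ : θ₁ = θ₂
  · subst hθ
    exact ⟨v₁, hv₁, by simp⟩
  by_cases hv : v₁ = 0
  · exact ⟨0, Submodule.zero_mem _, by simp [hv]⟩
  have hθ' : 0 < ‖θ₁ - θ₂‖ := norm_pos_iff.mpr (sub_ne_zero.mpr hθ)
  have hn : 0 < (ip a b θ₁).nrm v₁ :=
    pos_of_mul_pos_right ((norm_pos_iff.mpr hv).trans_le ((hM θ₁ h₁).norm_le v₁)) hMp.le
  have hlt : (⨅ v₂ : VStar a Vs θ₂, (ip a b θ₂).nrm (v₁ - v₂)) <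
      (Ls + 1) * ‖θ₁ - θ₂‖ * (ip a b θ₁).nrm v₁ := by
    refine (h θ₁ h₁ θ₂ h₂ v₁ hv₁).trans_lt ?_
    gcongr
    linarith
  obtain ⟨v₂, hv₂⟩ := exists_lt_of_ciInf_lt hlt
  refine ⟨v₂, v₂.2, ?_⟩
  calc ‖v₁ - v₂‖ ≤ M * (ip a b θ₂).nrm (v₁ - v₂) := (hM θ₂ h₂).norm_le _
    _ ≤ M * ((Ls + 1) * ‖θ₁ - θ₂‖ * (M * ‖v₁‖)) := by
        refine mul_le_mul_of_nonneg_left (hv₂.le.trans ?_) hMp.le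
        exact mul_le_mul_of_nonneg_left ((hM θ₁ h₁).nrm_le _) (by positivity)
    _ = (Ls + 1) * M ^ 2 * ‖θ₁ - θ₂‖ * ‖v₁‖ := by ring

/-- In the norm of `A`, `|v + z|² ≥ |v|² - 2K|v||z| + |z|² ≥ (1 - K²)|v|² ≥ (1 - K)²|v|²`, and
symmetrically for `z`. -/
theorem norm_le_of_transversal {A : NonnegForm H} {M K : ℝ} (hA : A.Equivalent M)
    (hK0 : 0 ≤ K) (hK : K < 1) {v z : H} (h : ‖A.form v z‖ ≤ K * A.nrm v * A.nrm z) :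
    ‖v‖ ≤ M ^ 2 / (1 - K) * ‖v + z‖ ∧ ‖z‖ ≤ M ^ 2 / (1 - K) * ‖v + z‖ := by
  have hMp := hA.pos
  have hK' : 0 < 1 - K := by linarith
  have hq := A.quad_add v z
  have hre := (Complex.abs_re_le_norm _).trans h
  have hre' := (abs_le.mp hre).1
  rw [← A.nrm_sq, ← A.nrm_sq, ← A.nrm_sq] at hq
  have h0 := A.nrm_nonneg v
  have h1 := A.nrm_nonneg z
  have h2 := A.nrm_nonneg (v + z)
  have aux : ∀ x y s : ℝ, 0 ≤ x → 0 ≤ y → 0 ≤ s → x ^ 2 - 2 * (K * x * y) + y ^ 2 ≤ s ^ 2 →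
      (1 - K) * x ≤ s := by
    intro x y s hx hy hs hle
    refine abs_le_of_sq_le_sq' ?_ hs |>.2
    nlinarith [sq_nonneg (y - K * x), mul_nonneg (mul_nonneg hK0 hK'.le) (sq_nonneg x)]
  have hv := aux (A.nrm v) (A.nrm z) (A.nrm (v + z)) h0 h1 h2 (by linarith)
  have hz := aux (A.nrm z) (A.nrm v) (A.nrm (v + z)) h1 h0 h2 (by linarith)
  have key : ∀ y, (1 - K) * A.nrm y ≤ A.nrm (v + z) → ‖y‖ ≤ M ^ 2 / (1 - K) * ‖v + z‖ := by
    intro y hy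
    rw [div_mul_eq_mul_div, le_div_iff₀ hK']
    calc ‖y‖ * (1 - K) ≤ (M * A.nrm y) * (1 - K) := by gcongr; exact hA.norm_le y
      _ = M * ((1 - K) * A.nrm y) := by ring
      _ ≤ M * (M * ‖v + z‖) := mul_le_mul_of_nonneg_left (hy.trans (hA.nrm_le _)) hMp.le
      _ = M ^ 2 * ‖v + z‖ := by ring
  exact ⟨key v hv, key z hz⟩

theorem exists_bounds {Vs : Submodule ℂ H} {Z : Submodule ℂ (a 0).ker}
    {a₁ : (a 0).ker →ₗ[ℂ] H →ₗ⋆[ℂ] (Fin n → ℂ)}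
    {a₂ : (a 0).ker →ₗ[ℂ] (a 0).ker →ₗ⋆[ℂ] Matrix (Fin n) (Fin n) ℂ}
    (hS : Standing Θ a b) (hH1 : GapCondition Θ a b) (hH2 : RemovableSingularity Θ a b Vs)
    (hZ : IsDefectSubspace a b Vs Z) (hH3 : QuadraticGap Θ a b)
    (hH4 : Differentiability Θ a b a₁ a₂) (hH5 : LipschitzAtZero Θ a b) :
    ∃ M, Bounds Θ a b Vs Z a₁ a₂ M := by
  have h0 : (0 : EuclideanSpace ℝ (Fin n)) ∈ Θ := interior_subset hH4.zero_mem_interior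
  obtain ⟨M₀, hM₀⟩ := hS.exists_equivalent h0
  have hM₀1 := (hM₀ 0 h0).one_le
  have hM₀p := (hM₀ 0 h0).pos
  obtain ⟨R, hR⟩ := hS.isCompact.isBounded.exists_norm_le
  obtain ⟨r, hr, hball⟩ := Metric.mem_nhds_iff.mp (mem_interior_iff_mem_nhds.mp
    hH4.zero_mem_interior)
  obtain ⟨La, hLa, hlip⟩ := hS.lipschitz
  obtain ⟨Ls, hLs, hnear⟩ := hH2.lipschitz
  obtain ⟨K₁, hK₁, hfirst⟩ := hH4.first
  obtain ⟨K₂, hK₂, hsecond⟩ := hH4.second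
  obtain ⟨γ, hγ, hgap⟩ := hH3
  obtain ⟨ν, hν, hgap0⟩ := hH1 0 h0
  obtain ⟨Lb, hLb, hb⟩ := hH5.lipschitz
  obtain ⟨KZ, hKZ0, hKZ1, htr⟩ := hZ.transversal
  -- The entry `2 * r⁻¹ ≤ M` puts the closed ball of radius `M⁻¹` inside the open ball of radius
  -- `r`, hence inside `Θ`.
  have hev : ∀ᶠ M in atTop, M₀ ≤ M ∧ R ≤ M ∧ 2 * r⁻¹ ≤ M ∧ La * M₀ ^ 2 ≤ M ∧
      (Ls + 1) * M₀ ^ 2 ≤ M ∧ K₁ * M₀ ^ 2 ≤ M ∧ K₂ * M₀ ^ 2 ≤ M ∧ γ⁻¹ * M₀ ^ 2 ≤ M ∧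
      ν⁻¹ * M₀ ^ 2 ≤ M ∧ Lb * M₀ ^ 2 ≤ M ∧ M₀ ^ 2 / (1 - KZ) ≤ M := by
    simp only [eventually_and, eventually_ge_atTop, and_self]
  obtain ⟨M, h1, h2, h3, h4, h5, h6, h7, h8, h9, h10, h11⟩ := hev.exists
  have hMp : 0 < M := hM₀p.trans_le h1
  refine ⟨M,
    { one_le := hM₀1.trans h1
      equiv := fun θ hθ => (hM₀ θ hθ).mono h1
      norm_le := fun θ hθ => (hR θ hθ).trans h2
      mem_of_norm_le := fun θ hθ => hball ?_
      lipschitz := fun θ₁ hθ₁ θ₂ hθ₂ u u' => ?_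
      near := fun θ₁ hθ₁ θ₂ hθ₂ v₁ hv₁ => ?_
      first := fun θ hθ v u => ?_
      second := fun θ hθ v v' => ?_
      gap := fun θ hθ w hw => ?_
      gap_zero := fun w hw => ?_
      lipschitz_b := fun θ hθ v v' => ?_
      transversal := fun v hv z hz => ?_
      le_ker := ?_
      exists_add := fun p hp => ?_
      isClosed := hH2.isClosed }⟩
  · rw [mem_ball_zero_iff]
    refine hθ.trans_lt ?_
    rw [inv_lt_comm₀ hMp hr]
    have := inv_pos.mpr hr
    linarith
  · exact le_of_nrm_bound (hM₀ θ₁ hθ₁) (hM₀ θ₁ hθ₁) hLa.le (norm_nonneg _)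
      (hlip θ₁ hθ₁ θ₂ hθ₂ u u') h4
  · obtain ⟨v₂, hv₂, hle⟩ := exists_near hM₀ hLs hnear hθ₁ hθ₂ hv₁
    exact ⟨v₂, hv₂, hle.trans (by gcongr)⟩
  · exact le_of_nrm_bound (hM₀ 0 h0) (hM₀ 0 h0) hK₁ (by positivity) (hfirst θ hθ v u) h6
  · exact le_of_nrm_bound (hM₀ 0 h0) (hM₀ 0 h0) hK₂ (by positivity) (hsecond θ hθ v v') h7
  · have hw' := hgap θ hθ w hw
    have hle := pow_le_pow_left₀ (norm_nonneg _) ((hM₀ θ hθ).norm_le w) 2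
    calc ‖θ‖ ^ 2 * ‖w‖ ^ 2 ≤ ‖θ‖ ^ 2 * (M₀ * (ip a b θ).nrm w) ^ 2 := by gcongr
      _ = γ⁻¹ * M₀ ^ 2 * (γ * ‖θ‖ ^ 2 * (ip a b θ).nrm w ^ 2) := by field_simp
      _ ≤ M * (a θ).quad w := by
          gcongr
  · have hw' := hgap0 w hw
    have hle := pow_le_pow_left₀ (norm_nonneg _) ((hM₀ 0 h0).norm_le w) 2
    calc ‖w‖ ^ 2 ≤ (M₀ * (ip a b 0).nrm w) ^ 2 := hle
      _ = ν⁻¹ * M₀ ^ 2 * (ν * (ip a b 0).nrm w ^ 2) := by field_simp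
      _ ≤ M * (a 0).quad w := by
          gcongr
  · exact le_of_nrm_bound (hM₀ 0 h0) (hM₀ θ hθ) hLb (norm_nonneg _)
      (hb θ hθ v v.2 v' v'.2) h10
  · have h := norm_le_of_transversal (hM₀ 0 h0) hKZ0 hKZ1 (htr v hv z hz)
    exact ⟨h.1.trans (by gcongr), h.2.trans (by gcongr)⟩
  · rw [← hZ.sup_eq]
    exact le_sup_left
  · rw [← hZ.sup_eq] at hp
    obtain ⟨v, hv, y, hy, rfl⟩ := Submodule.mem_sup.mp hp
    obtain ⟨z, hz, rfl⟩ := hy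
    exact ⟨v, hv, z, hz, rfl⟩

end

end Degenerating

/-! ### Orders of `a_θ` in `θ` on `V_0` -/

namespace Degenerating

variable {n : ℕ} {H : Type*} [NormedAddCommGroup H] [InnerProductSpace ℂ H]

section Dot

theorem dot_add (x y : Fin n → ℂ) (θ : EuclideanSpace ℝ (Fin n)) :
    dot (x + y) θ = dot x θ + dot y θ := by
  simp [dot, add_mul, Finset.sum_add_distrib]

theorem dot_smul (c : ℂ) (x : Fin n → ℂ) (θ : EuclideanSpace ℝ (Fin n)) :
    dot (c • x) θ = c * dot x θ := by
  simp [dot, mul_assoc, Finset.mul_sum]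

theorem dot_real_smul (x : Fin n → ℂ) (t : ℝ) (θ : EuclideanSpace ℝ (Fin n)) :
    dot x (t • θ) = t * dot x θ := by
  simp only [dot, PiLp.smul_apply, smul_eq_mul, Complex.ofReal_mul, Finset.mul_sum]
  exact Finset.sum_congr rfl fun i _ => by ring

theorem dot₂_add (x y : Matrix (Fin n) (Fin n) ℂ) (θ : EuclideanSpace ℝ (Fin n)) :
    dot₂ (x + y) θ = dot₂ x θ + dot₂ y θ := by
  simp [dot₂, add_mul, Finset.sum_add_distrib]

theorem dot₂_smul (c : ℂ) (x : Matrix (Fin n) (Fin n) ℂ) (θ : EuclideanSpace ℝ (Fin n)) :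
    dot₂ (c • x) θ = c * dot₂ x θ := by
  simp only [dot₂, Matrix.smul_apply, smul_eq_mul, Finset.mul_sum, Finset.sum_mul]
  exact Finset.sum_congr rfl fun i _ => Finset.sum_congr rfl fun j _ => by ring

theorem dot₂_real_smul (x : Matrix (Fin n) (Fin n) ℂ) (t : ℝ) (θ : EuclideanSpace ℝ (Fin n)) :
    dot₂ x (t • θ) = t ^ 2 * dot₂ x θ := by
  simp only [dot₂, PiLp.smul_apply, smul_eq_mul, Complex.ofReal_mul, Finset.mul_sum,
    Finset.sum_mul]
  exact Finset.sum_congr rfl fun i _ => Finset.sum_congr rfl fun j _ => by ring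

end Dot

section Bounds

variable {Θ : Set (EuclideanSpace ℝ (Fin n))} {a b : EuclideanSpace ℝ (Fin n) → NonnegForm H}
  {Vs : Submodule ℂ H} {Z : Submodule ℂ (a 0).ker}
  {a₁ : (a 0).ker →ₗ[ℂ] H →ₗ⋆[ℂ] (Fin n → ℂ)}
  {a₂ : (a 0).ker →ₗ[ℂ] (a 0).ker →ₗ⋆[ℂ] Matrix (Fin n) (Fin n) ℂ} {M : ℝ}
  {θ : EuclideanSpace ℝ (Fin n)}

theorem ip_quad (θ : EuclideanSpace ℝ (Fin n)) (u : H) :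
    (ip a b θ).quad u = (a θ).quad u + (b θ).quad u := NonnegForm.add_quad _ _ u

theorem nrm_le_ip_left (u : H) : (a θ).nrm u ≤ (ip a b θ).nrm u :=
  Real.sqrt_le_sqrt (by rw [ip_quad]; linarith [(b θ).quad_nonneg u])

theorem nrm_le_ip_right (u : H) : (b θ).nrm u ≤ (ip a b θ).nrm u :=
  Real.sqrt_le_sqrt (by rw [ip_quad]; linarith [(a θ).quad_nonneg u])

namespace Bounds

variable (hB : Bounds Θ a b Vs Z a₁ a₂ M)
include hB

theorem pos : 0 < M := zero_lt_one.trans_le hB.one_le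

theorem zero_mem : (0 : EuclideanSpace ℝ (Fin n)) ∈ Θ :=
  hB.mem_of_norm_le 0 (by simpa using hB.pos.le)

theorem norm_a_le (hθ : θ ∈ Θ) (u v : H) : ‖(a θ).form u v‖ ≤ M ^ 2 * ‖u‖ * ‖v‖ := by
  have := hB.pos
  have h := hB.equiv θ hθ
  calc ‖(a θ).form u v‖ ≤ (a θ).nrm u * (a θ).nrm v := (a θ).norm_apply_le u v
    _ ≤ (M * ‖u‖) * (M * ‖v‖) :=
        mul_le_mul ((nrm_le_ip_left u).trans (h.nrm_le u)) ((nrm_le_ip_left v).trans (h.nrm_le v))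
          ((a θ).nrm_nonneg v) (by positivity)
    _ = M ^ 2 * ‖u‖ * ‖v‖ := by ring

theorem norm_b_le (hθ : θ ∈ Θ) (u v : H) : ‖(b θ).form u v‖ ≤ M ^ 2 * ‖u‖ * ‖v‖ := by
  have := hB.pos
  have h := hB.equiv θ hθ
  calc ‖(b θ).form u v‖ ≤ (b θ).nrm u * (b θ).nrm v := (b θ).norm_apply_le u v
    _ ≤ (M * ‖u‖) * (M * ‖v‖) :=
        mul_le_mul ((nrm_le_ip_right u).trans (h.nrm_le u))
          ((nrm_le_ip_right v).trans (h.nrm_le v)) ((b θ).nrm_nonneg v) (by positivity)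
    _ = M ^ 2 * ‖u‖ * ‖v‖ := by ring

theorem isClosed_ker (hθ : θ ∈ Θ) : IsClosed ((a θ).ker : Set H) :=
  (a θ).isClosed_ker (hB.norm_a_le hθ)

theorem isClosed_WSpace (hθ : θ ∈ Θ) : IsClosed (WSpace a b θ : Set H) :=
  (ip a b θ).isClosed_orth (hB.equiv θ hθ).norm_form_le _

theorem isClosed_VStar (hθ : θ ∈ Θ) : IsClosed (VStar a Vs θ : Set H) := by
  unfold VStar
  split_ifs
  · exact hB.isClosed
  · exact hB.isClosed_ker hθ

theorem VStar_le_ker (θ : EuclideanSpace ℝ (Fin n)) : VStar a Vs θ ≤ (a θ).ker := by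
  unfold VStar
  split_ifs with h
  · rw [h]; exact hB.le_ker
  · exact le_rfl

/-- `a_θ` is of first order in `θ` on `V_0`. -/
theorem norm_a_ker_le (hθ : θ ∈ Θ) (v : (a 0).ker) (u : H) :
    ‖(a θ).form v u‖ ≤ M * ‖θ‖ * ‖v‖ * ‖u‖ := by
  have h := hB.lipschitz θ hθ 0 hB.zero_mem v u
  rwa [(a 0).apply_ker_left v.2, sub_zero, sub_zero] at h

theorem norm_a_ker_right_le (hθ : θ ∈ Θ) (v : (a 0).ker) (u : H) :
    ‖(a θ).form u v‖ ≤ M * ‖θ‖ * ‖v‖ * ‖u‖ := by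
  rw [← NonnegForm.conj_symm, RCLike.norm_conj]
  exact hB.norm_a_ker_le hθ v u

/-- The expansions of `a_θ` hold only in `Θ`, but their coefficients are homogeneous in `θ`:
rescaling to a small sphere inside `Θ` yields bounds for all `θ`. -/
theorem exists_smul_mem (hθ : θ ≠ 0) {ρ : ℝ} (hρ : 0 < ρ) (hρM : ρ ≤ M⁻¹) :
    ∃ t : ℝ, 0 < t ∧ t • θ ∈ Θ ∧ ‖t • θ‖ = ρ := by
  have h : 0 < ‖θ‖ := norm_pos_iff.mpr hθ
  have hn : ‖(ρ / ‖θ‖) • θ‖ = ρ := by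
    rw [norm_smul, Real.norm_eq_abs, abs_of_pos (by positivity)]
    field_simp
  exact ⟨ρ / ‖θ‖, by positivity, hB.mem_of_norm_le _ (by rwa [hn]), hn⟩

/-- On the sphere `‖θ‖ = M⁻¹` the form `a_θ(v, ·)` is of first order and the remainder `M ‖θ‖²`
equals `‖θ‖`; homogeneity does the rest. -/
theorem norm_dot_le (θ : EuclideanSpace ℝ (Fin n)) (v : (a 0).ker) (u : H) :
    ‖dot (a₁ v u) θ‖ ≤ 2 * M * ‖θ‖ * ‖v‖ * ‖u‖ := by
  have hM := hB.pos
  by_cases hθ : θ = 0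
  · simp [hθ, dot]
  obtain ⟨t, ht, hmem, hnorm⟩ := hB.exists_smul_mem hθ (inv_pos.mpr hM) le_rfl
  have h1 := hB.first _ hmem v u
  have h2 := hB.norm_a_ker_le hmem v u
  have h3 := norm_sub_norm_le (dot (a₁ v u) (t • θ)) ((a (t • θ)).form v u)
  rw [norm_sub_rev] at h3
  have h4 : M * ‖t • θ‖ ^ 2 = ‖t • θ‖ := by
    rw [sq, ← mul_assoc, hnorm, mul_inv_cancel₀ hM.ne', one_mul]
  rw [h4] at h1
  have h5 : ‖dot (a₁ v u) (t • θ)‖ ≤ (M + 1) * ‖t • θ‖ * ‖v‖ * ‖u‖ := by linarith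
  rw [dot_real_smul, norm_mul, Complex.norm_real, norm_smul, Real.norm_eq_abs, abs_of_pos ht] at h5
  have h6 : t * ‖dot (a₁ v u) θ‖ ≤ t * ((M + 1) * ‖θ‖ * ‖v‖ * ‖u‖) := by linarith
  refine (le_of_mul_le_mul_left h6 ht).trans ?_
  have := hB.one_le
  gcongr
  linarith

theorem norm_dot₂_le (θ : EuclideanSpace ℝ (Fin n)) (v v' : (a 0).ker) :
    ‖dot₂ (a₂ v v') θ‖ ≤ 2 * M ^ 2 * ‖θ‖ ^ 2 * ‖v‖ * ‖v'‖ := by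
  have hM := hB.pos
  by_cases hθ : θ = 0
  · simp [hθ, dot₂]
  obtain ⟨t, ht, hmem, hnorm⟩ := hB.exists_smul_mem hθ (inv_pos.mpr hM) le_rfl
  have h1 := hB.second _ hmem v v'
  have h2 := hB.norm_a_ker_le hmem v v'
  have h3 := norm_sub_norm_le (dot₂ (a₂ v v') (t • θ)) ((a (t • θ)).form v v')
  rw [norm_sub_rev] at h3
  -- At this radius powers of `‖t • θ‖` are traded for powers of `M`, so that all bounds become
  -- quadratic.
  have h4 : M * ‖t • θ‖ ^ 3 = ‖t • θ‖ ^ 2 := by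
    rw [hnorm]; field_simp
  have h4' : M * ‖t • θ‖ = M ^ 2 * ‖t • θ‖ ^ 2 := by
    rw [hnorm]; field_simp
  rw [h4] at h1
  rw [h4'] at h2
  have h5 : ‖dot₂ (a₂ v v') (t • θ)‖ ≤ (M ^ 2 + 1) * ‖t • θ‖ ^ 2 * ‖v‖ * ‖v'‖ := by
    have : ‖(v' : H)‖ = ‖v'‖ := rfl
    rw [this] at h2
    linarith
  rw [dot₂_real_smul, norm_mul, norm_pow, Complex.norm_real, norm_smul, Real.norm_eq_abs,
    abs_of_pos ht] at h5
  have h6 : t ^ 2 * ‖dot₂ (a₂ v v') θ‖ ≤ t ^ 2 * ((M ^ 2 + 1) * ‖θ‖ ^ 2 * ‖v‖ * ‖v'‖) := by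
    linarith
  refine (le_of_mul_le_mul_left h6 (by positivity)).trans ?_
  have := hB.one_le
  gcongr
  nlinarith

/-- `a_θ` is of second order in `θ` on `V_0 × V_0`. -/
theorem norm_a_ker_ker_le (hθ : θ ∈ Θ) (v v' : (a 0).ker) :
    ‖(a θ).form v v'‖ ≤ 3 * M ^ 2 * ‖θ‖ ^ 2 * ‖v‖ * ‖v'‖ := by
  have hM := hB.pos
  have h1 := hB.second θ hθ v v'
  have h2 := hB.norm_dot₂_le θ v v'
  have h3 := norm_sub_norm_le ((a θ).form v v') (dot₂ (a₂ v v') θ)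
  have h4 : M * ‖θ‖ ^ 3 * ‖v‖ * ‖v'‖ ≤ M ^ 2 * ‖θ‖ ^ 2 * ‖v‖ * ‖v'‖ := by
    calc M * ‖θ‖ ^ 3 * ‖v‖ * ‖v'‖ = M * ‖θ‖ ^ 2 * ‖θ‖ * ‖v‖ * ‖v'‖ := by ring
      _ ≤ M * ‖θ‖ ^ 2 * M * ‖v‖ * ‖v'‖ := by gcongr; exact hB.norm_le θ hθ
      _ = M ^ 2 * ‖θ‖ ^ 2 * ‖v‖ * ‖v'‖ := by ring
  linarith

end Bounds

end Bounds

/-! ### The corrector and the homogenised form -/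

section Corrector

variable [CompleteSpace H] {Θ : Set (EuclideanSpace ℝ (Fin n))}
  {a b : EuclideanSpace ℝ (Fin n) → NonnegForm H}
  {Vs : Submodule ℂ H} {Z : Submodule ℂ (a 0).ker}
  {a₁ : (a 0).ker →ₗ[ℂ] H →ₗ⋆[ℂ] (Fin n → ℂ)}
  {a₂ : (a 0).ker →ₗ[ℂ] (a 0).ker →ₗ⋆[ℂ] Matrix (Fin n) (Fin n) ℂ} {M : ℝ}
  {θ : EuclideanSpace ℝ (Fin n)}

namespace Bounds

variable (hB : Bounds Θ a b Vs Z a₁ a₂ M)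
include hB

/-- Lax-Milgram on `W_0`, where coercivity comes from the pointwise gap at `0`: the quadratic gap is
void there. -/
theorem existsUnique_cellSolution (θ : EuclideanSpace ℝ (Fin n)) (v : (a 0).ker) :
    ∃! w : H, IsCellSolution a b a₁ θ v w := by
  have hM := hB.pos
  let f : H →ₗ⋆[ℂ] ℂ :=
    { toFun := fun u => - dot (a₁ v u) θ
      map_add' := by intro x y; rw [map_add, dot_add, neg_add]
      map_smul' := by
        intro c x
        rw [LinearMap.map_smulₛₗ, dot_smul, smul_eq_mul, mul_neg] }
  refine (a 0).exists_unique_solution (hB.isClosed_WSpace hB.zero_mem) (inv_pos.mpr hM)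
    (hB.norm_a_le hB.zero_mem) (fun u hu => ?_) f (F := 2 * M * ‖θ‖ * ‖v‖) (fun u => ?_)
  · rw [inv_mul_le_iff₀ hM]
    exact hB.gap_zero u hu
  · change ‖- dot (a₁ v u) θ‖ ≤ _
    rw [norm_neg]
    exact hB.norm_dot_le θ v u

theorem isCellSolution_corrector (θ : EuclideanSpace ℝ (Fin n)) (v : (a 0).ker) :
    IsCellSolution a b a₁ θ v (corrector a b a₁ θ v) := by
  have h := (hB.existsUnique_cellSolution θ v).exists
  rw [corrector, dif_pos h]
  exact h.choose_spec

/-- Uniqueness makes the corrector, which is defined by choice, linear in `v` and homogeneous in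
`θ`. -/
theorem corrector_eq {v : (a 0).ker} {w : H} (hw : IsCellSolution a b a₁ θ v w) :
    corrector a b a₁ θ v = w :=
  (hB.existsUnique_cellSolution θ v).unique (hB.isCellSolution_corrector θ v) hw

theorem corrector_mem (θ : EuclideanSpace ℝ (Fin n)) (v : (a 0).ker) :
    corrector a b a₁ θ v ∈ WSpace a b 0 := (hB.isCellSolution_corrector θ v).1

theorem corrector_spec (θ : EuclideanSpace ℝ (Fin n)) (v : (a 0).ker) {w : H}
    (hw : w ∈ WSpace a b 0) :
    (a 0).form (corrector a b a₁ θ v) w = - dot (a₁ v w) θ :=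
  (hB.isCellSolution_corrector θ v).2 w hw

theorem corrector_add (v v' : (a 0).ker) :
    corrector a b a₁ θ (v + v') = corrector a b a₁ θ v + corrector a b a₁ θ v' := by
  refine hB.corrector_eq ⟨Submodule.add_mem _ (hB.corrector_mem _ _) (hB.corrector_mem _ _),
    fun w hw => ?_⟩
  beta_reduce
  rw [map_add, LinearMap.add_apply, hB.corrector_spec θ v hw, hB.corrector_spec θ v' hw, map_add,
    LinearMap.add_apply, dot_add, neg_add]

theorem corrector_smul (c : ℂ) (v : (a 0).ker) :
    corrector a b a₁ θ (c • v) = c • corrector a b a₁ θ v := by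
  refine hB.corrector_eq ⟨Submodule.smul_mem _ _ (hB.corrector_mem _ _), fun w hw => ?_⟩
  beta_reduce
  rw [map_smul, LinearMap.smul_apply, hB.corrector_spec θ v hw, map_smul, LinearMap.smul_apply,
    dot_smul, smul_eq_mul, mul_neg]

theorem corrector_real_smul (t : ℝ) (v : (a 0).ker) :
    corrector a b a₁ (t • θ) v = (t : ℂ) • corrector a b a₁ θ v := by
  refine hB.corrector_eq ⟨Submodule.smul_mem _ _ (hB.corrector_mem _ _), fun w hw => ?_⟩
  beta_reduce
  rw [map_smul, LinearMap.smul_apply, hB.corrector_spec θ v hw, dot_real_smul, smul_eq_mul,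
    mul_neg]

theorem norm_corrector_le (θ : EuclideanSpace ℝ (Fin n)) (v : (a 0).ker) :
    ‖corrector a b a₁ θ v‖ ≤ 2 * M ^ 2 * ‖θ‖ * ‖v‖ := by
  have hM := hB.pos
  set w := corrector a b a₁ θ v with hw
  have hmem : w ∈ WSpace a b 0 := hB.corrector_mem θ v
  have h1 := hB.gap_zero w hmem
  have h2 : (a 0).quad w ≤ 2 * M * ‖θ‖ * ‖v‖ * ‖w‖ := by
    have h3 := hB.norm_dot_le θ v w
    rw [← norm_neg, ← hB.corrector_spec θ v hmem, ← hw, NonnegForm.self_eq_quad,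
      Complex.norm_real] at h3
    exact (le_abs_self _).trans h3
  by_cases h0 : ‖w‖ = 0
  · rw [h0]; positivity
  have h0' : 0 < ‖w‖ := lt_of_le_of_ne (norm_nonneg _) (Ne.symm h0)
  refine le_of_mul_le_mul_right ?_ h0'
  calc ‖w‖ * ‖w‖ = ‖w‖ ^ 2 := (sq _).symm
    _ ≤ M * (2 * M * ‖θ‖ * ‖v‖ * ‖w‖) := h1.trans (mul_le_mul_of_nonneg_left h2 hM.le)
    _ = 2 * M ^ 2 * ‖θ‖ * ‖v‖ * ‖w‖ := by ring

/-- The splitting of `H` into `V_0` and `W_0`. -/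
theorem exists_ker_add (u : H) :
    ∃ (p : (a 0).ker) (w : H), w ∈ WSpace a b 0 ∧ u = p + w ∧ ‖p‖ ≤ M ^ 2 * ‖u‖ ∧
      ‖w‖ ≤ M ^ 2 * ‖u‖ := by
  have hM := hB.pos
  have he := hB.equiv 0 hB.zero_mem
  obtain ⟨P, hP⟩ := NonnegForm.exists_proj he (hB.isClosed_ker hB.zero_mem)
  refine ⟨P u, u - P u, hP u, (add_sub_cancel _ _).symm, ?_, ?_⟩
  · calc ‖(P u : H)‖ ≤ M * (ip a b 0).nrm (P u) := he.norm_le _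
      _ ≤ M * (M * ‖u‖) := by
          gcongr
          exact (NonnegForm.nrm_proj_le hP u).trans (he.nrm_le u)
      _ = M ^ 2 * ‖u‖ := by ring
  · have h := NonnegForm.nrm_sub_proj_le hP u (Submodule.zero_mem _)
    rw [sub_zero] at h
    calc ‖u - P u‖ ≤ M * (ip a b 0).nrm (u - P u) := he.norm_le _
      _ ≤ M * (M * ‖u‖) := by
          gcongr
          exact h.trans (he.nrm_le u)
      _ = M ^ 2 * ‖u‖ := by ring

/-- `a_θ((I + N_θ) z, ·)` is of second order in `θ`. -/
theorem norm_a_corrector_le (hθ : θ ∈ Θ) (z : (a 0).ker) (u : H) :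
    ‖(a θ).form (z + corrector a b a₁ θ z) u‖ ≤ 8 * M ^ 5 * ‖θ‖ ^ 2 * ‖z‖ * ‖u‖ := by
  have hM := hB.pos
  obtain ⟨p, w, hw, rfl, hp', hw'⟩ := hB.exists_ker_add u
  set u := (p : H) + w
  set N := corrector a b a₁ θ z with hN
  have hNle : ‖N‖ ≤ 2 * M ^ 2 * ‖θ‖ * ‖z‖ := hB.norm_corrector_le θ z
  have h1 : ‖(a θ).form z w - dot (a₁ z w) θ‖ ≤ M ^ 3 * ‖θ‖ ^ 2 * ‖z‖ * ‖u‖ := by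
    calc _ ≤ M * ‖θ‖ ^ 2 * ‖z‖ * ‖w‖ := hB.first θ hθ z w
      _ ≤ M * ‖θ‖ ^ 2 * ‖z‖ * (M ^ 2 * ‖u‖) := by gcongr
      _ = M ^ 3 * ‖θ‖ ^ 2 * ‖z‖ * ‖u‖ := by ring
  have h2 : ‖(a θ).form N w - (a 0).form N w‖ ≤ 2 * M ^ 5 * ‖θ‖ ^ 2 * ‖z‖ * ‖u‖ := by
    calc _ ≤ M * ‖θ - 0‖ * ‖N‖ * ‖w‖ := hB.lipschitz θ hθ 0 hB.zero_mem N w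
      _ ≤ M * ‖θ - 0‖ * (2 * M ^ 2 * ‖θ‖ * ‖z‖) * (M ^ 2 * ‖u‖) := by gcongr
      _ = 2 * M ^ 5 * ‖θ‖ ^ 2 * ‖z‖ * ‖u‖ := by rw [sub_zero]; ring
  have h3 : ‖(a θ).form z p‖ ≤ 3 * M ^ 4 * ‖θ‖ ^ 2 * ‖z‖ * ‖u‖ := by
    calc _ ≤ 3 * M ^ 2 * ‖θ‖ ^ 2 * ‖z‖ * ‖p‖ := hB.norm_a_ker_ker_le hθ z p
      _ ≤ 3 * M ^ 2 * ‖θ‖ ^ 2 * ‖z‖ * (M ^ 2 * ‖u‖) := by gcongr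
      _ = 3 * M ^ 4 * ‖θ‖ ^ 2 * ‖z‖ * ‖u‖ := by ring
  have h4 : ‖(a θ).form N p‖ ≤ 2 * M ^ 5 * ‖θ‖ ^ 2 * ‖z‖ * ‖u‖ := by
    calc _ ≤ M * ‖θ‖ * ‖p‖ * ‖N‖ := hB.norm_a_ker_right_le hθ p N
      _ ≤ M * ‖θ‖ * (M ^ 2 * ‖u‖) * (2 * M ^ 2 * ‖θ‖ * ‖z‖) := by gcongr
      _ = 2 * M ^ 5 * ‖θ‖ ^ 2 * ‖z‖ * ‖u‖ := by ring
  -- On `w ∈ W_0` the cell equation `a_0(N, w) = -a₀'(z, w) · θ` cancels the first order. On `p ∈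
  -- V_0`, `a_θ(z, p)` is already quadratic, and `a_θ(N, p)` has one factor `θ` from `N` and one
  -- from `p`.
  have h5 : (a θ).form (z + N) u = ((a θ).form z w - dot (a₁ z w) θ) +
      ((a θ).form N w - (a 0).form N w) + (a θ).form z p + (a θ).form N p := by
    rw [hB.corrector_spec θ z hw]
    simp only [u, map_add, LinearMap.add_apply]
    ring
  have h6 := norm_add₄_le (a := (a θ).form z w - dot (a₁ z w) θ)
    (b := (a θ).form N w - (a 0).form N w) (c := (a θ).form z p) (d := (a θ).form N p)
  rw [h5]
  have h35 : M ^ 3 ≤ M ^ 5 := pow_le_pow_right₀ hB.one_le (by norm_num)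
  have h45 : M ^ 4 ≤ M ^ 5 := pow_le_pow_right₀ hB.one_le (by norm_num)
  have hX : 0 ≤ ‖θ‖ ^ 2 * ‖z‖ * ‖u‖ := by positivity
  have h7 := mul_le_mul_of_nonneg_right h35 hX
  have h8 := mul_le_mul_of_nonneg_right h45 hX
  linarith

/-- The cell problem of `p`, tested with `N_θ z`, reads `a₀'(p, N_θ z) · θ = -a_0(N_θ p, N_θ z)`. So
the cross term `a_θ(N_θ z, p)` yields exactly the correction in `homForm`; its remainder is cubic
since `N_θ` is of first order. -/
theorem norm_a_corrector_sub_homForm_le (hθ : θ ∈ Θ) (z p : (a 0).ker) :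
    ‖(a θ).form (z + corrector a b a₁ θ z) p - homForm a b a₁ a₂ θ z p‖ ≤
      3 * M ^ 3 * ‖θ‖ ^ 3 * ‖z‖ * ‖p‖ := by
  have hM := hB.pos
  set N := corrector a b a₁ θ z with hN
  have hNle : ‖N‖ ≤ 2 * M ^ 2 * ‖θ‖ * ‖z‖ := hB.norm_corrector_le θ z
  have h1 := hB.second θ hθ z p
  have h2 : ‖(a θ).form p N - dot (a₁ p N) θ‖ ≤ 2 * M ^ 3 * ‖θ‖ ^ 3 * ‖z‖ * ‖p‖ := by
    calc _ ≤ M * ‖θ‖ ^ 2 * ‖p‖ * ‖N‖ := hB.first θ hθ p N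
      _ ≤ M * ‖θ‖ ^ 2 * ‖p‖ * (2 * M ^ 2 * ‖θ‖ * ‖z‖) := by gcongr
      _ = 2 * M ^ 3 * ‖θ‖ ^ 3 * ‖z‖ * ‖p‖ := by ring
  have h3 : (a θ).form (z + N) p - homForm a b a₁ a₂ θ z p =
      ((a θ).form z p - dot₂ (a₂ z p) θ) +
        starRingEnd ℂ ((a θ).form p N - dot (a₁ p N) θ) := by
    have h4 := hB.corrector_spec θ p (hB.corrector_mem θ z)
    rw [← hN] at h4
    rw [← neg_eq_iff_eq_neg] at h4
    rw [← h4, sub_neg_eq_add, map_add (starRingEnd ℂ), NonnegForm.conj_symm, NonnegForm.conj_symm,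
      homForm, ← hN, map_add, LinearMap.add_apply]
    ring
  rw [h3]
  have h5 := norm_add_le ((a θ).form z p - dot₂ (a₂ z p) θ)
    (starRingEnd ℂ ((a θ).form p N - dot (a₁ p N) θ))
  rw [RCLike.norm_conj] at h5
  have h13 : M ≤ M ^ 3 := le_self_pow₀ hB.one_le (by norm_num)
  have h6 := mul_le_mul_of_nonneg_right h13 (show 0 ≤ ‖θ‖ ^ 3 * ‖z‖ * ‖p‖ by positivity)
  linarith

theorem homForm_real_smul (t : ℝ) (z p : (a 0).ker) :
    homForm a b a₁ a₂ (t • θ) z p = t ^ 2 * homForm a b a₁ a₂ θ z p := by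
  simp only [homForm, dot₂_real_smul, hB.corrector_real_smul, map_smul, LinearMap.smul_apply,
    LinearMap.map_smulₛₗ, smul_eq_mul, Complex.conj_ofReal]
  ring

theorem norm_homForm_le (θ : EuclideanSpace ℝ (Fin n)) (z p : (a 0).ker) :
    ‖homForm a b a₁ a₂ θ z p‖ ≤ 6 * M ^ 6 * ‖θ‖ ^ 2 * ‖z‖ * ‖p‖ := by
  have hM := hB.pos
  have h1 := hB.norm_dot₂_le θ z p
  have h2 : ‖(a 0).form (corrector a b a₁ θ z) (corrector a b a₁ θ p)‖ ≤
      4 * M ^ 6 * ‖θ‖ ^ 2 * ‖z‖ * ‖p‖ := by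
    have hz := hB.norm_corrector_le θ z
    have hp := hB.norm_corrector_le θ p
    calc _ ≤ M ^ 2 * ‖corrector a b a₁ θ z‖ * ‖corrector a b a₁ θ p‖ :=
          hB.norm_a_le hB.zero_mem _ _
      _ ≤ M ^ 2 * (2 * M ^ 2 * ‖θ‖ * ‖z‖) * (2 * M ^ 2 * ‖θ‖ * ‖p‖) := by gcongr
      _ = 4 * M ^ 6 * ‖θ‖ ^ 2 * ‖z‖ * ‖p‖ := by ring
  have h3 := norm_sub_le (dot₂ (a₂ z p) θ)
    ((a 0).form (corrector a b a₁ θ z) (corrector a b a₁ θ p))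
  have h26 : M ^ 2 ≤ M ^ 6 := pow_le_pow_right₀ hB.one_le (by norm_num)
  have h6 := mul_le_mul_of_nonneg_right h26 (show 0 ≤ ‖θ‖ ^ 2 * ‖z‖ * ‖p‖ by positivity)
  rw [homForm]
  linarith

/-- The homogenised form is a sesquilinear form on `V_0`. -/
theorem exists_homForm_linear (θ : EuclideanSpace ℝ (Fin n)) :
    ∃ B : (a 0).ker →ₗ[ℂ] (a 0).ker →ₗ⋆[ℂ] ℂ, ∀ z p, B z p = homForm a b a₁ a₂ θ z p := by
  refine ⟨LinearMap.mk₂'ₛₗ (RingHom.id ℂ) (starRingEnd ℂ) (homForm a b a₁ a₂ θ) ?_ ?_ ?_ ?_,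
    fun z p => rfl⟩
  · intro x y z
    simp only [homForm, hB.corrector_add, map_add, LinearMap.add_apply, dot₂_add]
    ring
  · intro c x y
    simp only [homForm, hB.corrector_smul, map_smul, LinearMap.smul_apply, dot₂_smul,
      RingHom.id_apply, smul_eq_mul]
    ring
  · intro x y z
    simp only [homForm, hB.corrector_add, map_add, dot₂_add]
    ring
  · intro c x y
    simp only [homForm, hB.corrector_smul, LinearMap.map_smulₛₗ, dot₂_smul, smul_eq_mul]
    ring

end Bounds

end Corrector

end Degenerating

/-! ### Properties of transfer operators -/

namespace Degenerating

variable {n : ℕ} {H : Type*} [NormedAddCommGroup H] [InnerProductSpace ℂ H]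

section Transfer

variable {Θ : Set (EuclideanSpace ℝ (Fin n))}
  {a b : EuclideanSpace ℝ (Fin n) → NonnegForm H}
  {Vs : Submodule ℂ H} {Z : Submodule ℂ (a 0).ker}
  {a₁ : (a 0).ker →ₗ[ℂ] H →ₗ⋆[ℂ] (Fin n → ℂ)}
  {a₂ : (a 0).ker →ₗ[ℂ] (a 0).ker →ₗ⋆[ℂ] Matrix (Fin n) (Fin n) ℂ} {M Kb : ℝ}
  {θ : EuclideanSpace ℝ (Fin n)} {E : EuclideanSpace ℝ (Fin n) → H → H}

namespace IsTransfer

variable (hE : IsTransfer Θ a b Vs Z Kb E) (hB : Bounds Θ a b Vs Z a₁ a₂ M) (hθ : θ ∈ Θ)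
include hE hB hθ

theorem mem_ker {v : H} (hv : v ∈ Vs) : E θ v ∈ (a θ).ker :=
  hB.VStar_le_ker θ ((hE.bijOn θ hθ).mapsTo hv)

/-- `E θ v` lies in the kernel of `a_θ`, so an isometry for `b` is one for the full inner products.
-/
theorem form_eq {v v' : H} (hv : v ∈ Vs) (hv' : v' ∈ Vs) :
    (ip a b θ).form (E θ v) (E θ v') = (b 0).form v v' := by
  have h := hE.isometric θ hθ v hv v' hv'
  rw [ip, NonnegForm.add_apply, (a θ).apply_ker_left (hE.mem_ker hB hθ hv), zero_add]
  exact h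

/-- Linearity is not assumed: it follows because `E θ` preserves a definite form. The square of the
defect expands to the same expression in `V_⋆`, where it is zero. -/
theorem map_add {v v' : H} (hv : v ∈ Vs) (hv' : v' ∈ Vs) :
    E θ (v + v') = E θ v + E θ v' := by
  have hvv := Vs.add_mem hv hv'
  rw [← sub_eq_zero]
  apply (hB.equiv θ hθ).eq_zero
  have : (ip a b θ).form (E θ (v + v') - (E θ v + E θ v')) (E θ (v + v') - (E θ v + E θ v')) =
      0 := by
    simp only [map_sub, _root_.map_add, LinearMap.sub_apply, LinearMap.add_apply,
      hE.form_eq hB hθ hv hv, hE.form_eq hB hθ hv hv', hE.form_eq hB hθ hv hvv,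
      hE.form_eq hB hθ hv' hv, hE.form_eq hB hθ hv' hv', hE.form_eq hB hθ hv' hvv,
      hE.form_eq hB hθ hvv hv, hE.form_eq hB hθ hvv hv', hE.form_eq hB hθ hvv hvv]
    ring
  simpa [NonnegForm.quad] using congrArg Complex.re this

theorem map_smul (c : ℂ) {v : H} (hv : v ∈ Vs) : E θ (c • v) = c • E θ v := by
  have hcv := Vs.smul_mem c hv
  rw [← sub_eq_zero]
  apply (hB.equiv θ hθ).eq_zero
  have : (ip a b θ).form (E θ (c • v) - c • E θ v) (E θ (c • v) - c • E θ v) = 0 := by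
    simp only [map_sub, _root_.map_smul, LinearMap.sub_apply, LinearMap.smul_apply,
      LinearMap.map_smulₛₗ, hE.form_eq hB hθ hv hv, hE.form_eq hB hθ hv hcv,
      hE.form_eq hB hθ hcv hv, hE.form_eq hB hθ hcv hcv, smul_eq_mul]
    ring
  simpa [NonnegForm.quad] using congrArg Complex.re this

theorem map_zero : E θ 0 = 0 := by
  simpa using hE.map_smul hB hθ 0 Vs.zero_mem

theorem nrm_eq {v : H} (hv : v ∈ Vs) : (ip a b θ).nrm (E θ v) = (ip a b 0).nrm v := by
  have h0 : (ip a b 0).form v v = (b 0).form v v := by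
    rw [ip, NonnegForm.add_apply, (a 0).apply_ker_left (hB.le_ker hv), zero_add]
  have h := hE.form_eq hB hθ hv hv
  rw [← h0] at h
  exact congrArg (fun x : ℂ => Real.sqrt x.re) h

theorem norm_le {v : H} (hv : v ∈ Vs) : ‖E θ v‖ ≤ M ^ 2 * ‖v‖ := by
  have hM := hB.pos
  calc ‖E θ v‖ ≤ M * (ip a b θ).nrm (E θ v) := (hB.equiv θ hθ).norm_le _
    _ ≤ M * (M * ‖v‖) := by
        rw [hE.nrm_eq hB hθ hv]
        gcongr
        exact (hB.equiv 0 hB.zero_mem).nrm_le v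
    _ = M ^ 2 * ‖v‖ := by ring

theorem le_norm {v : H} (hv : v ∈ Vs) : ‖v‖ ≤ M ^ 2 * ‖E θ v‖ := by
  have hM := hB.pos
  calc ‖v‖ ≤ M * (ip a b 0).nrm v := (hB.equiv 0 hB.zero_mem).norm_le _
    _ ≤ M * (M * ‖E θ v‖) := by
        rw [← hE.nrm_eq hB hθ hv]
        gcongr
        exact (hB.equiv θ hθ).nrm_le _
    _ = M ^ 2 * ‖E θ v‖ := by ring

/-- `Kb` is an arbitrary real number, hence the absolute value. -/
theorem norm_near_le {v : H} (hv : v ∈ Vs) {z : (a 0).ker} (hz : z ∈ Z) :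
    ‖(b θ).form (E θ v) z - (b 0).form v z‖ ≤ |Kb| * M ^ 2 * ‖θ‖ * ‖v‖ * ‖z‖ := by
  have h0 := hB.equiv 0 hB.zero_mem
  refine le_of_nrm_bound (u := v) (v := (z : H)) h0 h0 (abs_nonneg Kb) (norm_nonneg θ) ?_ le_rfl
  have h1 := (ip a b 0).nrm_nonneg v
  have h2 := (ip a b 0).nrm_nonneg (z : H)
  have h3 : ‖(b θ).form (E θ v) z - (b 0).form v z‖ ≤
      Kb * ‖θ‖ * (ip a b 0).nrm v * (ip a b 0).nrm (z : H) := hE.near θ hθ v hv z hz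
  refine h3.trans ?_
  gcongr
  exact le_abs_self Kb

end IsTransfer

end Transfer

/-! ### Coercivity on `Z` and the approximating problem -/

section Approx

variable [CompleteSpace H] {Θ : Set (EuclideanSpace ℝ (Fin n))}
  {a b : EuclideanSpace ℝ (Fin n) → NonnegForm H}
  {Vs : Submodule ℂ H} {Z : Submodule ℂ (a 0).ker}
  {a₁ : (a 0).ker →ₗ[ℂ] H →ₗ⋆[ℂ] (Fin n → ℂ)}
  {a₂ : (a 0).ker →ₗ[ℂ] (a 0).ker →ₗ⋆[ℂ] Matrix (Fin n) (Fin n) ℂ} {M Kb : ℝ}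
  {θ : EuclideanSpace ℝ (Fin n)} {E : EuclideanSpace ℝ (Fin n) → H → H}

namespace Bounds

variable (hB : Bounds Θ a b Vs Z a₁ a₂ M)
include hB

/-- The splitting of `H` into `V_θ^⋆` and its orthogonal complement, on which `a_θ` has a gap of
order `|θ|²`. -/
theorem exists_VStar_add (hθ : θ ∈ Θ) (u : H) :
    ∃ v ∈ VStar a Vs θ, ∃ w, u = v + w ∧ ‖v‖ ≤ M ^ 2 * ‖u‖ ∧ ‖w‖ ≤ M ^ 2 * ‖u‖ ∧
      ‖θ‖ ^ 2 * ‖w‖ ^ 2 ≤ M * (a θ).quad u ∧ (a θ).quad w = (a θ).quad u := by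
  have hM := hB.pos
  have he := hB.equiv θ hθ
  obtain ⟨P, hP⟩ := NonnegForm.exists_proj he (hB.isClosed_VStar hθ)
  have hk : (P u : H) ∈ (a θ).ker := hB.VStar_le_ker θ (P u).2
  have hquad : (a θ).quad (u - P u) = (a θ).quad u := by
    simp [NonnegForm.quad, (a θ).apply_ker_left hk, (a θ).apply_ker_right hk]
  refine ⟨P u, (P u).2, u - P u, (add_sub_cancel _ _).symm, ?_, ?_, ?_, hquad⟩
  · calc ‖(P u : H)‖ ≤ M * (ip a b θ).nrm (P u) := he.norm_le _
      _ ≤ M * (M * ‖u‖) := by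
          gcongr
          exact (NonnegForm.nrm_proj_le hP u).trans (he.nrm_le u)
      _ = M ^ 2 * ‖u‖ := by ring
  · have h := NonnegForm.nrm_sub_proj_le hP u (Submodule.zero_mem _)
    rw [sub_zero] at h
    calc ‖u - P u‖ ≤ M * (ip a b θ).nrm (u - P u) := he.norm_le _
      _ ≤ M * (M * ‖u‖) := by
          gcongr
          exact h.trans (he.nrm_le u)
      _ = M ^ 2 * ‖u‖ := by ring
  -- At `θ = 0` the space `V_⋆` may be smaller than `V_0`, so no gap is available, but the factor
  -- `‖θ‖ ^ 2` vanishes.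
  · by_cases h0 : θ = 0
    · have := (a θ).quad_nonneg u
      have h1 : ‖θ‖ = 0 := by rw [h0, norm_zero]
      rw [h1, zero_pow two_ne_zero, zero_mul]
      positivity
    · rw [← hquad]
      refine hB.gap θ hθ _ fun v hv => hP u v ?_
      rw [VStar, if_neg h0]
      exact hv

/-- On the defect subspace the homogenised form is coercive, with a constant of order `|θ|²`. -/
theorem homForm_coercive (θ : EuclideanSpace ℝ (Fin n)) {z : (a 0).ker} (hz : z ∈ Z) :
    ‖θ‖ ^ 2 * ‖z‖ ^ 2 ≤ 8 * M ^ 3 * (homForm a b a₁ a₂ θ z z).re := by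
  have hM := hB.pos
  have hM1 := hB.one_le
  have hpow : ∀ {i j : ℕ}, i ≤ j → M ^ i ≤ M ^ j := fun hij => pow_le_pow_right₀ hM1 hij
  -- By homogeneity one radius suffices. It is chosen so that the cubic error `19 * M ^ 7 * ‖θ‖ ^ 3
  -- * ‖z‖ ^ 2`, multiplied by `4 * M ^ 3`, is half of the left-hand side; `152 = 8 * 19`.
  have small : ∀ θ ∈ Θ, ‖θ‖ = (152 * M ^ 10)⁻¹ →
      ‖θ‖ ^ 2 * ‖z‖ ^ 2 ≤ 8 * M ^ 3 * (homForm a b a₁ a₂ θ z z).re := by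
    intro θ hθ hnorm
    have hle1 : ‖θ‖ * (10 * M ^ 7) ≤ 1 := by
      rw [hnorm, inv_mul_le_iff₀ (by positivity), mul_one]
      have := hpow (show 7 ≤ 10 by norm_num)
      have : (0 : ℝ) ≤ M ^ 10 := by positivity
      linarith
    set N := corrector a b a₁ θ z with hN
    have hNle : ‖N‖ ≤ 2 * M ^ 2 * ‖θ‖ * ‖z‖ := hB.norm_corrector_le θ z
    obtain ⟨v', hv', w, hyw, hv'le, -, hgap, -⟩ := hB.exists_VStar_add hθ ((z : H) + N)
    -- Let `v'` be the part of `z + N` in `V_θ^⋆` and `v ∈ V_⋆` close to it. Transversality bounds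
    -- `z` by `z - v = w - N + (v' - v)`, whose last two terms are `O(‖θ‖ ‖z‖)` and are absorbed by
    -- `hle1`.
    have hzw : ‖z‖ ≤ 2 * M * ‖w‖ := by
      obtain ⟨v, hv, hle⟩ := hB.near θ hθ 0 hB.zero_mem v' hv'
      rw [VStar, if_pos rfl] at hv
      rw [sub_zero] at hle
      have h1 : ‖v'‖ ≤ 3 * M ^ 5 * ‖z‖ := by
        have h2 : ‖(z : H) + N‖ ≤ ‖z‖ + 2 * M ^ 2 * M * ‖z‖ := by
          refine (norm_add_le _ _).trans (add_le_add le_rfl (hNle.trans ?_))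
          gcongr
          exact hB.norm_le θ hθ
        have h3 : M ^ 2 * ‖(z : H) + N‖ ≤ M ^ 2 * (‖z‖ + 2 * M ^ 2 * M * ‖z‖) := by gcongr
        have h4 := mul_le_mul_of_nonneg_right (hpow (show 2 ≤ 5 by norm_num)) (norm_nonneg z)
        linarith
      have h2 := (hB.transversal (-v) (Vs.neg_mem hv) z hz).2
      have h3 : -v + (z : H) = w - N + (v' - v) := by
        rw [eq_sub_of_add_eq hyw]; abel
      have h4 : ‖-v + (z : H)‖ ≤ ‖w‖ + ‖N‖ + ‖v' - v‖ := by
        rw [h3]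
        exact (norm_add_le _ _).trans (add_le_add_left (norm_sub_le _ _) _)
      have h5 : ‖v' - v‖ ≤ 3 * M ^ 6 * ‖θ‖ * ‖z‖ := by
        calc _ ≤ M * ‖θ‖ * ‖v'‖ := hle
          _ ≤ M * ‖θ‖ * (3 * M ^ 5 * ‖z‖) := by gcongr
          _ = 3 * M ^ 6 * ‖θ‖ * ‖z‖ := by ring
      have h6 : ‖N‖ ≤ 2 * M ^ 6 * ‖θ‖ * ‖z‖ := by
        refine hNle.trans ?_
        have := hpow (show 2 ≤ 6 by norm_num)
        gcongr
      have h7 : ‖z‖ ≤ M * (‖w‖ + 5 * M ^ 6 * ‖θ‖ * ‖z‖) := by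
        refine h2.trans (mul_le_mul_of_nonneg_left ?_ hM.le)
        linarith
      have h8 := mul_le_mul_of_nonneg_right hle1 (norm_nonneg z)
      nlinarith
    have hquad : ‖θ‖ ^ 2 * ‖z‖ ^ 2 ≤ 4 * M ^ 3 * (a θ).quad (z + N) := by
      calc ‖θ‖ ^ 2 * ‖z‖ ^ 2 ≤ ‖θ‖ ^ 2 * (2 * M * ‖w‖) ^ 2 := by gcongr
        _ = 4 * M ^ 2 * (‖θ‖ ^ 2 * ‖w‖ ^ 2) := by ring
        _ ≤ 4 * M ^ 2 * (M * (a θ).quad (z + N)) := by gcongr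
        _ = 4 * M ^ 3 * (a θ).quad (z + N) := by ring
    have h1 := hB.norm_a_corrector_sub_homForm_le hθ z z
    have h2 := hB.norm_a_corrector_le hθ z N
    rw [← hN] at h1 h2
    have h3 : ‖(a θ).form (z + N) N‖ ≤ 16 * M ^ 7 * ‖θ‖ ^ 3 * ‖z‖ * ‖z‖ := by
      calc _ ≤ 8 * M ^ 5 * ‖θ‖ ^ 2 * ‖z‖ * (2 * M ^ 2 * ‖θ‖ * ‖z‖) := h2.trans (by gcongr)
        _ = 16 * M ^ 7 * ‖θ‖ ^ 3 * ‖z‖ * ‖z‖ := by ring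
    have h4 : (a θ).quad (z + N) = (homForm a b a₁ a₂ θ z z).re +
        ((a θ).form (z + N) z - homForm a b a₁ a₂ θ z z).re + ((a θ).form (z + N) N).re := by
      have : (a θ).quad (z + N) = ((a θ).form (z + N) (z + N)).re := rfl
      rw [this, _root_.map_add ((a θ).form (z + N)), Complex.add_re, Complex.sub_re]
      ring
    have h5 := (Complex.re_le_norm _).trans h1
    have h6 := (Complex.re_le_norm _).trans h3
    have h7 : 3 * M ^ 3 * ‖θ‖ ^ 3 * ‖z‖ * ‖z‖ ≤ 3 * M ^ 7 * ‖θ‖ ^ 3 * ‖z‖ * ‖z‖ := by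
      have := hpow (show 3 ≤ 7 by norm_num)
      gcongr
    have h8 : (a θ).quad (z + N) ≤ (homForm a b a₁ a₂ θ z z).re +
        19 * M ^ 7 * ‖θ‖ ^ 3 * ‖z‖ * ‖z‖ := by linarith
    have h9 : 19 * M ^ 7 * ‖θ‖ ^ 3 * ‖z‖ * ‖z‖ * (8 * M ^ 3) = ‖θ‖ ^ 2 * ‖z‖ ^ 2 := by
      have h10 : ‖θ‖ * (152 * M ^ 10) = 1 := by
        rw [hnorm]
        exact inv_mul_cancel₀ (by positivity)
      calc _ = (‖θ‖ * (152 * M ^ 10)) * (‖θ‖ ^ 2 * ‖z‖ ^ 2) := by ring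
        _ = _ := by rw [h10, one_mul]
    have h10 : 4 * M ^ 3 * (a θ).quad (z + N) ≤ 4 * M ^ 3 * ((homForm a b a₁ a₂ θ z z).re +
        19 * M ^ 7 * ‖θ‖ ^ 3 * ‖z‖ * ‖z‖) := by gcongr
    linarith
  by_cases h0 : θ = 0
  · have h := hB.homForm_real_smul 0 z z (θ := θ)
    rw [zero_smul] at h
    rw [h0, h]
    simp
  have hρ : (152 * M ^ 10)⁻¹ ≤ M⁻¹ := by
    apply inv_anti₀ hM
    have h1 : M ≤ M ^ 10 := le_self_pow₀ hM1 (by norm_num)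
    linarith [pow_pos hM 10]
  obtain ⟨t, ht, hmem, hnorm⟩ := hB.exists_smul_mem h0 (by positivity) hρ
  have h := small _ hmem hnorm
  rw [hB.homForm_real_smul, ← Complex.ofReal_pow, Complex.re_ofReal_mul, norm_smul,
    Real.norm_eq_abs, abs_of_pos ht] at h
  have h1 : t ^ 2 * (‖θ‖ ^ 2 * ‖z‖ ^ 2) ≤
      t ^ 2 * (8 * M ^ 3 * (homForm a b a₁ a₂ θ z z).re) := by linarith
  exact le_of_mul_le_mul_left h1 (by positivity)

theorem homForm_re_nonneg (θ : EuclideanSpace ℝ (Fin n)) {z : (a 0).ker} (hz : z ∈ Z) :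
    0 ≤ (homForm a b a₁ a₂ θ z z).re := by
  have hM := hB.pos
  exact nonneg_of_mul_nonneg_right
    ((show (0 : ℝ) ≤ ‖θ‖ ^ 2 * ‖z‖ ^ 2 by positivity).trans (hB.homForm_coercive θ hz))
    (by positivity)

omit [CompleteSpace H] in
theorem quad_b_ker (p : (a 0).ker) : (M ^ 2)⁻¹ * ‖p‖ ^ 2 ≤ (b 0).quad p := by
  have h := (hB.equiv 0 hB.zero_mem).coercive p
  rwa [ip_quad, (a 0).quad_eq_zero_of_mem_ker p.2, zero_add] at h

omit [CompleteSpace H] in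
/-- The projection of `V_0` onto `Z` along `V_⋆`. -/
theorem exists_defect_proj :
    ∃ π : (a 0).ker →ₗ[ℂ] (a 0).ker, (∀ p, π p ∈ Z) ∧ (∀ p, ((p - π p : (a 0).ker) : H) ∈ Vs) ∧
      (∀ v ∈ Vs, ∀ z ∈ Z, ∀ p : (a 0).ker, (p : H) = v + z → π p = z) ∧
      ∀ p, ‖π p‖ ≤ M * ‖p‖ := by
  have huniq : ∀ v ∈ Vs, ∀ z ∈ Z, ∀ v' ∈ Vs, ∀ z' ∈ Z, v + (z : H) = v' + z' → z = z' := by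
    intro v hv z hz v' hv' z' hz' h
    have h1 := (hB.transversal (v - v') (Vs.sub_mem hv hv') (z - z') (Z.sub_mem hz hz')).2
    have h2 : v - v' + ((z - z' : (a 0).ker) : H) = 0 := by
      rw [Submodule.coe_sub, sub_add_sub_comm, h, sub_self]
    rw [h2, norm_zero, mul_zero] at h1
    exact sub_eq_zero.mp (norm_le_zero_iff.mp h1)
  have hex : ∀ p : (a 0).ker, ∃ z ∈ Z, ∃ v ∈ Vs, (p : H) = v + z := fun p => by
    obtain ⟨v, hv, z, hz, h⟩ := hB.exists_add p p.2
    exact ⟨z, hz, v, hv, h⟩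
  choose q hq v hv hadd using hex
  refine ⟨{ toFun := q, map_add' := ?_, map_smul' := ?_ }, hq, fun p => ?_, ?_, fun p => ?_⟩
  · intro x y
    refine huniq _ (hv (x + y)) _ (hq _) _ (Vs.add_mem (hv x) (hv y)) _
      (Z.add_mem (hq x) (hq y)) ?_
    rw [← hadd, Submodule.coe_add, Submodule.coe_add, hadd x, hadd y]
    abel
  · intro c x
    refine huniq _ (hv (c • x)) _ (hq _) _ (Vs.smul_mem c (hv x)) _ (Z.smul_mem c (hq x)) ?_
    rw [← hadd, Submodule.coe_smul, RingHom.id_apply, Submodule.coe_smul, hadd x, smul_add]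
  · change ((p - q p : (a 0).ker) : H) ∈ Vs
    rw [Submodule.coe_sub, hadd p, add_sub_cancel_right]
    exact hv p
  · intro w hw z hz p hp
    exact huniq _ (hv p) _ (hq p) _ hw _ hz (by rw [← hadd, hp])
  · have h := (hB.transversal (v p) (hv p) (q p) (hq p)).2
    rwa [← hadd] at h

/-- Lax-Milgram on `V_0` in the single unknown `p = v + z`, with `z = π p`. The homogenised part is
non-negative on `Z`, and `b_0` is coercive on `V_0` because `a_0` vanishes there. Linearity of `E θ`
on `V_⋆` makes the right-hand side antilinear. -/
theorem existsUnique_approxSolution (hE : IsTransfer Θ a b Vs Z Kb E) (hθ : θ ∈ Θ) (ε : ℝ)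
    (f : H →L⋆[ℂ] ℂ) :
    ∃! p : H × (a 0).ker, IsApproxSolution a b a₁ a₂ Vs Z E ε θ f p.1 p.2 := by
  have hM := hB.pos
  have : CompleteSpace (a 0).ker := (hB.isClosed_ker hB.zero_mem).completeSpace_coe
  obtain ⟨π, hπZ, hπV, hπ, hπle⟩ := hB.exists_defect_proj
  obtain ⟨A, hA⟩ := hB.exists_homForm_linear (ε⁻¹ • θ)
  let B : (a 0).ker →ₗ[ℂ] (a 0).ker →ₗ⋆[ℂ] ℂ :=
    LinearMap.mk₂'ₛₗ (RingHom.id ℂ) (starRingEnd ℂ)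
      (fun p p' => A (π p) (π p') + (b 0).form p p')
      (by intro x y z; simp; ring) (by intro c x y; simp; ring)
      (by intro x y z; simp; ring) (by intro c x y; simp; ring)
  have hBapp : ∀ p p', B p p' = A (π p) (π p') + (b 0).form p p' := fun p p' => rfl
  let F : (a 0).ker →ₗ⋆[ℂ] ℂ :=
    { toFun := fun p => f (E θ ((p - π p : (a 0).ker) : H) + π p)
      map_add' := by
        intro x y
        have h : x + y - π (x + y) = (x - π x) + (y - π y) := by
          rw [_root_.map_add]; abel
        rw [h, Submodule.coe_add, hE.map_add hB hθ (hπV x) (hπV y), _root_.map_add π,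
          Submodule.coe_add, ← _root_.map_add f]
        congr 1
        abel
      map_smul' := by
        intro c x
        have h : c • x - π (c • x) = c • (x - π x) := by
          rw [_root_.map_smul, smul_sub]
        rw [h, Submodule.coe_smul, hE.map_smul hB hθ c (hπV x), _root_.map_smul π,
          Submodule.coe_smul, ← smul_add, ContinuousLinearMap.map_smulₛₗ] }
  have hFapp : ∀ p, F p = f (E θ ((p - π p : (a 0).ker) : H) + π p) := fun p => rfl
  have hlax := exists_unique_of_coercive B (c := (M ^ 2)⁻¹)
    (C := 6 * M ^ 6 * ‖ε⁻¹ • θ‖ ^ 2 * M ^ 2 + M ^ 2) (by positivity) (fun p p' => ?_)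
    (fun p => ?_) F (F := ‖f‖ * (M ^ 2 * (1 + M) + M)) (fun p => ?_)
  · obtain ⟨p, hp, huniq⟩ := hlax
    refine ⟨(((p - π p : (a 0).ker) : H), π p), ⟨hπV p, hπZ p, ?_⟩, ?_⟩
    · intro v' hv' z' hz'
      have h := hp (⟨v', hB.le_ker hv'⟩ + z')
      have hz : π (⟨v', hB.le_ker hv'⟩ + z') = z' := hπ v' hv' z' hz' _ rfl
      rw [hBapp, hFapp, hz, add_sub_cancel_right, hA] at h
      beta_reduce
      rw [Submodule.coe_sub, sub_add_cancel]
      exact h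
    · rintro ⟨v, z⟩ ⟨hv, hz, heqn⟩
      have hz1 : π (⟨v, hB.le_ker hv⟩ + z) = z := hπ v hv z hz _ rfl
      have hpe : ⟨v, hB.le_ker hv⟩ + z = p := by
        refine huniq _ fun p' => ?_
        have h := heqn _ (hπV p') _ (hπZ p')
        beta_reduce at h
        rw [hBapp, hFapp, hz1, hA, ← h]
        simp
      rw [← hpe, hz1]
      simp
  · have h1 := hB.norm_homForm_le (ε⁻¹ • θ) (π p) (π p')
    have h2 := hB.norm_b_le hB.zero_mem p p'
    have h3 := hπle p
    have h4 := hπle p'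
    rw [hBapp, hA]
    calc _ ≤ 6 * M ^ 6 * ‖ε⁻¹ • θ‖ ^ 2 * ‖π p‖ * ‖π p'‖ + M ^ 2 * ‖p‖ * ‖p'‖ :=
          (norm_add_le _ _).trans (add_le_add h1 h2)
      _ ≤ 6 * M ^ 6 * ‖ε⁻¹ • θ‖ ^ 2 * (M * ‖p‖) * (M * ‖p'‖) + M ^ 2 * ‖p‖ * ‖p'‖ := by gcongr
      _ = _ := by ring
  · have h1 := hB.quad_b_ker p
    have h2 := hB.homForm_re_nonneg (ε⁻¹ • θ) (hπZ p)
    have h3 := Complex.re_le_norm (B p p)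
    rw [hBapp, hA, Complex.add_re] at h3
    rw [hBapp, hA]
    have h4 : (b 0).quad p = ((b 0).form p p).re := rfl
    linarith
  · have h1 := hE.norm_le hB hθ (hπV p)
    have h2 : ‖((p - π p : (a 0).ker) : H)‖ ≤ ‖p‖ + M * ‖p‖ :=
      (norm_sub_le p (π p)).trans (add_le_add le_rfl (hπle p))
    rw [hFapp, mul_assoc]
    refine (f.le_opNorm _).trans (mul_le_mul_of_nonneg_left ?_ (norm_nonneg _))
    have h3 := mul_le_mul_of_nonneg_left h2 (sq_nonneg M)
    have h4 := norm_add_le (E θ ((p - π p : (a 0).ker) : H)) (π p)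
    have h5 := hπle p
    have h6 : ‖((π p : (a 0).ker) : H)‖ = ‖π p‖ := rfl
    linarith

/-- The a priori bounds for the approximating problem. -/
theorem approxSolution_bounds (hE : IsTransfer Θ a b Vs Z Kb E) (hθ : θ ∈ Θ) {ε : ℝ}
    (hε : 0 < ε) {f : H →L⋆[ℂ] ℂ} {F : ℝ} (hF : ∀ u, ‖f u‖ ≤ F * ‖u‖) (hF0 : 0 ≤ F)
    {v : H} {z : (a 0).ker} (h : IsApproxSolution a b a₁ a₂ Vs Z E ε θ f v z) :
    ‖v‖ ≤ 2 * M ^ 6 * F ∧ ‖z‖ ≤ 2 * M ^ 6 * F ∧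
      ‖θ‖ ^ 2 * ‖z‖ ≤ 24 * M ^ 10 * F * ε ^ 2 := by
  have hM := hB.pos
  have hM1 := hB.one_le
  obtain ⟨hv, hz, heqn⟩ := h
  beta_reduce at heqn
  obtain ⟨htv, htz⟩ := hB.transversal v hv z hz
  -- Test with the solution itself and drop the non-negative homogenised part.
  have hs : ‖v + z‖ ≤ 2 * M ^ 5 * F := by
    have h1 := heqn v hv z hz
    have h2 := hB.homForm_re_nonneg (ε⁻¹ • θ) hz
    have h3 := hB.quad_b_ker (⟨v, hB.le_ker hv⟩ + z)
    have h4 := congrArg Complex.re h1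
    rw [Complex.add_re] at h4
    have h5 : (b 0).quad (v + z) = ((b 0).form (v + z) (v + z)).re := rfl
    have h6 := (Complex.re_le_norm _).trans (hF (E θ v + z))
    have h7 : ‖E θ v + z‖ ≤ 2 * M ^ 3 * ‖v + z‖ := by
      have h8 := hE.norm_le hB hθ hv
      have h9 := mul_le_mul_of_nonneg_left htv (sq_nonneg M)
      have h10 : M * ‖v + z‖ ≤ M ^ 3 * ‖v + z‖ := by
        gcongr
        exact le_self_pow₀ hM1 (by norm_num)
      have h11 := norm_add_le (E θ v) z
      have h12 : ‖((z : (a 0).ker) : H)‖ = ‖z‖ := rfl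
      linarith
    have h8 := mul_le_mul_of_nonneg_left h7 hF0
    have h9 : (M ^ 2)⁻¹ * ‖v + z‖ ^ 2 ≤ F * (2 * M ^ 3 * ‖v + z‖) := by
      have : ‖(⟨v, hB.le_ker hv⟩ + z : (a 0).ker)‖ = ‖v + z‖ := rfl
      rw [this] at h3
      have h3' : (M ^ 2)⁻¹ * ‖v + z‖ ^ 2 ≤ (b 0).quad (v + z) := h3
      linarith
    rw [inv_mul_le_iff₀ (by positivity)] at h9
    by_cases h0 : ‖v + z‖ = 0
    · rw [h0]; positivity
    have h0' : 0 < ‖v + z‖ := lt_of_le_of_ne (norm_nonneg _) (Ne.symm h0)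
    refine le_of_mul_le_mul_right ?_ h0'
    calc _ = ‖v + z‖ ^ 2 := by ring
      _ ≤ _ := h9
      _ = _ := by ring
  have hMs : M * ‖v + z‖ ≤ 2 * M ^ 6 * F := by
    calc _ ≤ M * (2 * M ^ 5 * F) := by gcongr
      _ = _ := by ring
  refine ⟨htv.trans hMs, htz.trans hMs, ?_⟩
  -- Testing with `z` alone isolates the homogenised term, whose coercivity constant is of order `‖θ
  -- / ε‖ ^ 2`.
  have h1 := heqn 0 Vs.zero_mem z hz
  rw [hE.map_zero hB hθ, zero_add] at h1
  have h2 := hB.homForm_coercive (ε⁻¹ • θ) hz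
  have h3 : (homForm a b a₁ a₂ (ε⁻¹ • θ) z z).re ≤ 3 * M ^ 7 * F * ‖z‖ := by
    rw [eq_sub_of_add_eq h1]
    have h4 := hB.norm_b_le hB.zero_mem (v + z) z
    have h5 := hF z
    have h6 := (Complex.re_le_norm _).trans (norm_sub_le (f z) ((b 0).form (v + z) z))
    have h7 : M ^ 2 * ‖v + z‖ * ‖z‖ ≤ M ^ 2 * (2 * M ^ 5 * F) * ‖z‖ := by gcongr
    have h8 : 1 * F * ‖z‖ ≤ M ^ 7 * F * ‖z‖ := by
      gcongr
      exact one_le_pow₀ hM1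
    have h12 : ‖((z : (a 0).ker) : H)‖ = ‖z‖ := rfl
    rw [h12] at h4 h5
    linarith
  have h4 := mul_le_mul_of_nonneg_left h3 (show 0 ≤ 8 * M ^ 3 by positivity)
  have h5 : ‖ε⁻¹ • θ‖ = ε⁻¹ * ‖θ‖ := by
    rw [norm_smul, Real.norm_eq_abs, abs_of_pos (by positivity)]
  rw [h5] at h2
  by_cases h0 : ‖z‖ = 0
  · rw [h0, mul_zero]; positivity
  have h0' : 0 < ‖z‖ := lt_of_le_of_ne (norm_nonneg _) (Ne.symm h0)
  refine le_of_mul_le_mul_right ?_ h0'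
  calc ‖θ‖ ^ 2 * ‖z‖ * ‖z‖ = ε ^ 2 * ((ε⁻¹ * ‖θ‖) ^ 2 * ‖z‖ ^ 2) := by field_simp
    _ ≤ ε ^ 2 * (8 * M ^ 3 * (3 * M ^ 7 * F * ‖z‖)) := by
        exact mul_le_mul_of_nonneg_left (h2.trans h4) (sq_nonneg ε)
    _ = 24 * M ^ 10 * F * ε ^ 2 * ‖z‖ := by ring

end Bounds

end Approx

end Degenerating

/-! ### The residual and the error estimates -/

namespace Degenerating

variable {n : ℕ} {H : Type*} [NormedAddCommGroup H] [InnerProductSpace ℂ H]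

section Estimate

variable [CompleteSpace H] {Θ : Set (EuclideanSpace ℝ (Fin n))}
  {a b : EuclideanSpace ℝ (Fin n) → NonnegForm H}
  {Vs : Submodule ℂ H} {Z : Submodule ℂ (a 0).ker}
  {a₁ : (a 0).ker →ₗ[ℂ] H →ₗ⋆[ℂ] (Fin n → ℂ)}
  {a₂ : (a 0).ker →ₗ[ℂ] (a 0).ker →ₗ⋆[ℂ] Matrix (Fin n) (Fin n) ℂ} {M Kb : ℝ}
  {θ : EuclideanSpace ℝ (Fin n)} {E : EuclideanSpace ℝ (Fin n) → H → H}

namespace Bounds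

variable (hB : Bounds Θ a b Vs Z a₁ a₂ M)
include hB

/-- Every `u` whose energy is at most `Q²` is the sum of elements of `V_θ^⋆` and `Z` up to an
error of order `ε Q`. -/
theorem exists_decomposition (hθ : θ ∈ Θ) {ε Q : ℝ} (hε : 0 < ε) (hQ : 0 ≤ Q) {u : H}
    (hu : ‖u‖ ≤ Q) (hq : (a θ).quad u ≤ ε ^ 2 * Q ^ 2) :
    ∃ v ∈ VStar a Vs θ, ∃ z ∈ Z, ∃ w : H, u = v + z + w ∧ ‖v‖ ≤ 6 * M ^ 7 * Q ∧
      ‖z‖ ≤ 6 * M ^ 7 * Q ∧ ‖θ‖ * ‖z‖ ≤ 6 * M ^ 7 * ε * Q ∧ ‖w‖ ≤ 6 * M ^ 7 * ε * Q := by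
  have hM := hB.pos
  have hM1 := hB.one_le
  have hεQ : 0 ≤ ε * Q := by positivity
  have hpowQ : ∀ {i j : ℕ}, i ≤ j → M ^ i * Q ≤ M ^ j * Q := fun hij => by
    have := pow_le_pow_right₀ hM1 hij
    gcongr
  have hpowε : ∀ {i j : ℕ}, i ≤ j → M ^ i * (ε * Q) ≤ M ^ j * (ε * Q) := fun hij => by
    have := pow_le_pow_right₀ hM1 hij
    gcongr
  obtain ⟨v₀, hv₀, x, hux, hv₀le, hxle, hgap, hxq⟩ := hB.exists_VStar_add hθ u
  have hv₀Q : ‖v₀‖ ≤ M ^ 2 * Q := hv₀le.trans (by gcongr)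
  have hxQ : ‖x‖ ≤ M ^ 2 * Q := hxle.trans (by gcongr)
  have hθx : ‖θ‖ * ‖x‖ ≤ M * (ε * Q) := by
    refine abs_le_of_sq_le_sq' ?_ (by positivity) |>.2
    calc (‖θ‖ * ‖x‖) ^ 2 = ‖θ‖ ^ 2 * ‖x‖ ^ 2 := by ring
      _ ≤ M * (a θ).quad u := hgap
      _ ≤ M * (ε ^ 2 * Q ^ 2) := by gcongr
      _ ≤ M ^ 2 * (ε ^ 2 * Q ^ 2) := by
          gcongr
          exact le_self_pow₀ hM1 two_ne_zero
      _ = (M * (ε * Q)) ^ 2 := by ring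
  -- For `θ` bounded away from `0` the gap alone gives `‖x‖ ≲ ε Q`, and no component in `Z` is
  -- needed.
  by_cases hlarge : (2 * M ^ 2)⁻¹ ≤ ‖θ‖
  · refine ⟨v₀, hv₀, 0, Z.zero_mem, x, by simpa using hux, ?_, ?_, ?_, ?_⟩
    · have := hpowQ (show 2 ≤ 7 by norm_num)
      have : 0 ≤ M ^ 7 * Q := by positivity
      linarith
    · rw [norm_zero]; positivity
    · rw [norm_zero, mul_zero]; positivity
    · have h1 := mul_le_mul_of_nonneg_right hlarge (norm_nonneg x)
      rw [inv_mul_le_iff₀ (by positivity)] at h1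
      have h2 := mul_le_mul_of_nonneg_left hθx (show 0 ≤ 2 * M ^ 2 by positivity)
      have h3 := hpowε (show 3 ≤ 7 by norm_num)
      have : 0 ≤ M ^ 7 * (ε * Q) := by positivity
      linarith
  · have hsmall : ‖θ‖ * (2 * M ^ 2) ≤ 1 := by
      have h := mul_le_mul_of_nonneg_right (not_le.mp hlarge).le
        (show 0 ≤ 2 * M ^ 2 by positivity)
      rwa [inv_mul_cancel₀ (by positivity)] at h
    obtain ⟨p, w, hw, hxpw, hple, hwle⟩ := hB.exists_ker_add x
    obtain ⟨v₁, hv₁, z, hz, hpvz⟩ := hB.exists_add p p.2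
    obtain ⟨hv₁le, hzle⟩ := hB.transversal v₁ hv₁ z hz
    rw [← hpvz] at hv₁le hzle
    have hv₁x : ‖v₁‖ ≤ M ^ 3 * ‖x‖ := by
      calc ‖v₁‖ ≤ M * (M ^ 2 * ‖x‖) := hv₁le.trans (mul_le_mul_of_nonneg_left hple hM.le)
        _ = M ^ 3 * ‖x‖ := by ring
    have hzx : ‖z‖ ≤ M ^ 3 * ‖x‖ := by
      calc ‖z‖ ≤ M * (M ^ 2 * ‖x‖) := hzle.trans (mul_le_mul_of_nonneg_left hple hM.le)
        _ = M ^ 3 * ‖x‖ := by ring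
    have hwε : ‖w‖ ≤ 4 * M ^ 5 * (ε * Q) := by
      have h1 := hB.gap_zero w hw
      -- The gap at `0` controls `w` by `a_0`, while the energy is that of `a_θ`; the difference `M
      -- ‖θ‖ ‖w‖²` is absorbed by `hsmall`.
      have h2 : (a 0).quad w ≤ (a θ).quad w + M * ‖θ‖ * ‖w‖ * ‖w‖ := by
        have h3 := hB.lipschitz 0 hB.zero_mem θ hθ w w
        rw [zero_sub, norm_neg] at h3
        have h4 := (Complex.re_le_norm _).trans h3
        rw [Complex.sub_re] at h4
        have h5 : (a 0).quad w = ((a 0).form w w).re := rfl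
        have h6 : (a θ).quad w = ((a θ).form w w).re := rfl
        linarith
      have h3 : (a θ).quad w ≤ 8 * M ^ 8 * (ε * Q) ^ 2 := by
        have h4 := (a θ).quad_add_le x (-p)
        have h5 : x + -(p : H) = w := by rw [hxpw]; abel
        rw [h5, NonnegForm.quad_neg, hxq] at h4
        have h6 : (a θ).quad p ≤ 3 * M ^ 8 * (ε * Q) ^ 2 := by
          calc (a θ).quad p ≤ ‖(a θ).form p p‖ := Complex.re_le_norm _
            _ ≤ 3 * M ^ 2 * ‖θ‖ ^ 2 * ‖p‖ * ‖p‖ := hB.norm_a_ker_ker_le hθ p p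
            _ ≤ 3 * M ^ 2 * ‖θ‖ ^ 2 * (M ^ 2 * ‖x‖) * (M ^ 2 * ‖x‖) := by gcongr
            _ = 3 * M ^ 6 * (‖θ‖ * ‖x‖) ^ 2 := by ring
            _ ≤ 3 * M ^ 6 * (M * (ε * Q)) ^ 2 := by gcongr
            _ = 3 * M ^ 8 * (ε * Q) ^ 2 := by ring
        have h7 : 1 * (ε * Q) ^ 2 ≤ M ^ 8 * (ε * Q) ^ 2 := by
          gcongr
          exact one_le_pow₀ hM1
        linarith
      refine abs_le_of_sq_le_sq' ?_ (by positivity) |>.2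
      have h4 := mul_le_mul_of_nonneg_right hsmall (sq_nonneg ‖w‖)
      have h5 : M * (a 0).quad w ≤ M * (8 * M ^ 8 * (ε * Q) ^ 2 + M * ‖θ‖ * ‖w‖ * ‖w‖) :=
        mul_le_mul_of_nonneg_left (by linarith) hM.le
      have h6 : M ^ 9 * (ε * Q) ^ 2 ≤ M ^ 10 * (ε * Q) ^ 2 := by
        gcongr
        · norm_num
      nlinarith
    -- Moving `v₁` from `V_⋆` to `V_θ^⋆` costs `‖θ‖ ‖v₁‖ ≲ ‖θ‖ ‖x‖ ≲ ε Q`, which joins the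
    -- remainder.
    obtain ⟨v₂, hv₂, hv₂le⟩ := hB.near 0 hB.zero_mem θ hθ v₁ (by rwa [VStar, if_pos rfl])
    rw [zero_sub, norm_neg] at hv₂le
    have hd : ‖v₁ - v₂‖ ≤ M ^ 5 * (ε * Q) := by
      calc _ ≤ M * ‖θ‖ * (M ^ 3 * ‖x‖) := hv₂le.trans (by gcongr)
        _ = M ^ 4 * (‖θ‖ * ‖x‖) := by ring
        _ ≤ M ^ 4 * (M * (ε * Q)) := by gcongr
        _ = M ^ 5 * (ε * Q) := by ring
    have hv₁Q : ‖v₁‖ ≤ M ^ 5 * Q := by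
      calc _ ≤ M ^ 3 * (M ^ 2 * Q) := hv₁x.trans (by gcongr)
        _ = M ^ 5 * Q := by ring
    have hd' : ‖v₁ - v₂‖ ≤ M ^ 7 * Q := by
      calc _ ≤ M * M * (M ^ 5 * Q) := by
            refine hv₂le.trans ?_
            have := hB.norm_le θ hθ
            gcongr
        _ = M ^ 7 * Q := by ring
    refine ⟨v₀ + v₂, Submodule.add_mem _ hv₀ hv₂, z, hz, w + (v₁ - v₂), ?_, ?_, ?_, ?_, ?_⟩
    · rw [hux, hxpw, hpvz]; abel
    · have h1 := norm_add_le v₀ v₂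
      have h2 : ‖v₂‖ ≤ ‖v₁‖ + ‖v₁ - v₂‖ := by
        have := norm_sub_le v₁ (v₁ - v₂)
        rwa [sub_sub_cancel] at this
      have h3 := hpowQ (show 2 ≤ 7 by norm_num)
      have h4 := hpowQ (show 5 ≤ 7 by norm_num)
      have : 0 ≤ M ^ 7 * Q := by positivity
      linarith
    · have h1 : ‖z‖ ≤ M ^ 5 * Q := by
        calc _ ≤ M ^ 3 * (M ^ 2 * Q) := hzx.trans (by gcongr)
          _ = M ^ 5 * Q := by ring
      have h4 := hpowQ (show 5 ≤ 7 by norm_num)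
      have : 0 ≤ M ^ 7 * Q := by positivity
      linarith
    · have h1 : ‖θ‖ * ‖z‖ ≤ M ^ 4 * (ε * Q) := by
        calc _ ≤ ‖θ‖ * (M ^ 3 * ‖x‖) := by gcongr
          _ = M ^ 3 * (‖θ‖ * ‖x‖) := by ring
          _ ≤ M ^ 3 * (M * (ε * Q)) := by gcongr
          _ = M ^ 4 * (ε * Q) := by ring
      have h4 := hpowε (show 4 ≤ 7 by norm_num)
      have : 0 ≤ M ^ 7 * (ε * Q) := by positivity
      linarith
    · have h1 := norm_add_le w (v₁ - v₂)
      have h4 := hpowε (show 5 ≤ 7 by norm_num)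
      have : 0 ≤ M ^ 7 * (ε * Q) := by positivity
      linarith

theorem existsUnique_solution (hθ : θ ∈ Θ) {ε : ℝ} (hε : 0 < ε) (hε1 : ε < 1)
    (f : H →L⋆[ℂ] ℂ) : ∃! u : H, IsSolution a b ε θ f u := by
  have hM := hB.pos
  have hs : 1 ≤ (ε ^ 2)⁻¹ := (one_le_inv₀ (by positivity)).mpr (pow_le_one₀ hε.le hε1.le)
  have hs0 : 0 ≤ (ε ^ 2)⁻¹ := by positivity
  refine exists_unique_of_coercive (((a θ).smul _ hs0).add (b θ)).form (c := (M ^ 2)⁻¹)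
    (C := (ε ^ 2)⁻¹ * M ^ 2 + M ^ 2) (by positivity) (fun u v => ?_) (fun u => ?_)
    f.toLinearMap (F := ‖f‖) f.le_opNorm
  · have h1 := hB.norm_a_le hθ u v
    have h2 := hB.norm_b_le hθ u v
    rw [NonnegForm.add_apply, NonnegForm.smul_apply]
    have h3 := norm_add_le (((ε ^ 2)⁻¹ : ℝ) * (a θ).form u v) ((b θ).form u v)
    rw [norm_mul, Complex.norm_real, Real.norm_eq_abs, abs_of_nonneg hs0] at h3
    have h4 := mul_le_mul_of_nonneg_left h1 hs0
    linarith
  · have h1 := (hB.equiv θ hθ).coercive u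
    rw [ip_quad] at h1
    have h2 := mul_le_mul_of_nonneg_right hs ((a θ).quad_nonneg u)
    rw [NonnegForm.self_eq_quad, Complex.norm_real, NonnegForm.add_quad, NonnegForm.smul_quad]
    exact le_trans (by linarith) (le_abs_self _)

/-- The residual of the approximation in the equation for `u_{ε, θ}`. -/
theorem norm_residual_le (hE : IsTransfer Θ a b Vs Z Kb E) (hθ : θ ∈ Θ) {ε : ℝ}
    (hε : 0 < ε) (hε1 : ε < 1) {f : H →L⋆[ℂ] ℂ} {F : ℝ} (hF : ∀ u, ‖f u‖ ≤ F * ‖u‖)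
    (hF0 : 0 ≤ F) {v : H} {z : (a 0).ker} (hvz : IsApproxSolution a b a₁ a₂ Vs Z E ε θ f v z)
    {C D : ℝ} (hC : 24 * M ^ 10 ≤ C) (hD : 8 * M ^ 5 + |Kb| * M ^ 2 ≤ D)
    {Q : ℝ} (hQ : 0 ≤ Q) {u : H} (hu : ‖u‖ ≤ Q) (hq : (a θ).quad u ≤ ε ^ 2 * Q ^ 2) :
    ‖corrector a b a₁ θ z‖ ≤ C * F * ε ∧
    ‖f u - (((ε ^ 2)⁻¹ : ℝ) * (a θ).form (E θ v + (z + corrector a b a₁ θ z)) u +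
      (b θ).form (E θ v + (z + corrector a b a₁ θ z)) u)‖ ≤ (C + 10 * D * C ^ 2) * F * ε * Q := by
  have hM := hB.pos
  have hM1 := hB.one_le
  have hCk : ∀ {k : ℝ} {i : ℕ}, k ≤ 24 → i ≤ 10 → k * M ^ i ≤ C := fun {k i} hk hi =>
    calc k * M ^ i ≤ 24 * M ^ i := by gcongr
      _ ≤ 24 * M ^ 10 := by gcongr
      _ ≤ C := hC
  have hC0 : 0 ≤ C := le_trans (by positivity) hC
  have hD0 : 0 ≤ D := le_trans (by positivity) hD
  have hKbM : 0 ≤ |Kb| * M ^ 2 := by positivity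
  have hDk : ∀ {k : ℝ} {i : ℕ}, k ≤ 8 → i ≤ 5 → k * M ^ i ≤ D := fun {k i} hk hi =>
    calc k * M ^ i ≤ 8 * M ^ i := by gcongr
      _ ≤ 8 * M ^ 5 := by gcongr
      _ ≤ D := by linarith
  have hDM : M ≤ D := by simpa using hDk (k := 1) (i := 1) (by norm_num) (by norm_num)
  have hDM2 : M ^ 2 ≤ D := by simpa using hDk (k := 1) (i := 2) (by norm_num) (by norm_num)
  have hDKb : |Kb| * M ^ 2 ≤ D := le_trans (by linarith [pow_pos hM 5]) hD
  obtain ⟨hv, hz, hθz⟩ := hB.approxSolution_bounds hE hθ hε hF hF0 hvz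
  obtain ⟨hvV, hzZ, heqn⟩ := hvz
  beta_reduce at heqn
  -- Interpolation between `‖θ‖² ‖z‖ ≲ ε² F` and `‖z‖ ≲ F`; 48 is rounded up to the square 49.
  have hθz1 : ‖θ‖ * ‖z‖ ≤ 7 * M ^ 8 * F * ε := by
    refine abs_le_of_sq_le_sq' ?_ (by positivity) |>.2
    calc (‖θ‖ * ‖z‖) ^ 2 = (‖θ‖ ^ 2 * ‖z‖) * ‖z‖ := by ring
      _ ≤ (24 * M ^ 10 * F * ε ^ 2) * (2 * M ^ 6 * F) := by gcongr
      _ = 48 * (M ^ 8 * F * ε) ^ 2 := by ring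
      _ ≤ 49 * (M ^ 8 * F * ε) ^ 2 := by gcongr; norm_num
      _ = (7 * M ^ 8 * F * ε) ^ 2 := by ring
  have hNle := hB.norm_corrector_le (a₁ := a₁) θ z
  have hspec1 := hB.norm_a_corrector_le hθ z
  have hspec2 := hB.norm_a_corrector_sub_homForm_le hθ z
  set N := corrector a b a₁ θ z with hN
  have hNC : ‖N‖ ≤ C * F * ε := by
    calc ‖N‖ ≤ 2 * M ^ 2 * (‖θ‖ * ‖z‖) := by linarith
      _ ≤ 2 * M ^ 2 * (7 * M ^ 8 * F * ε) := by gcongr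
      _ = 14 * M ^ 10 * (F * ε) := by ring
      _ ≤ C * (F * ε) := by gcongr; exact hCk (by norm_num) le_rfl
      _ = C * F * ε := by ring
  refine ⟨hNC, ?_⟩
  have hvC : ‖v‖ ≤ C * F := hv.trans (by gcongr; exact hCk (by norm_num) (by norm_num))
  have hzC : ‖z‖ ≤ C * F := hz.trans (by gcongr; exact hCk (by norm_num) (by norm_num))
  have hEvC : ‖E θ v‖ ≤ C * F := by
    calc _ ≤ M ^ 2 * (2 * M ^ 6 * F) := (hE.norm_le hB hθ hvV).trans (by gcongr)
      _ = 2 * M ^ 8 * F := by ring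
      _ ≤ C * F := by gcongr; exact hCk (by norm_num) (by norm_num)
  have hθ2z : ‖θ‖ ^ 2 * ‖z‖ ≤ C * F * ε ^ 2 := hθz.trans (by gcongr)
  have hθzC : ‖θ‖ * ‖z‖ ≤ C * F * ε :=
    hθz1.trans (by gcongr; exact hCk (by norm_num) (by norm_num))
  obtain ⟨x, hx, z', hz', w, rfl, hxQ, hz'Q, hθz'Q, hwQ⟩ := hB.exists_decomposition hθ hε hQ hu hq
  obtain ⟨v', hv', rfl⟩ := (hE.bijOn θ hθ).surjOn hx
  have h7C : 6 * M ^ 7 ≤ C := hCk (by norm_num) (by norm_num)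
  have hEv'C : ‖E θ v'‖ ≤ C * Q := hxQ.trans (by gcongr)
  have hv'C : ‖v'‖ ≤ C * Q := by
    calc _ ≤ M ^ 2 * (6 * M ^ 7 * Q) := (hE.le_norm hB hθ hv').trans (by gcongr)
      _ = 6 * M ^ 9 * Q := by ring
      _ ≤ C * Q := by gcongr; exact hCk (by norm_num) (by norm_num)
  have hz'C : ‖z'‖ ≤ C * Q := hz'Q.trans (by gcongr)
  have hθz'C : ‖θ‖ * ‖z'‖ ≤ C * ε * Q := hθz'Q.trans (by gcongr)
  have hwC : ‖w‖ ≤ C * ε * Q := hwQ.trans (by gcongr)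
  set s : ℝ := (ε ^ 2)⁻¹ with hs
  have hs0 : 0 ≤ s := by positivity
  have hsε : s * ε ^ 2 = 1 := inv_mul_cancel₀ (by positivity)
  have hsn : ‖(s : ℂ)‖ = s := by rw [Complex.norm_real, Real.norm_eq_abs, abs_of_nonneg hs0]
  have hhom : homForm a b a₁ a₂ (ε⁻¹ • θ) z z' = s * homForm a b a₁ a₂ θ z z' := by
    rw [hB.homForm_real_smul, hs]
    push_cast
    rw [inv_pow]
  have heq := heqn v' hv' z' hz'
  rw [hhom] at heq
  have hiso : (b θ).form (E θ v) (E θ v') = (b 0).form v v' := hE.isometric θ hθ v hvV v' hv'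
  set T : ℝ := D * C ^ 2 * F * ε * Q with hT
  have t0 : ‖f w‖ ≤ C * F * ε * Q := by
    calc _ ≤ F * (C * ε * Q) := (hF w).trans (by gcongr)
      _ = C * F * ε * Q := by ring
  -- Of the three powers of `θ`, two go with `z` and cancel `ε⁻²`; the third goes with `z'` and
  -- leaves one `ε`.
  have t1 : ‖(s : ℂ) * ((a θ).form (z + N) z' - homForm a b a₁ a₂ θ z z')‖ ≤ T := by
    rw [norm_mul, hsn]
    calc _ ≤ s * (3 * M ^ 3 * ‖θ‖ ^ 3 * ‖z‖ * ‖z'‖) := by gcongr; exact hspec2 z'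
      _ ≤ s * (D * ‖θ‖ ^ 3 * ‖z‖ * ‖z'‖) := by gcongr; exact hDk (by norm_num) (by norm_num)
      _ = s * D * (‖θ‖ ^ 2 * ‖z‖) * (‖θ‖ * ‖z'‖) := by ring
      _ ≤ s * D * (C * F * ε ^ 2) * (C * ε * Q) := by gcongr
      _ = (s * ε ^ 2) * (D * C ^ 2 * F * ε * Q) := by ring
      _ = T := by rw [hsε, one_mul]
  have t2 : ‖(s : ℂ) * (a θ).form (z + N) w‖ ≤ T := by
    rw [norm_mul, hsn]
    calc _ ≤ s * (8 * M ^ 5 * ‖θ‖ ^ 2 * ‖z‖ * ‖w‖) := by gcongr; exact hspec1 w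
      _ ≤ s * (D * ‖θ‖ ^ 2 * ‖z‖ * ‖w‖) := by gcongr; exact hDk (by norm_num) (by norm_num)
      _ = s * D * (‖θ‖ ^ 2 * ‖z‖) * ‖w‖ := by ring
      _ ≤ s * D * (C * F * ε ^ 2) * (C * ε * Q) := by gcongr
      _ = (s * ε ^ 2) * (D * C ^ 2 * F * ε * Q) := by ring
      _ = T := by rw [hsε, one_mul]
  have t3 : ‖(b θ).form (E θ v + (z + N)) w‖ ≤ 3 * T := by
    have h1 : ‖E θ v + (z + N)‖ ≤ 3 * (C * F) := by
      have h2 := norm_add_le (E θ v) (z + N)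
      have h3 := norm_add_le (z : H) N
      have h4 : C * F * ε ≤ C * F * 1 := by gcongr
      have h5 : ‖((z : (a 0).ker) : H)‖ = ‖z‖ := rfl
      linarith
    calc _ ≤ M ^ 2 * ‖E θ v + (z + N)‖ * ‖w‖ := hB.norm_b_le hθ _ _
      _ ≤ D * (3 * (C * F)) * (C * ε * Q) := by gcongr
      _ = 3 * T := by rw [hT]; ring
  have t4 : ‖(b θ).form N (E θ v' + z')‖ ≤ 2 * T := by
    have h1 : ‖E θ v' + z'‖ ≤ 2 * (C * Q) := by
      have h2 := norm_add_le (E θ v') z'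
      have h5 : ‖((z' : (a 0).ker) : H)‖ = ‖z'‖ := rfl
      linarith
    calc _ ≤ M ^ 2 * ‖N‖ * ‖E θ v' + z'‖ := hB.norm_b_le hθ _ _
      _ ≤ D * (C * F * ε) * (2 * (C * Q)) := by gcongr
      _ = 2 * T := by rw [hT]; ring
  have t5 : ‖(b θ).form z (E θ v') - (b 0).form z v'‖ ≤ T := by
    rw [← RCLike.norm_conj, map_sub, NonnegForm.conj_symm, NonnegForm.conj_symm]
    calc _ ≤ |Kb| * M ^ 2 * ‖θ‖ * ‖v'‖ * ‖z‖ := hE.norm_near_le hB hθ hv' hzZ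
      _ ≤ D * ‖θ‖ * ‖v'‖ * ‖z‖ := by gcongr
      _ = D * ‖v'‖ * (‖θ‖ * ‖z‖) := by ring
      _ ≤ D * (C * Q) * (C * F * ε) := by gcongr
      _ = T := by rw [hT]; ring
  have t6 : ‖(b θ).form (E θ v) z' - (b 0).form v z'‖ ≤ T := by
    calc _ ≤ |Kb| * M ^ 2 * ‖θ‖ * ‖v‖ * ‖z'‖ := hE.norm_near_le hB hθ hvV hz'
      _ ≤ D * ‖θ‖ * ‖v‖ * ‖z'‖ := by gcongr
      _ = D * ‖v‖ * (‖θ‖ * ‖z'‖) := by ring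
      _ ≤ D * (C * F) * (C * ε * Q) := by gcongr
      _ = T := by rw [hT]; ring
  have t7 : ‖(b θ).form z z' - (b 0).form z z'‖ ≤ T := by
    calc _ ≤ M * ‖θ‖ * ‖z‖ * ‖z'‖ := hB.lipschitz_b θ hθ z z'
      _ ≤ D * ‖θ‖ * ‖z‖ * ‖z'‖ := by gcongr
      _ = D * (‖θ‖ * ‖z‖) * ‖z'‖ := by ring
      _ ≤ D * (C * F * ε) * (C * Q) := by gcongr
      _ = T := by rw [hT]; ring
  have hEk := hE.mem_ker hB hθ hvV
  have hEk' := hE.mem_ker hB hθ hv'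
  -- The approximating equation is subtracted. Terms with `a_θ` and `E θ v` or `E θ v'` vanish since
  -- these lie in the kernel, and `b_θ(E θ v, E θ v')` cancels by isometry.
  have hsplit : f (E θ v' + z' + w) - ((s : ℂ) * (a θ).form (E θ v + (z + N)) (E θ v' + z' + w) +
      (b θ).form (E θ v + (z + N)) (E θ v' + z' + w)) =
      f w - (s : ℂ) * ((a θ).form (z + N) z' - homForm a b a₁ a₂ θ z z')
        - (s : ℂ) * (a θ).form (z + N) w - (b θ).form (E θ v + (z + N)) w
        - (b θ).form N (E θ v' + z') - ((b θ).form z (E θ v') - (b 0).form z v')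
        - ((b θ).form (E θ v) z' - (b 0).form v z')
        - ((b θ).form z z' - (b 0).form z z') := by
    rw [_root_.map_add f, ← heq]
    simp only [_root_.map_add, LinearMap.add_apply, (a θ).apply_ker_left hEk,
      (a θ).apply_ker_right hEk', hiso]
    ring
  rw [hsplit]
  have hfin : (C + 10 * D * C ^ 2) * F * ε * Q = C * F * ε * Q + 10 * T := by rw [hT]; ring
  rw [hfin]
  have n7 := norm_sub_le (f w - (s : ℂ) * ((a θ).form (z + N) z' - homForm a b a₁ a₂ θ z z')
        - (s : ℂ) * (a θ).form (z + N) w - (b θ).form (E θ v + (z + N)) w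
        - (b θ).form N (E θ v' + z') - ((b θ).form z (E θ v') - (b 0).form z v')
        - ((b θ).form (E θ v) z' - (b 0).form v z')) ((b θ).form z z' - (b 0).form z z')
  have n6 := norm_sub_le (f w - (s : ℂ) * ((a θ).form (z + N) z' - homForm a b a₁ a₂ θ z z')
        - (s : ℂ) * (a θ).form (z + N) w - (b θ).form (E θ v + (z + N)) w
        - (b θ).form N (E θ v' + z') - ((b θ).form z (E θ v') - (b 0).form z v'))
        ((b θ).form (E θ v) z' - (b 0).form v z')
  have n5 := norm_sub_le (f w - (s : ℂ) * ((a θ).form (z + N) z' - homForm a b a₁ a₂ θ z z')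
        - (s : ℂ) * (a θ).form (z + N) w - (b θ).form (E θ v + (z + N)) w
        - (b θ).form N (E θ v' + z')) ((b θ).form z (E θ v') - (b 0).form z v')
  have n4 := norm_sub_le (f w - (s : ℂ) * ((a θ).form (z + N) z' - homForm a b a₁ a₂ θ z z')
        - (s : ℂ) * (a θ).form (z + N) w - (b θ).form (E θ v + (z + N)) w)
        ((b θ).form N (E θ v' + z'))
  have n3 := norm_sub_le (f w - (s : ℂ) * ((a θ).form (z + N) z' - homForm a b a₁ a₂ θ z z')
        - (s : ℂ) * (a θ).form (z + N) w) ((b θ).form (E θ v + (z + N)) w)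
  have n2 := norm_sub_le (f w - (s : ℂ) * ((a θ).form (z + N) z' - homForm a b a₁ a₂ θ z z'))
        ((s : ℂ) * (a θ).form (z + N) w)
  have n1 := norm_sub_le (f w)
        ((s : ℂ) * ((a θ).form (z + N) z' - homForm a b a₁ a₂ θ z z'))
  linarith

/-- The error estimates. -/
theorem error_estimates (hE : IsTransfer Θ a b Vs Z Kb E) (hθ : θ ∈ Θ) {ε : ℝ}
    (hε : 0 < ε) (hε1 : ε < 1) {f : H →L⋆[ℂ] ℂ} {u v : H} {z : (a 0).ker}
    (hu : IsSolution a b ε θ f u) (hvz : IsApproxSolution a b a₁ a₂ Vs Z E ε θ f v z)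
    {C D K : ℝ} (hC : 24 * M ^ 10 = C) (hD : 8 * M ^ 5 + |Kb| * M ^ 2 = D)
    (hK : (C + 10 * D * C ^ 2) * M ^ 2 = K) :
    (ε ^ 2)⁻¹ * (a θ).quad (u - (E θ v + (z + corrector a b a₁ θ z))) +
        (b θ).quad (u - (E θ v + (z + corrector a b a₁ θ z))) ≤
      K ^ 2 * ε ^ 2 * (ip a b θ).dualNorm f ^ 2 ∧
    (b θ).quad (u - (E θ v + z)) ≤
      (2 * K ^ 2 + 2 * M ^ 4 * C ^ 2) * ε ^ 2 * (ip a b θ).dualNorm f ^ 2 := by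
  have hM := hB.pos
  set G := (ip a b θ).dualNorm f with hG
  have hG0 : 0 ≤ G := NonnegForm.dualNorm_nonneg _ _
  have hF : ∀ x, ‖f x‖ ≤ M * G * ‖x‖ := fun x => by
    calc ‖f x‖ ≤ G * (ip a b θ).nrm x := NonnegForm.norm_apply_le_dualNorm (hB.equiv θ hθ) f x
      _ ≤ G * (M * ‖x‖) := by gcongr; exact (hB.equiv θ hθ).nrm_le x
      _ = M * G * ‖x‖ := by ring
  have hF0 : 0 ≤ M * G := by positivity
  have hC0 : 0 ≤ C := by rw [← hC]; positivity
  have hD0 : 0 ≤ D := by rw [← hD]; positivity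
  have hs : 1 ≤ (ε ^ 2)⁻¹ := (one_le_inv₀ (by positivity)).mpr (pow_le_one₀ hε.le hε1.le)
  set N := corrector a b a₁ θ z with hN
  set r := u - (E θ v + (z + N)) with hr
  set s : ℝ := (ε ^ 2)⁻¹ with hsdef
  have hsε : ε ^ 2 * s = 1 := mul_inv_cancel₀ (by positivity)
  have ha0 := (a θ).quad_nonneg r
  have hb0 := (b θ).quad_nonneg r
  set q : ℝ := s * (a θ).quad r + (b θ).quad r with hq
  have hq0 : 0 ≤ q := by positivity
  have hqs : Real.sqrt q ^ 2 = q := Real.sq_sqrt hq0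
  -- As `ε⁻² ≥ 1`, the energy dominates the inner product at `θ`; so `Q = M √q` is admissible in the
  -- residual bound.
  have hrn : ‖r‖ ≤ M * Real.sqrt q := by
    refine ((hB.equiv θ hθ).norm_le r).trans ?_
    gcongr
    apply Real.sqrt_le_sqrt
    rw [ip_quad, hq]
    nlinarith
  have hra : (a θ).quad r ≤ ε ^ 2 * (M * Real.sqrt q) ^ 2 := by
    have h1 : (a θ).quad r ≤ ε ^ 2 * q := by
      rw [hq, mul_add, ← mul_assoc, hsε, one_mul]
      have : 0 ≤ ε ^ 2 * (b θ).quad r := by positivity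
      linarith
    refine h1.trans ?_
    rw [mul_pow, hqs]
    gcongr
    exact le_mul_of_one_le_left hq0 (one_le_pow₀ hB.one_le)
  obtain ⟨hNle, hres⟩ := hB.norm_residual_le hE hθ hε hε1 hF hF0 hvz hC.le hD.le
    (show 0 ≤ M * Real.sqrt q by positivity) hrn hra
  rw [← hN] at hNle hres
  -- The equation for `u`, tested with `r`, identifies the residual at `r` with the energy `q`.
  have hqle : q ≤ K * G * ε * Real.sqrt q := by
    have h1 : (s : ℂ) * (a θ).form u r + (b θ).form u r = f r := hu r
    rw [← h1] at hres
    have h2 : (s : ℂ) * (a θ).form u r + (b θ).form u r -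
        ((s : ℂ) * (a θ).form (E θ v + (z + N)) r + (b θ).form (E θ v + (z + N)) r) = (q : ℂ) := by
      have h3 : (a θ).form u r = (a θ).form r r + (a θ).form (E θ v + (z + N)) r := by
        rw [← LinearMap.add_apply, ← map_add, hr, sub_add_cancel]
      have h4 : (b θ).form u r = (b θ).form r r + (b θ).form (E θ v + (z + N)) r := by
        rw [← LinearMap.add_apply, ← map_add, hr, sub_add_cancel]
      rw [h3, h4, NonnegForm.self_eq_quad, NonnegForm.self_eq_quad, hq]
      push_cast
      ring
    rw [h2, Complex.norm_real, Real.norm_eq_abs, abs_of_nonneg hq0] at hres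
    calc q ≤ _ := hres
      _ = K * G * ε * Real.sqrt q := by rw [← hK]; ring
  have hK0 : 0 ≤ K := by rw [← hK]; positivity
  have hsq : Real.sqrt q ≤ K * G * ε := by
    by_cases h0 : Real.sqrt q = 0
    · rw [h0]; positivity
    have h0' : 0 < Real.sqrt q := lt_of_le_of_ne (Real.sqrt_nonneg _) (Ne.symm h0)
    refine le_of_mul_le_mul_right ?_ h0'
    rw [← sq, hqs]
    exact hqle
  have hfirst : q ≤ K ^ 2 * ε ^ 2 * G ^ 2 := by
    rw [← hqs]
    calc _ ≤ (K * G * ε) ^ 2 := by gcongr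
      _ = _ := by ring
  refine ⟨hfirst, ?_⟩
  -- Dropping the corrector is harmless in `b_θ`, since `‖N‖ ≲ ε`; in `ε⁻² a_θ` it would not be
  -- negligible.
  have h1 : u - (E θ v + z) = r + N := by rw [hr]; abel
  have h2 : (b θ).quad N ≤ M ^ 4 * C ^ 2 * ε ^ 2 * G ^ 2 := by
    calc (b θ).quad N ≤ ‖(b θ).form N N‖ := Complex.re_le_norm _
      _ ≤ M ^ 2 * ‖N‖ * ‖N‖ := hB.norm_b_le hθ N N
      _ ≤ M ^ 2 * (C * (M * G) * ε) * (C * (M * G) * ε) := by gcongr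
      _ = _ := by ring
  have h3 : (b θ).quad r ≤ q := by
    rw [hq]
    have : 0 ≤ s * (a θ).quad r := by positivity
    linarith
  rw [h1]
  have h4 := (b θ).quad_add_le r N
  linarith

end Bounds

end Estimate

end Degenerating

/-! ### Existence of transfer operators -/

namespace Degenerating

variable {n : ℕ} {H : Type*} [NormedAddCommGroup H] [InnerProductSpace ℂ H]

section TransferExistence

open Filter Topology

variable [CompleteSpace H] {Θ : Set (EuclideanSpace ℝ (Fin n))}
  {a b : EuclideanSpace ℝ (Fin n) → NonnegForm H}
  {Vs : Submodule ℂ H} {Z : Submodule ℂ (a 0).ker}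
  {a₁ : (a 0).ker →ₗ[ℂ] H →ₗ⋆[ℂ] (Fin n → ℂ)}
  {a₂ : (a 0).ker →ₗ[ℂ] (a 0).ker →ₗ⋆[ℂ] Matrix (Fin n) (Fin n) ℂ} {M : ℝ}
  {θ : EuclideanSpace ℝ (Fin n)}

omit [CompleteSpace H] in
theorem VStar_zero : VStar a Vs 0 = Vs := if_pos rfl

/-- `e` is an isometric bijection from `V_{θ₁}^⋆` to `V_{θ₂}^⋆`. -/
def IsIsometric (a b : EuclideanSpace ℝ (Fin n) → NonnegForm H) (Vs : Submodule ℂ H)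
    (θ₁ θ₂ : EuclideanSpace ℝ (Fin n)) (e : H → H) : Prop :=
  Set.BijOn e (VStar a Vs θ₁) (VStar a Vs θ₂) ∧
    ∀ u ∈ VStar a Vs θ₁, ∀ v ∈ VStar a Vs θ₁,
      (ip a b θ₂).form (e u) (e v) = (ip a b θ₁).form u v

omit [CompleteSpace H] in
theorem IsIsometric.trans {θ₁ θ₂ θ₃ : EuclideanSpace ℝ (Fin n)} {e e' : H → H}
    (h : IsIsometric a b Vs θ₁ θ₂ e) (h' : IsIsometric a b Vs θ₂ θ₃ e') :
    IsIsometric a b Vs θ₁ θ₃ (e' ∘ e) :=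
  ⟨h'.1.comp h.1, fun u hu v hv =>
    (h'.2 _ (h.1.mapsTo hu) _ (h.1.mapsTo hv)).trans (h.2 u hu v hv)⟩

namespace Bounds

variable (hB : Bounds Θ a b Vs Z a₁ a₂ M)
include hB

theorem exists_isIsometric_of_near {θ₁ θ₂ : EuclideanSpace ℝ (Fin n)} (h₁ : θ₁ ∈ Θ) (h₂ : θ₂ ∈ Θ)
    (h : M ^ 3 * ‖θ₁ - θ₂‖ < 1) : ∃ e, IsIsometric a b Vs θ₁ θ₂ e := by
  have hM := hB.pos
  obtain ⟨e, he, hiso, -⟩ := NonnegForm.exists_isometric_bijOn (hB.equiv θ₁ h₁) (hB.equiv θ₂ h₂)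
    (hB.isClosed_VStar h₁) (hB.isClosed_VStar h₂) (η := M * ‖θ₁ - θ₂‖) (by positivity)
    (by linarith) (hB.near θ₁ h₁ θ₂ h₂) (by
      rw [norm_sub_rev]
      exact hB.near θ₂ h₂ θ₁ h₁)
  exact ⟨e, he, hiso⟩

/-- Parameters closer than `M⁻³` are related in both directions and the relation is transitive, so
connectedness links `0` to every `θ`. No closeness to the identity survives the composition. -/
theorem exists_isIsometric (hΘ : IsPreconnected Θ) (hθ : θ ∈ Θ) :
    ∃ e, IsIsometric a b Vs 0 θ e := by
  have hM := hB.pos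
  refine hΘ.induction₂' (fun x y => ∃ e, IsIsometric a b Vs x y e) (fun x hx => ?_)
    (fun x y z _ _ _ hxy hyz => ?_) hB.zero_mem hθ
  · have hball : Metric.ball x (M ^ 3)⁻¹ ∈ 𝓝[Θ] x :=
      mem_nhdsWithin_of_mem_nhds (Metric.ball_mem_nhds x (by positivity))
    filter_upwards [hball, self_mem_nhdsWithin] with y hy hyΘ
    rw [Metric.mem_ball, dist_eq_norm] at hy
    have h := mul_lt_mul_of_pos_left hy (show 0 < M ^ 3 by positivity)
    rw [mul_inv_cancel₀ (by positivity)] at h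
    exact ⟨hB.exists_isIsometric_of_near hx hyΘ (by rwa [norm_sub_rev]),
      hB.exists_isIsometric_of_near hyΘ hx h⟩
  · obtain ⟨e, he⟩ := hxy
    obtain ⟨e', he'⟩ := hyz
    exact ⟨_, he.trans he'⟩

/-- Near `θ = 0` the isometric bijection can be chosen close to the identity. -/
theorem exists_isIsometric_near_id (hθ : θ ∈ Θ) (hsmall : ‖θ‖ * (6 * M ^ 5) ≤ 1) :
    ∃ e, IsIsometric a b Vs 0 θ e ∧ ∀ v ∈ Vs, ‖e v - v‖ ≤ 7 * M ^ 9 * ‖θ‖ * ‖v‖ := by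
  have hM := hB.pos
  have hM1 := hB.one_le
  have hpow : ∀ {i j : ℕ}, i ≤ j → M ^ i * ‖θ‖ ≤ M ^ j * ‖θ‖ := fun hij =>
    mul_le_mul_of_nonneg_right (pow_le_pow_right₀ hM1 hij) (norm_nonneg θ)
  have h35 := hpow (show 3 ≤ 5 by norm_num)
  obtain ⟨e, he, hiso, hnear⟩ := NonnegForm.exists_isometric_bijOn (hB.equiv 0 hB.zero_mem)
    (hB.equiv θ hθ) (hB.isClosed_VStar hB.zero_mem) (hB.isClosed_VStar hθ)
    (η := M * ‖θ‖) (by positivity) (by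
      have : 0 ≤ M ^ 5 * ‖θ‖ := by positivity
      linarith)
    (by simpa using hB.near 0 hB.zero_mem θ hθ)
    (by simpa using hB.near θ hθ 0 hB.zero_mem)
  refine ⟨e, ⟨he, hiso⟩, ?_⟩
  -- On `V_⋆` one `M ‖θ‖` comes from `a_θ`, as `a_0` vanishes there, and one from `b_θ - b_0`. The
  -- smallness condition then reads `(2M + M³) M² ‖θ‖ ≤ 3 M⁵ ‖θ‖ ≤ 1/2`.
  have h1 := hnear (2 * M * ‖θ‖) (by linarith) ?_
  · intro v hv
    refine (h1 v (by rwa [VStar_zero])).trans ?_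
    have h39 := hpow (show 3 ≤ 9 by norm_num)
    have h79 := hpow (show 7 ≤ 9 by norm_num)
    gcongr
    linarith
  · intro u hu v hv
    rw [VStar_zero] at hu hv
    have h2 := hB.norm_a_ker_le hθ ⟨u, hB.le_ker hu⟩ v
    have h3 := hB.lipschitz_b θ hθ ⟨u, hB.le_ker hu⟩ ⟨v, hB.le_ker hv⟩
    have h4 : (ip a b θ).form u v - (ip a b 0).form u v =
        (a θ).form u v + ((b θ).form u v - (b 0).form u v) := by
      rw [ip, ip, NonnegForm.add_apply, NonnegForm.add_apply,
        (a 0).apply_ker_left (hB.le_ker hu)]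
      ring
    rw [h4]
    have h5 := norm_add_le ((a θ).form u v) ((b θ).form u v - (b 0).form u v)
    simp only [Submodule.coe_norm] at h2 h3
    linarith

/-- Families of transfer operators exist. -/
theorem exists_isTransfer (hΘ : IsPreconnected Θ) :
    ∃ (Kb : ℝ) (E : EuclideanSpace ℝ (Fin n) → H → H), 0 ≤ Kb ∧ IsTransfer Θ a b Vs Z Kb E := by
  have hM := hB.pos
  have hM1 := hB.one_le
  have hex : ∀ θ, ∃ e : H → H, θ ∈ Θ → IsIsometric a b Vs 0 θ e ∧
      (‖θ‖ * (6 * M ^ 5) ≤ 1 → ∀ v ∈ Vs, ‖e v - v‖ ≤ 7 * M ^ 9 * ‖θ‖ * ‖v‖) := by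
    intro θ
    by_cases hθ : θ ∈ Θ
    · by_cases hsmall : ‖θ‖ * (6 * M ^ 5) ≤ 1
      · obtain ⟨e, he, he'⟩ := hB.exists_isIsometric_near_id hθ hsmall
        exact ⟨e, fun _ => ⟨he, fun _ => he'⟩⟩
      · obtain ⟨e, he⟩ := hB.exists_isIsometric hΘ hθ
        exact ⟨e, fun _ => ⟨he, fun h => absurd h hsmall⟩⟩
    · exact ⟨id, fun h => absurd h hθ⟩
  choose E hE using hex
  refine ⟨12 * M ^ 13, E, by positivity, fun θ hθ => ?_, fun θ hθ v hv v' hv' => ?_,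
    fun θ hθ v hv z hz => ?_⟩
  · have h := (hE θ hθ).1.1
    rwa [VStar_zero] at h
  · obtain ⟨⟨hbij, hiso⟩, -⟩ := hE θ hθ
    rw [VStar_zero] at hbij hiso
    have h := hiso v hv v' hv'
    rw [ip, ip, NonnegForm.add_apply, NonnegForm.add_apply, (a 0).apply_ker_left (hB.le_ker hv),
      (a θ).apply_ker_left (hB.VStar_le_ker θ (hbij.mapsTo hv)), zero_add, zero_add] at h
    exact h
  · obtain ⟨⟨hbij, hiso⟩, hnear⟩ := hE θ hθ
    rw [VStar_zero] at hbij hiso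
    have hmain : ‖(b θ).form (E θ v) z - (b 0).form v z‖ ≤ 12 * M ^ 11 * ‖θ‖ * ‖v‖ * ‖z‖ := by
      -- Near `0` closeness to the identity gives the factor `‖θ‖`. Otherwise `1 ≤ 6 M⁵ ‖θ‖`, and
      -- the crude bound `2 M⁴` becomes `12 M⁹ ‖θ‖`.
      by_cases hsmall : ‖θ‖ * (6 * M ^ 5) ≤ 1
      · have h1 := hB.norm_b_le hθ (E θ v - v) z
        have h2 := hB.lipschitz_b θ hθ ⟨v, hB.le_ker hv⟩ z
        have h3 : (b θ).form (E θ v) z - (b 0).form v z =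
            (b θ).form (E θ v - v) z + ((b θ).form v z - (b 0).form v z) := by
          rw [map_sub, LinearMap.sub_apply]; ring
        rw [h3]
        have h4 := norm_add_le ((b θ).form (E θ v - v) z) ((b θ).form v z - (b 0).form v z)
        have h5 : M ^ 2 * ‖E θ v - v‖ * ‖(z : H)‖ ≤
            M ^ 2 * (7 * M ^ 9 * ‖θ‖ * ‖v‖) * ‖(z : H)‖ := by
          have := hnear hsmall v hv
          gcongr
        have h6 : M * (‖θ‖ * ‖v‖ * ‖z‖) ≤ M ^ 11 * (‖θ‖ * ‖v‖ * ‖z‖) := by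
          gcongr
          exact le_self_pow₀ hM1 (by norm_num)
        have h7 : 0 ≤ M ^ 11 * (‖θ‖ * ‖v‖ * ‖z‖) := by positivity
        simp only [Submodule.coe_norm] at h2 h6 h7 ⊢
        linarith
      · have h1 := hB.norm_b_le hθ (E θ v) z
        have h2 := hB.norm_b_le hB.zero_mem v z
        have h3 := norm_sub_le ((b θ).form (E θ v) z) ((b 0).form v z)
        have h4 : ‖E θ v‖ ≤ M ^ 2 * ‖v‖ := by
          have h5 : (ip a b θ).nrm (E θ v) = (ip a b 0).nrm v :=
            congrArg (fun x : ℂ => Real.sqrt x.re) (hiso v hv v hv)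
          calc ‖E θ v‖ ≤ M * (ip a b θ).nrm (E θ v) := (hB.equiv θ hθ).norm_le _
            _ ≤ M * (M * ‖v‖) := by
                rw [h5]
                gcongr
                exact (hB.equiv 0 hB.zero_mem).nrm_le v
            _ = M ^ 2 * ‖v‖ := by ring
        have h5 : M ^ 2 * ‖E θ v‖ * ‖(z : H)‖ ≤ M ^ 2 * (M ^ 2 * ‖v‖) * ‖(z : H)‖ := by gcongr
        have h6 : M ^ 2 * (‖v‖ * ‖z‖) ≤ M ^ 4 * (‖v‖ * ‖z‖) := by
          gcongr
          norm_num
        have h7 : 1 * (M ^ 4 * (‖v‖ * ‖z‖)) ≤ (‖θ‖ * (6 * M ^ 5)) * (M ^ 4 * (‖v‖ * ‖z‖)) := by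
          gcongr
          exact (not_le.mp hsmall).le
        have h8 : M ^ 9 * (‖θ‖ * ‖v‖ * ‖z‖) ≤ M ^ 11 * (‖θ‖ * ‖v‖ * ‖z‖) := by
          gcongr
          norm_num
        simp only [Submodule.coe_norm] at h6 h7 h8 ⊢
        linarith
    have h1 := (hB.equiv 0 hB.zero_mem).norm_le v
    have h2 := (hB.equiv 0 hB.zero_mem).norm_le z
    have h3 := (ip a b 0).nrm_nonneg v
    calc ‖(b θ).form (E θ v) z - (b 0).form v z‖ ≤ 12 * M ^ 11 * ‖θ‖ * ‖v‖ * ‖(z : H)‖ := hmain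
      _ ≤ 12 * M ^ 11 * ‖θ‖ * (M * (ip a b 0).nrm v) * (M * (ip a b 0).nrm z) := by gcongr
      _ = 12 * M ^ 13 * ‖θ‖ * (ip a b 0).nrm v * (ip a b 0).nrm z := by ring

end Bounds

end TransferExistence

end Degenerating

/-! ### The theorem -/

theorem mainTheorem1 {n : ℕ} (hn : 1 ≤ n)
    {H : Type*} [NormedAddCommGroup H] [InnerProductSpace ℂ H] [CompleteSpace H]
    [TopologicalSpace.SeparableSpace H]
    (Θ : Set (EuclideanSpace ℝ (Fin n)))
    (a b : EuclideanSpace ℝ (Fin n) → NonnegForm H)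
    (Vs : Submodule ℂ H) (Z : Submodule ℂ (a 0).ker)
    (a₁ : (a 0).ker →ₗ[ℂ] H →ₗ⋆[ℂ] (Fin n → ℂ))
    (a₂ : (a 0).ker →ₗ[ℂ] (a 0).ker →ₗ⋆[ℂ] Matrix (Fin n) (Fin n) ℂ)
    (hS : Degenerating.Standing Θ a b)
    (hH1 : Degenerating.GapCondition Θ a b)
    (hH2 : Degenerating.RemovableSingularity Θ a b Vs)
    (hZ : Degenerating.IsDefectSubspace a b Vs Z)
    (hH3 : Degenerating.QuadraticGap Θ a b)
    (hH4 : Degenerating.Differentiability Θ a b a₁ a₂)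
    (hH5 : Degenerating.LipschitzAtZero Θ a b) :
    -- the linearised cell problem, which defines the corrector `N_θ`, is well-posed
    (∀ (θ : EuclideanSpace ℝ (Fin n)) (v : (a 0).ker),
      ∃! w : H, Degenerating.IsCellSolution a b a₁ θ v w) ∧
    -- families of transfer operators exist
    (∃ (Kb : ℝ) (E : EuclideanSpace ℝ (Fin n) → H → H),
      0 ≤ Kb ∧ Degenerating.IsTransfer Θ a b Vs Z Kb E) ∧
    -- well-posedness and error estimates, for every family of transfer operators
    (∀ Kb : ℝ, ∃ C₉ C₁₀ : ℝ, ∀ E : EuclideanSpace ℝ (Fin n) → H → H,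
      Degenerating.IsTransfer Θ a b Vs Z Kb E →
      ∀ ε : ℝ, 0 < ε → ε < 1 → ∀ θ ∈ Θ, ∀ f : H →L⋆[ℂ] ℂ,
        (∃! u : H, Degenerating.IsSolution a b ε θ f u) ∧
        (∃! p : H × (a 0).ker,
          Degenerating.IsApproxSolution a b a₁ a₂ Vs Z E ε θ f p.1 p.2) ∧
        ∀ (u v : H) (z : (a 0).ker), Degenerating.IsSolution a b ε θ f u →
          Degenerating.IsApproxSolution a b a₁ a₂ Vs Z E ε θ f v z →
          (ε ^ 2)⁻¹ * (a θ).quad (u - (E θ v + (z + Degenerating.corrector a b a₁ θ z))) +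
              (b θ).quad (u - (E θ v + (z + Degenerating.corrector a b a₁ θ z))) ≤
            C₉ * ε ^ 2 * (Degenerating.ip a b θ).dualNorm f ^ 2 ∧
          (b θ).quad (u - (E θ v + z)) ≤
            C₁₀ * ε ^ 2 * (Degenerating.ip a b θ).dualNorm f ^ 2) := by
  obtain ⟨M, hB⟩ := Degenerating.exists_bounds hS hH1 hH2 hZ hH3 hH4 hH5
  -- Unification with `error_estimates` fixes both constants; they depend only on `M` and `Kb`.
  refine ⟨hB.existsUnique_cellSolution, hB.exists_isTransfer hH5.isConnected.isPreconnected,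
    fun Kb => ⟨_, _, fun E hE ε hε hε1 θ hθ f => ⟨hB.existsUnique_solution hθ hε hε1 f,
      hB.existsUnique_approxSolution hE hθ ε f, fun u v z hu hvz =>
        hB.error_estimates hE hθ hε hε1 hu hvz rfl rfl rfl⟩⟩⟩
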